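/- **Theorem (Bethe ansatz equations).** *Setting.* Let $V$ be a finite-dimensional Euclidean space and $R\subset V^*$ a reduced, irreducible, crystallographic root system (not required to span $V^*$), with co-vectors $\xi^\vee\in V$ given by $\eta(\xi^\vee)=2\langle\eta,\xi\rangle/\langle\xi,\xi\rangle$ and Weyl group $W$, generated by the reflections $s_\alpha$ ($\alpha\in R$). Let $X\subset V^*$ be a full lattice containing $R$ whose dual lattice $Y\subset V$ contains all $\alpha^\vee$ ($\alpha\in R$), and let $W^a=W\ltimes Y$ be the extended affine Weyl group, acting on $V$ by isometries, with gradient map $D:W^a\to W$, $wt_y\mapsto w$. Let $R^a=R+\mathbb Z1$ be the set of affine roots, with reflections $s_a(v)=v-a(v)(Da)^\vee$, where $Da$ is the gradient of $a$. Fix a basis $F$ of $R$, with positive roots $R^+$ and highest root $\theta$; let $a_0=-\theta+1$, $F^a=F\cup\{a_0\}$, $R^{a,+}=(R+\mathbb Z_{>0}1)\cup R^+$, $R^{a,-}=-R^{a,+}$, and let $\Omega\subset W^a$ be the subgroup of elements of length $0$, where $l(w)=\#(R^{a,+}\cap w^{-1}R^{a,-})$. Let $k:R^a\to\mathbb C$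 be $W^a$-invariant, let $V_{\mathbb C}^*=\mathrm{Hom}_{\mathbb R}(V,\mathbb C)$ and $$C_k^{reg}=\{\lambda\in V_{\mathbb C}^*\mid 0\neq\lambda(Da^\vee)\neq k_a\ \ \forall a\in R^a\}.$$ For $\lambda\in C_k^{reg}$ let $J_w^k(\lambda)\in\mathbb C[W^a]$ ($w\in W^a$) be the cocycle determined by $$J_{s_a}^k(\lambda)=\frac{\lambda(Da^\vee)s_a+k_a}{\lambda(Da^\vee)-k_a}\ (a\in F^a),\qquad J_\omega^k(\lambda)=\omega\ (\omega\in\Omega),\qquad J_{\sigma\tau}^k(\lambda)=J_\sigma^k((D\tau)\lambda)J_\tau^k(\lambda)\ (\sigma,\tau\in W^a),$$ and write $J_y^k=J_{t_y}^k$ for $y\in Y$. For a complex left $W^a$-module $M$ let $C^\omega(V)$ be the space of complex-valued real analytic functions on $V$, and let $W^a$ act on $C^\omega(V)\otimes_{\mathbb C}M$ by the representation $Q_{k,M}$ determined by $$Q_{k,M}(s_a)=s_a\otimes s_a-k_aI(a)\otimes\mathrm{Id}_M\ (a\in F^a),\qquad Q_{k,M}(\omega)=\omega\otimes\omega\ (\omega\in\Omega),$$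 where $(I(a)f)(v)=\int_0^{a(v)}f(v-tDa^\vee)\,dt$ and $(wf)(v)=f(w^{-1}v)$ on $C^\omega(V)$. Let $F_{ir}^k(M)_\lambda$ be the space of all $f\in C^\omega(V)\otimes M$ with $p(\partial)f=p(\lambda)f$ for all $W$-invariant $p\in S(V_{\mathbb C})$, and let $F_{ir}^k(M)_\lambda^{W^a}$ be its subspace of $Q_{k,M}(W^a)$-invariants. *(i)* Let $\lambda\in C_k^{reg}$, let $M$ be a complex left $W^a$-module and $m\in M$, and let $$\psi_\lambda^m=\sum_{w\in W}e^{w\lambda}\otimes J_w^k(\lambda)m,\qquad e^{\mu}(v)=e^{\mu(v)}.$$ Then $\psi_\lambda^m\in F_{ir}^k(M)_\lambda^{W^a}$ if and only if $$J_y^k(\lambda)m=e^{\lambda(y)}m\qquad\text{for all }y\in Y.$$ *(ii)* Let $\lambda\in C_k^{reg}$, let $\mathbb I=\mathbb C$ be the trivial $W^a$-module, and let $c_k(\mu)=\prod_{\alpha\in R^+}\frac{\mu(\alpha^\vee)-k_\alpha}{\mu(\alpha^\vee)}$. Then $$\psi_\lambda=\frac1{c_k(\lambda)}\sum_{w\in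 W}c_k(w\lambda)e^{w\lambda}$$ lies in $F_{ir}^k(\mathbb I)_\lambda^{W^a}$ if and only if $j_y^k(\lambda)=e^{\lambda(y)}$ for all $y\in Y$, where $j_y^k(\lambda)=\prod_{\alpha\in R^+}\left(\frac{\lambda(\alpha^\vee)+k_\alpha}{\lambda(\alpha^\vee)-k_\alpha}\right)^{\alpha(y)}$ if $\theta(Y)=\mathbb Z$, and, in the remaining case $\theta(Y)=2\mathbb Z$, with $k_0=k_{a_0}$, $$j_y^k(\lambda)=\prod_{\alpha\in R^+\setminus W\theta}\left(\frac{\lambda(\alpha^\vee)+k_\alpha}{\lambda(\alpha^\vee)-k_\alpha}\right)^{\alpha(y)}\prod_{\beta\in R^+\cap W\theta}\left(\frac{\lambda(\beta^\vee)+k_\theta}{\lambda(\beta^\vee)-k_\theta}\right)^{\beta(y)/2}\left(\frac{\lambda(\beta^\vee)+k_0}{\lambda(\beta^\vee)-k_0}\right)^{\beta(y)/2}.$$ -/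

import Mathlib

open scoped TensorProduct Topology ENNReal NNReal

noncomputable section

namespace BetheAnsatz

/-! ### Analyticity of parameter integrals -/

set_option maxHeartbeats 400000 in
theorem analyticAt_primitive {V : Type*} [NormedAddCommGroup V] [NormedSpace ℝ V]
    {h : ℝ × V → ℂ} (s₀ : ℝ) (v₀ : V) (hh : AnalyticAt ℝ h (s₀, v₀)) :
    AnalyticAt ℝ (fun x : ℝ × V => ∫ t in s₀..x.1, h (t, x.2)) (s₀, v₀) := by
  obtain ⟨p, r, hp⟩ := hh
  let A : ℝ → (ℝ × V →L[ℝ] ℝ × V) := fun τ =>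
    (τ • ContinuousLinearMap.fst ℝ ℝ V).prod (ContinuousLinearMap.snd ℝ ℝ V)
  have hAapp : ∀ τ x, A τ x = (τ * x.1, x.2) := fun τ x => by simp [A]
  have hAc : Continuous A := by
    have : A = fun τ => τ • ((ContinuousLinearMap.fst ℝ ℝ V).prod (0 : ℝ × V →L[ℝ] V)) +
        (0 : ℝ × V →L[ℝ] ℝ).prod (ContinuousLinearMap.snd ℝ ℝ V) := by
      funext τ; ext x <;> simp [A]
    rw [this]; fun_prop
  have hAn : ∀ τ ∈ Set.Icc (0:ℝ) 1, ‖A τ‖ ≤ 1 := by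
    intro τ hτ
    refine ContinuousLinearMap.opNorm_le_bound _ zero_le_one fun x => ?_
    rw [hAapp, one_mul, Prod.norm_def, Prod.norm_def]
    refine max_le_max ?_ le_rfl
    simp only [norm_mul, Real.norm_eq_abs, abs_of_nonneg hτ.1]
    exact mul_le_of_le_one_left (abs_nonneg _) hτ.2
  let B : ∀ n : ℕ, ℝ → ContinuousMultilinearMap ℝ (fun _ : Fin n => ℝ × V) ℂ := fun n τ =>
    (p n).compContinuousLinearMap (fun _ => A τ)
  have hBc : ∀ n, Continuous (B n) := by
    intro n
    have h2 : Continuous fun τ : ℝ => (fun _ : Fin n => A τ) := continuous_pi fun _ => hAc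
    have h3 := (ContinuousMultilinearMap.compContinuousLinearMapContinuousMultilinear ℝ
      (fun _ : Fin n => ℝ × V) (fun _ : Fin n => ℝ × V) ℂ).cont.comp h2
    exact Continuous.clm_apply h3 (continuous_const (y := p n))
  have hBn : ∀ n, ∀ τ ∈ Set.Icc (0:ℝ) 1, ‖B n τ‖ ≤ ‖p n‖ := by
    intro n τ hτ
    refine ((p n).norm_compContinuousLinearMap_le _).trans ?_
    refine mul_le_of_le_one_right (norm_nonneg _) ?_
    exact Finset.prod_le_one (fun _ _ => norm_nonneg _) fun _ _ => hAn τ hτ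
  let q : FormalMultilinearSeries ℝ (ℝ × V) ℂ := fun n => ∫ τ in (0:ℝ)..1, B n τ
  have hq : ∀ n, ‖q n‖ ≤ ‖p n‖ := by
    intro n
    have := intervalIntegral.norm_integral_le_of_norm_le_const (a := (0:ℝ)) (b := 1) (f := B n)
      (C := ‖p n‖) (by
        intro x hx
        rw [Set.uIoc_of_le zero_le_one] at hx
        exact hBn n x ⟨hx.1.le, hx.2⟩)
    simpa using this
  have hG : HasFPowerSeriesOnBall
      (fun x : ℝ × V => ∫ τ in (0:ℝ)..1, h ((s₀, v₀) + A τ (x - (s₀, v₀)))) q (s₀, v₀) r := by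
    refine ⟨?_, hp.r_pos, ?_⟩
    · refine hp.r_le.trans ?_
      refine ENNReal.le_of_forall_nnreal_lt fun r' hr' => ?_
      obtain ⟨C, -, hC⟩ := p.norm_mul_pow_le_of_lt_radius hr'
      refine q.le_radius_of_bound C fun n => le_trans ?_ (hC n)
      gcongr
      exact hq n
    · intro y hy
      have hyr : ‖y‖₊ < p.radius := by
        have := hp.r_le
        have h2 : (‖y‖₊ : ℝ≥0∞) < r := by simpa [Metric.mem_eball, edist_zero_right, enorm] using hy
        exact h2.trans_le this
      have happ : ∀ n, q n (fun _ => y) = ∫ τ in (0:ℝ)..1, p n (fun _ => A τ y) := by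
        intro n
        have := (ContinuousMultilinearMap.apply ℝ (fun _ : Fin n => ℝ × V) ℂ
          (fun _ => y)).intervalIntegral_comp_comm (a := (0:ℝ)) (b := 1)
          (μ := MeasureTheory.volume) ((hBc n).intervalIntegrable 0 1)
        simpa [q, B] using this.symm
      simp only [happ, add_sub_cancel_left]
      refine intervalIntegral.hasSum_integral_of_dominated_convergence
        (fun n _ => ‖p n‖ * ‖y‖ ^ n) ?_ ?_ ?_ ?_ ?_
      · intro n
        have : Continuous fun τ => p n (fun _ => A τ y) := by
          refine (p n).cont.comp (continuous_pi fun _ => ?_)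
          simp only [hAapp]
          fun_prop
        exact this.aestronglyMeasurable
      · intro n
        refine Filter.Eventually.of_forall fun t ht => ?_
        rw [Set.uIoc_of_le zero_le_one] at ht
        refine ((p n).le_opNorm _).trans ?_
        simp only [Finset.prod_const, Finset.card_univ, Fintype.card_fin]
        gcongr
        exact ((A t).le_opNorm y).trans (mul_le_of_le_one_left (norm_nonneg _)
          (hAn t ⟨ht.1.le, ht.2⟩))
      · refine Filter.Eventually.of_forall fun t ht => ?_
        have hs := p.summable_norm_mul_pow hyr
        simp only [coe_nnnorm] at hs
        exact hs
      · exact intervalIntegrable_const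
      · refine Filter.Eventually.of_forall fun t ht => ?_
        rw [Set.uIoc_of_le zero_le_one] at ht
        refine hp.hasSum ?_
        have h2 : ‖A t y‖ ≤ ‖y‖ := ((A t).le_opNorm y).trans (mul_le_of_le_one_left (norm_nonneg _)
          (hAn t ⟨ht.1.le, ht.2⟩))
        rw [Metric.mem_eball, edist_zero_right] at hy ⊢
        refine lt_of_le_of_lt ?_ hy
        exact enorm_le_iff_norm_le.mpr h2
  have hG' := hG.analyticAt
  have hfst : AnalyticAt ℝ (fun x : ℝ × V => x.1 - s₀) (s₀, v₀) :=
    analyticAt_fst.sub analyticAt_const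
  refine (hfst.smul hG').congr (Filter.Eventually.of_forall fun x => ?_)
  simp only [hAapp]
  have := intervalIntegral.smul_integral_comp_add_mul (a := (0:ℝ)) (b := 1)
    (f := fun t => h (t, x.2)) (x.1 - s₀) s₀
  simp only [mul_zero, add_zero, mul_one, add_sub_cancel] at this
  rw [← this]
  simp [mul_comm]

theorem analyticAt_integral_param {V : Type*} [NormedAddCommGroup V] [NormedSpace ℝ V]
    {h : ℝ × V → ℂ} (hh : ∀ x, AnalyticAt ℝ h x) (v₀ : V) (b : ℝ) :
    AnalyticAt ℝ (fun v : V => ∫ t in (0:ℝ)..b, h (t, v)) v₀ := by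
  have hc : Continuous h := continuous_iff_continuousAt.2 fun x => (hh x).continuousAt
  have hi : ∀ (v : V) (a b : ℝ),
      IntervalIntegrable (fun t => h (t, v)) MeasureTheory.volume a b := fun v a b =>
    (hc.comp (by fun_prop : Continuous fun t : ℝ => (t, v))).intervalIntegrable a b
  let P : ℝ → Prop := fun b => AnalyticAt ℝ (fun v : V => ∫ t in (0:ℝ)..b, h (t, v)) v₀
  have hloc : IsLocallyConstant P := by
    rw [IsLocallyConstant.iff_eventually_eq]
    intro s₀
    have h1 := analyticAt_primitive s₀ v₀ (hh _)
    have h2 := h1.eventually_analyticAt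
    have h3 : ∀ᶠ s in 𝓝 s₀, AnalyticAt ℝ (fun x : ℝ × V => ∫ t in s₀..x.1, h (t, x.2)) (s, v₀) :=
      (by fun_prop : Continuous fun s : ℝ => (s, v₀)).continuousAt.eventually h2
    filter_upwards [h3] with s hs
    have h4 : AnalyticAt ℝ (fun v : V => ∫ t in s₀..s, h (t, v)) v₀ :=
      AnalyticAt.fun_comp (g := fun x : ℝ × V => ∫ t in s₀..x.1, h (t, x.2))
        (f := fun v : V => (s, v)) hs (analyticAt_const.prod analyticAt_id)
    refine propext ⟨fun h5 => ?_, fun h5 => ?_⟩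
    · refine (h5.sub h4).congr (Filter.Eventually.of_forall fun v => ?_)
      simp only [Pi.sub_apply]
      rw [← intervalIntegral.integral_add_adjacent_intervals (hi v 0 s₀) (hi v s₀ s)]
      ring
    · refine (h5.add h4).congr (Filter.Eventually.of_forall fun v => ?_)
      exact intervalIntegral.integral_add_adjacent_intervals (hi v 0 s₀) (hi v s₀ s)
  have h0 : P 0 := by
    simp only [P, intervalIntegral.integral_same]
    exact analyticAt_const
  have : P b = P 0 := hloc.apply_eq_of_preconnectedSpace _ _
  exact this.mpr h0

variable {V : Type*} [NormedAddCommGroup V] [InnerProductSpace ℝ V] [FiniteDimensional ℝ V]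

/-! ### Co-vectors and reflections -/

/-- The vector of `V` that represents a functional `ξ` through the scalar product. -/
def riesz (ξ : Module.Dual ℝ V) : V :=
  haveI : CompleteSpace V := FiniteDimensional.complete ℝ V
  (InnerProductSpace.toDual ℝ V).symm (LinearMap.toContinuousLinearMap ξ)

theorem inner_riesz (ξ : Module.Dual ℝ V) (v : V) : inner ℝ (riesz ξ) v = ξ v := by
  have : CompleteSpace V := FiniteDimensional.complete ℝ V
  simp [riesz]

/-- The co-vector `ξ^∨ ∈ V` of `ξ ∈ V^*`, characterized for `ξ ≠ 0` by
`η(ξ^∨) = 2⟨η, ξ⟩ / ⟨ξ, ξ⟩` for all `η ∈ V^*`, where `V^*` carries the scalar product of `V`. -/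
def covector (ξ : Module.Dual ℝ V) : V :=
  (2 / inner ℝ (riesz ξ) (riesz ξ)) • riesz ξ

theorem apply_covector (η ξ : Module.Dual ℝ V) :
    η (covector ξ) = 2 * inner ℝ (riesz η) (riesz ξ) / inner ℝ (riesz ξ) (riesz ξ) := by
  rw [covector, map_smul, ← inner_riesz η, smul_eq_mul]
  ring

theorem covector_zero : covector (0 : Module.Dual ℝ V) = 0 := by
  have : riesz (0 : Module.Dual ℝ V) = 0 := by simp [riesz]
  simp [covector, this]

theorem apply_covector_self {ξ : Module.Dual ℝ V} (h : ξ ≠ 0) : ξ (covector ξ) = 2 := by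
  rw [apply_covector, mul_div_assoc, div_self, mul_one]
  intro h0
  apply h
  ext v
  rw [← inner_riesz, inner_self_eq_zero.1 h0]
  simp

/-- The linear reflection `s_α(v) = v - α(v) α^∨` of `V`. -/
def reflFun (α : Module.Dual ℝ V) : V →ₗ[ℝ] V :=
  LinearMap.id - α.smulRight (covector α)

theorem reflFun_apply (α : Module.Dual ℝ V) (v : V) :
    reflFun α v = v - α v • covector α := rfl

theorem reflFun_reflFun (α : Module.Dual ℝ V) (v : V) : reflFun α (reflFun α v) = v := by
  by_cases h : α = 0
  · subst h; simp [reflFun_apply]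
  · simp only [reflFun_apply, map_sub, map_smul, apply_covector_self h]
    module

/-- The linear reflection `s_α` as an invertible linear map. -/
def refl (α : Module.Dual ℝ V) : V ≃ₗ[ℝ] V :=
  LinearEquiv.ofInvolutive (reflFun α) (reflFun_reflFun α)

theorem refl_apply (α : Module.Dual ℝ V) (v : V) : refl α v = v - α v • covector α := rfl

/-- The gradient `Da ∈ V^*` of an affine linear function `a` on `V`. -/
abbrev grad (a : V →ᵃ[ℝ] ℝ) : Module.Dual ℝ V := a.linear

theorem affine_apply (a : V →ᵃ[ℝ] ℝ) (v : V) : a v = grad a v + a 0 := by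
  have := a.map_vadd 0 v
  simpa using this

/-- The reflection `s_a(v) = v - a(v) (Da)^∨` in the affine hyperplane `{v | a(v) = 0}`. -/
def affRefl (a : V →ᵃ[ℝ] ℝ) : V ≃ᵃ[ℝ] V :=
  AffineEquiv.mk' (fun v => v - a v • covector (grad a)) (refl (grad a)) 0 (by
    intro v
    simp only [vsub_eq_sub, sub_zero, vadd_eq_add, refl_apply, zero_sub, affine_apply a v]
    module)

theorem affRefl_apply (a : V →ᵃ[ℝ] ℝ) (v : V) :
    affRefl a v = v - a v • covector (grad a) := rfl

theorem affRefl_linear (a : V →ᵃ[ℝ] ℝ) : (affRefl a).linear = refl (grad a) := rfl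

/-! ### Root systems and lattices -/

/-- A reduced, crystallographic, irreducible root system `R ⊂ V^*`; it need not span `V^*`. -/
structure IsRootSystem (R : Set (Module.Dual ℝ V)) : Prop where
  finite : R.Finite
  nonempty : R.Nonempty
  zero_notMem : (0 : Module.Dual ℝ V) ∉ R
  reflection_mem : ∀ α ∈ R, ∀ β ∈ R, β - β (covector α) • α ∈ R
  crystallographic : ∀ α ∈ R, ∀ β ∈ R, ∃ n : ℤ, β (covector α) = n
  reduced : ∀ α ∈ R, ∀ c : ℝ, c • α ∈ R → c = 1 ∨ c = -1
  irreducible : ∀ S ⊆ R, S.Nonempty →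
    (∀ α ∈ S, ∀ β ∈ R, β ∉ S → inner ℝ (riesz α) (riesz β) = 0) → S = R

/-- `F` is a basis of the root system `R`: a linearly independent subset such that every root
is a linear combination of `F` with coefficients in `ℤ_{≥ 0}`, or minus such a combination. -/
structure IsRootBasis (R F : Set (Module.Dual ℝ V)) : Prop where
  subset : F ⊆ R
  linearIndependent : LinearIndepOn ℝ id F
  mem_or_neg_mem : ∀ α ∈ R, α ∈ AddSubmonoid.closure F ∨ -α ∈ AddSubmonoid.closure F

/-- `θ` is the highest root of `R` with respect to the basis `F`. -/
structure IsHighestRoot (R F : Set (Module.Dual ℝ V)) (θ : Module.Dual ℝ V) : Prop where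
  mem : θ ∈ R
  sub_mem : ∀ α ∈ R, θ - α ∈ AddSubmonoid.closure F

variable (V) in
/-- The data underlying an extended affine Weyl group: a reduced irreducible crystallographic root
system `R` in `V^*`, a full lattice `X` in `V^*` that contains `R` and whose dual lattice in `V`
contains all co-roots, and a basis `F` of `R` together with the (unique) highest root `θ`. -/
structure RootDatum where
  /-- the root system -/
  R : Set (Module.Dual ℝ V)
  isRootSystem : IsRootSystem R
  /-- the full lattice in the dual space -/
  X : AddSubgroup (Module.Dual ℝ V)
  isFullLattice : ∃ b : Module.Basis (Fin (Module.finrank ℝ V)) ℝ (Module.Dual ℝ V),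
    X = AddSubgroup.closure (Set.range b)
  root_mem : ∀ α ∈ R, α ∈ X
  coroot_mem : ∀ α ∈ R, ∀ ξ ∈ X, ∃ n : ℤ, ξ (covector α) = n
  /-- the basis of the root system -/
  F : Set (Module.Dual ℝ V)
  isRootBasis : IsRootBasis R F
  /-- the highest root -/
  θ : Module.Dual ℝ V
  isHighestRoot : IsHighestRoot R F θ

namespace RootDatum

variable (D : RootDatum V)

/-- The lattice `Y ⊂ V` dual to `X`. -/
def Y : AddSubgroup V where
  carrier := {y | ∀ ξ ∈ D.X, ∃ n : ℤ, ξ y = n}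
  zero_mem' ξ _ := ⟨0, by simp⟩
  add_mem' {x y} hx hy ξ hξ := by
    obtain ⟨n, hn⟩ := hx ξ hξ
    obtain ⟨m, hm⟩ := hy ξ hξ
    exact ⟨n + m, by simp [hn, hm]⟩
  neg_mem' {x} hx ξ hξ := by
    obtain ⟨n, hn⟩ := hx ξ hξ
    exact ⟨-n, by simp [hn]⟩

theorem covector_mem_Y {α : Module.Dual ℝ V} (hα : α ∈ D.R) : covector α ∈ D.Y :=
  fun ξ hξ => D.coroot_mem α hα ξ hξ

theorem exists_int_of_mem_Y {α : Module.Dual ℝ V} (hα : α ∈ D.R) {y : V} (hy : y ∈ D.Y) :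
    ∃ n : ℤ, α y = n := hy α (D.root_mem α hα)

theorem int_smul_mem_Y {n : ℤ} {x : ℝ} (hx : x = n) {y : V} (hy : y ∈ D.Y) : x • y ∈ D.Y := by
  rw [hx, Int.cast_smul_eq_zsmul]
  exact D.Y.zsmul_mem hy n

/-- The Weyl group `W`, generated by the reflections `s_α` with `α ∈ R`. -/
def W : Subgroup (V ≃ₗ[ℝ] V) := Subgroup.closure (refl '' D.R)

theorem W_apply_mem_Y {w : V ≃ₗ[ℝ] V} (hw : w ∈ D.W) {y : V} (hy : y ∈ D.Y) : w y ∈ D.Y := by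
  have key : ∀ α ∈ D.R, ∀ z ∈ D.Y, refl α z ∈ D.Y := by
    intro α hα z hz
    rw [refl_apply]
    obtain ⟨n, hn⟩ := D.exists_int_of_mem_Y hα hz
    exact D.Y.sub_mem hz (D.int_smul_mem_Y hn (D.covector_mem_Y hα))
  have hinv : ∀ α : Module.Dual ℝ V, (refl α)⁻¹ = refl α := by
    intro α
    rw [inv_eq_iff_mul_eq_one]
    ext v
    exact reflFun_reflFun α v
  induction hw using Subgroup.closure_induction'' generalizing y with
  | mem x hx =>
    obtain ⟨α, hα, rfl⟩ := hx
    exact key α hα y hy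
  | inv_mem x hx =>
    obtain ⟨α, hα, rfl⟩ := hx
    rw [hinv]
    exact key α hα y hy
  | one => exact hy
  | mul a b _ _ ha hb => exact ha (hb hy)

/-- The extended affine Weyl group `W^a = W ⋉ Y`, as the group of all isometries `w t_y` of `V`
with `w ∈ W` and `y ∈ Y`, where `t_y` is the translation over `y`. -/
def Wa : Subgroup (V ≃ᵃ[ℝ] V) where
  carrier := {g | ∃ w ∈ D.W, ∃ y ∈ D.Y,
    g = w.toAffineEquiv * AffineEquiv.constVAdd ℝ V y}
  one_mem' := ⟨1, D.W.one_mem, 0, D.Y.zero_mem, by ext v; simp⟩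
  mul_mem' := by
    rintro _ _ ⟨w, hw, y, hy, rfl⟩ ⟨w', hw', y', hy', rfl⟩
    refine ⟨w * w', D.W.mul_mem hw hw', w'⁻¹ y + y',
      D.Y.add_mem (D.W_apply_mem_Y (D.W.inv_mem hw') hy) hy', ?_⟩
    ext v
    simp
  inv_mem' := by
    rintro _ ⟨w, hw, y, hy, rfl⟩
    refine ⟨w⁻¹, D.W.inv_mem hw, -(w y), D.Y.neg_mem (D.W_apply_mem_Y hw hy), ?_⟩
    rw [inv_eq_iff_mul_eq_one]
    ext v
    simp

theorem linear_mem_W (g : D.Wa) : (g : V ≃ᵃ[ℝ] V).linear ∈ D.W := by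
  obtain ⟨_, w, hw, y, hy, rfl⟩ := g
  exact hw

/-- The gradient homomorphism `D : W^a → W`, `D(w t_y) = w`. -/
def gradW : D.Wa →* D.W where
  toFun g := ⟨(g : V ≃ᵃ[ℝ] V).linear, D.linear_mem_W g⟩
  map_one' := rfl
  map_mul' _ _ := rfl

/-- The inclusion `W ⊂ W^a`. -/
def ofW : D.W →* D.Wa where
  toFun w := ⟨(w : V ≃ₗ[ℝ] V).toAffineEquiv, w, w.2, 0, D.Y.zero_mem, by ext v; simp⟩
  map_one' := rfl
  map_mul' _ _ := rfl

/-- The translation `t_y ∈ W^a` for `y ∈ Y`. -/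
def transl (y : D.Y) : D.Wa :=
  ⟨AffineEquiv.constVAdd ℝ V (y : V), 1, D.W.one_mem, y, y.2, by ext v; simp⟩

/-! ### Affine roots -/

/-- The affine root system `R^a = R + ℤ1`. -/
def affineRoots : Set (V →ᵃ[ℝ] ℝ) :=
  {a | ∃ α ∈ D.R, ∃ m : ℤ, a = α.toAffineMap + AffineMap.const ℝ V (m : ℝ)}

/-- The action of `W^a` on affine linear functions by transposition, `(w a)(v) = a(w⁻¹ v)`. -/
def act (w : D.Wa) (a : V →ᵃ[ℝ] ℝ) : V →ᵃ[ℝ] ℝ :=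
  a.comp ((w⁻¹ : D.Wa) : V ≃ᵃ[ℝ] V).toAffineMap

/-- The positive roots `R^+` with respect to the basis `F`. -/
def posRoots : Set (Module.Dual ℝ V) := {α ∈ D.R | α ∈ AddSubmonoid.closure D.F}

/-- The positive affine roots `R^{a,+} = (R + ℤ_{> 0}) ∪ R^+`. -/
def posAffineRoots : Set (V →ᵃ[ℝ] ℝ) :=
  {a | ∃ α ∈ D.R, ∃ m : ℤ, 0 < m ∧ a = α.toAffineMap + AffineMap.const ℝ V (m : ℝ)} ∪
    LinearMap.toAffineMap '' D.posRoots

/-- The negative affine roots `R^{a,-} = -R^{a,+}`. -/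
def negAffineRoots : Set (V →ᵃ[ℝ] ℝ) := {a | -a ∈ D.posAffineRoots}

/-- The simple affine root `a_0 = -θ + 1`. -/
def a₀ : V →ᵃ[ℝ] ℝ := (-D.θ).toAffineMap + AffineMap.const ℝ V (1 : ℝ)

/-- The basis `F^a = F ∪ {a_0}` of the affine root system. -/
def simpleAffineRoots : Set (V →ᵃ[ℝ] ℝ) := LinearMap.toAffineMap '' D.F ∪ {D.a₀}

/-- The length `l(w) = #(R^{a,+} ∩ w⁻¹ R^{a,-})` of `w ∈ W^a`. -/
def length (w : D.Wa) : ℕ := {a ∈ D.posAffineRoots | D.act w a ∈ D.negAffineRoots}.ncard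

/-- The elements of length zero of `W^a`. -/
def Ω : Set D.Wa := {w | D.length w = 0}

theorem toAffineMap_mem_affineRoots {α : Module.Dual ℝ V} (hα : α ∈ D.R) :
    α.toAffineMap ∈ D.affineRoots :=
  ⟨α, hα, 0, by ext v; simp⟩

theorem neg_mem_R {α : Module.Dual ℝ V} (hα : α ∈ D.R) : -α ∈ D.R := by
  have h0 : α ≠ 0 := fun h => D.isRootSystem.zero_notMem (h ▸ hα)
  have h := D.isRootSystem.reflection_mem α hα α hα
  rw [apply_covector_self h0] at h
  convert h using 1
  module

theorem simpleAffineRoots_subset : D.simpleAffineRoots ⊆ D.affineRoots := by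
  rintro _ (⟨α, hα, rfl⟩ | rfl)
  · exact D.toAffineMap_mem_affineRoots (D.isRootBasis.subset hα)
  · exact ⟨-D.θ, D.neg_mem_R D.isHighestRoot.mem, 1, by simp [a₀]⟩

theorem affRefl_mem_Wa {a : V →ᵃ[ℝ] ℝ} (ha : a ∈ D.affineRoots) : affRefl a ∈ D.Wa := by
  obtain ⟨α, hα, m, rfl⟩ := ha
  refine ⟨refl α, Subgroup.subset_closure ⟨α, hα, rfl⟩, (m : ℝ) • covector α,
    D.int_smul_mem_Y rfl (D.covector_mem_Y hα), ?_⟩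
  have h0 : α ≠ 0 := fun h => D.isRootSystem.zero_notMem (h ▸ hα)
  ext v
  simp [affRefl_apply, refl_apply, apply_covector_self h0]
  module

/-- The reflection `s_a ∈ W^a` for an affine root `a`. -/
def s (a : D.affineRoots) : D.Wa := ⟨affRefl a, D.affRefl_mem_Wa a.2⟩

/-- The simple reflection `s_a ∈ W^a` for `a ∈ F^a`. -/
def simpleRefl (a : D.simpleAffineRoots) : D.Wa := D.s ⟨a, D.simpleAffineRoots_subset a.2⟩

/-! ### Reduced expressions -/

theorem act_apply (w : D.Wa) (a : V →ᵃ[ℝ] ℝ) (v : V) :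
    D.act w a v = a (((w⁻¹ : D.Wa) : V ≃ᵃ[ℝ] V) v) := rfl

theorem act_mul (w w' : D.Wa) (a : V →ᵃ[ℝ] ℝ) : D.act (w * w') a = D.act w (D.act w' a) := by
  ext v
  simp only [act_apply, mul_inv_rev]
  rfl

theorem act_add (w : D.Wa) (a b : V →ᵃ[ℝ] ℝ) : D.act w (a + b) = D.act w a + D.act w b := rfl

theorem act_neg (w : D.Wa) (a : V →ᵃ[ℝ] ℝ) : D.act w (-a) = -D.act w a := rfl

theorem act_zero (w : D.Wa) : D.act w 0 = 0 := rfl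

theorem simpleRefl_mul_self (a : D.simpleAffineRoots) : D.simpleRefl a * D.simpleRefl a = 1 := by
  have h0 : grad (a : V →ᵃ[ℝ] ℝ) ≠ 0 := by
    obtain ⟨α, hα, m, h⟩ := D.simpleAffineRoots_subset a.2
    intro h0
    rw [h] at h0
    have : α = 0 := by simpa [grad] using h0
    exact D.isRootSystem.zero_notMem (this ▸ hα)
  apply Subtype.ext
  ext v
  change affRefl (a : V →ᵃ[ℝ] ℝ) (affRefl (a : V →ᵃ[ℝ] ℝ) v) = v
  simp only [affRefl_apply]
  rw [affine_apply _ (v - _), map_sub, map_smul, apply_covector_self h0,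
    affine_apply (a : V →ᵃ[ℝ] ℝ) v, smul_eq_mul]
  module

theorem act_simpleRefl (a : D.simpleAffineRoots) (b : V →ᵃ[ℝ] ℝ) :
    D.act (D.simpleRefl a) b = b - grad b (covector (grad (a : V →ᵃ[ℝ] ℝ))) • (a : V →ᵃ[ℝ] ℝ) := by
  have : (D.simpleRefl a)⁻¹ = D.simpleRefl a := inv_eq_of_mul_eq_one_left (D.simpleRefl_mul_self a)
  ext v
  rw [act_apply, this]
  change b (affRefl (a : V →ᵃ[ℝ] ℝ) v) = _
  rw [affRefl_apply, affine_apply b, map_sub, map_smul]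
  simp only [AffineMap.coe_sub, AffineMap.coe_smul, Pi.sub_apply, Pi.smul_apply, smul_eq_mul]
  rw [affine_apply b v]
  ring

theorem comp_mem_R {w : V ≃ₗ[ℝ] V} (hw : w ∈ D.W) {α : Module.Dual ℝ V} (hα : α ∈ D.R) :
    α ∘ₗ (w : V →ₗ[ℝ] V) ∈ D.R := by
  have key : ∀ β ∈ D.R, ∀ α ∈ D.R, α ∘ₗ (refl β : V →ₗ[ℝ] V) ∈ D.R := by
    intro β hβ α hα
    convert D.isRootSystem.reflection_mem β hβ α hα using 1
    ext v
    simp [refl_apply, mul_comm]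
  have hinv : ∀ α : Module.Dual ℝ V, (refl α)⁻¹ = refl α := by
    intro α
    rw [inv_eq_iff_mul_eq_one]
    ext v
    exact reflFun_reflFun α v
  induction hw using Subgroup.closure_induction'' generalizing α with
  | mem x hx =>
    obtain ⟨β, hβ, rfl⟩ := hx
    exact key β hβ α hα
  | inv_mem x hx =>
    obtain ⟨β, hβ, rfl⟩ := hx
    rw [hinv]
    exact key β hβ α hα
  | one => exact hα
  | mul a b _ _ ha hb => exact hb (ha hα)

theorem act_mem_affineRoots (w : D.Wa) {a : V →ᵃ[ℝ] ℝ} (ha : a ∈ D.affineRoots) :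
    D.act w a ∈ D.affineRoots := by
  obtain ⟨α, hα, m, rfl⟩ := ha
  obtain ⟨g, hg, y, hy, h⟩ := (w⁻¹).2
  obtain ⟨n, hn⟩ := D.exists_int_of_mem_Y (D.comp_mem_R hg hα) hy
  refine ⟨α ∘ₗ (g : V →ₗ[ℝ] V), D.comp_mem_R hg hα, n + m, ?_⟩
  ext v
  rw [act_apply, h]
  simp only [LinearMap.coe_comp, LinearEquiv.coe_coe, Function.comp_apply] at hn
  simp [← hn]
  ring

theorem pos_or_neg {a : V →ᵃ[ℝ] ℝ} (ha : a ∈ D.affineRoots) :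
    a ∈ D.posAffineRoots ∨ a ∈ D.negAffineRoots := by
  obtain ⟨α, hα, m, rfl⟩ := ha
  rcases lt_trichotomy m 0 with h | h | h
  · right
    left
    exact ⟨-α, D.neg_mem_R hα, -m, by omega, by ext v; simp [add_comm]⟩
  · subst h
    rcases D.isRootBasis.mem_or_neg_mem α hα with h | h
    · left; right
      exact ⟨α, ⟨hα, h⟩, by ext v; simp⟩
    · right; right
      exact ⟨-α, ⟨D.neg_mem_R hα, h⟩, by ext v; simp⟩
  · left; left
    exact ⟨α, hα, m, h, rfl⟩

theorem toAffineMap_mem_closure {α : Module.Dual ℝ V} (hα : α ∈ AddSubmonoid.closure D.F) :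
    α.toAffineMap ∈ AddSubmonoid.closure D.simpleAffineRoots := by
  induction hα using AddSubmonoid.closure_induction with
  | mem x hx => exact AddSubmonoid.subset_closure (Or.inl ⟨x, hx, rfl⟩)
  | zero => exact AddSubmonoid.zero_mem _
  | add x y _ _ hx hy => exact AddSubmonoid.add_mem _ hx hy

theorem pos_mem_closure {a : V →ᵃ[ℝ] ℝ} (ha : a ∈ D.posAffineRoots) :
    a ∈ AddSubmonoid.closure D.simpleAffineRoots := by
  rcases ha with ⟨α, hα, m, hm, rfl⟩ | ⟨α, ⟨-, hα⟩, rfl⟩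
  · obtain ⟨n, rfl⟩ : ∃ n : ℕ, m = n + 1 := ⟨(m - 1).toNat, by omega⟩
    have hθ : D.θ ∈ AddSubmonoid.closure D.F := by
      rcases D.isRootBasis.mem_or_neg_mem _ D.isHighestRoot.mem with h | h
      · exact h
      · have h2 := D.isHighestRoot.sub_mem _ (D.neg_mem_R D.isHighestRoot.mem)
        simpa using AddSubmonoid.add_mem _ h2 h
    have h1 := D.isHighestRoot.sub_mem _ (D.neg_mem_R hα)
    have h2 := D.toAffineMap_mem_closure (AddSubmonoid.add_mem _ (AddSubmonoid.nsmul_mem _ hθ n) h1)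
    have h3 : D.a₀ ∈ AddSubmonoid.closure D.simpleAffineRoots :=
      AddSubmonoid.subset_closure (Or.inr rfl)
    convert AddSubmonoid.add_mem _ h2 (AddSubmonoid.nsmul_mem _ h3 (n + 1)) using 1
    ext v
    simp [a₀]
    ring
  · exact D.toAffineMap_mem_closure hα

theorem exists_functional (c : (V →ᵃ[ℝ] ℝ) → ℝ) :
    ∃ φ : (V →ᵃ[ℝ] ℝ) → ℝ, (∀ a b, φ (a + b) = φ a + φ b) ∧
      ∀ a ∈ D.simpleAffineRoots, φ a = c a := by
  let b := Module.Basis.extend D.isRootBasis.linearIndependent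
  let h : Module.Dual ℝ V →ₗ[ℝ] ℝ := b.constr ℝ fun i => c (i : Module.Dual ℝ V).toAffineMap
  have hh : ∀ f ∈ D.F, h f = c f.toAffineMap := by
    intro f hf
    have hf' : f ∈ D.isRootBasis.linearIndependent.extend (Set.subset_univ _) :=
      Module.Basis.subset_extend D.isRootBasis.linearIndependent hf
    have := b.constr_basis ℝ (fun i => c (i : Module.Dual ℝ V).toAffineMap) ⟨f, hf'⟩
    simpa [b, h, Module.Basis.extend_apply_self] using this
  refine ⟨fun a => h a.linear + (h D.θ + c D.a₀) * a 0, fun a b => ?_, ?_⟩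
  · simp; ring
  · rintro _ (⟨f, hf, rfl⟩ | rfl)
    · simp [hh f hf]
    · simp [a₀]

theorem functional_zero {φ : (V →ᵃ[ℝ] ℝ) → ℝ} (h : ∀ a b, φ (a + b) = φ a + φ b) : φ 0 = 0 := by
  have := h 0 0
  simpa using this

theorem eq_zero_of_closure {a : V →ᵃ[ℝ] ℝ} (h₁ : a ∈ AddSubmonoid.closure D.simpleAffineRoots)
    (h₂ : -a ∈ AddSubmonoid.closure D.simpleAffineRoots) : a = 0 := by
  obtain ⟨φ, hadd, hφ⟩ := D.exists_functional 1
  have key : ∀ x ∈ AddSubmonoid.closure D.simpleAffineRoots, x = 0 ∨ 0 < φ x := by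
    intro x hx
    induction hx using AddSubmonoid.closure_induction with
    | mem x hx => right; rw [hφ x hx]; exact one_pos
    | zero => left; rfl
    | add x y _ _ hx hy =>
      rcases hx with rfl | hx
      · simpa using hy
      · rcases hy with rfl | hy
        · right; simpa using hx
        · right; rw [hadd]; exact add_pos hx hy
  have h0 : φ a + φ (-a) = 0 := by rw [← hadd, add_neg_cancel, functional_zero hadd]
  rcases key a h₁ with h | h
  · exact h
  · rcases key _ h₂ with h' | h'
    · simpa using h'
    · linarith

theorem ne_zero_of_mem_affineRoots {a : V →ᵃ[ℝ] ℝ} (ha : a ∈ D.affineRoots) : a ≠ 0 := by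
  obtain ⟨α, hα, m, rfl⟩ := ha
  intro h
  have h2 : α = 0 := by
    have := congrArg AffineMap.linear h
    simpa using this
  exact D.isRootSystem.zero_notMem (h2 ▸ hα)

theorem mem_affineRoots_of_pos {a : V →ᵃ[ℝ] ℝ} (ha : a ∈ D.posAffineRoots) :
    a ∈ D.affineRoots := by
  rcases ha with ⟨α, hα, m, hm, rfl⟩ | ⟨α, ⟨hα, -⟩, rfl⟩
  · exact ⟨α, hα, m, rfl⟩
  · exact D.toAffineMap_mem_affineRoots hα

theorem pos_of_mem_closure {a : V →ᵃ[ℝ] ℝ} (ha : a ∈ D.affineRoots)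
    (h : a ∈ AddSubmonoid.closure D.simpleAffineRoots) : a ∈ D.posAffineRoots := by
  rcases D.pos_or_neg ha with h1 | h1
  · exact h1
  · exact absurd (D.eq_zero_of_closure h (D.pos_mem_closure h1)) (D.ne_zero_of_mem_affineRoots ha)

theorem simple_pos {a : V →ᵃ[ℝ] ℝ} (ha : a ∈ D.simpleAffineRoots) : a ∈ D.posAffineRoots :=
  D.pos_of_mem_closure (D.simpleAffineRoots_subset ha) (AddSubmonoid.subset_closure ha)

theorem not_pos_of_neg {a : V →ᵃ[ℝ] ℝ} (ha : a ∈ D.negAffineRoots) : a ∉ D.posAffineRoots :=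
  fun h => D.ne_zero_of_mem_affineRoots (D.mem_affineRoots_of_pos h)
    (D.eq_zero_of_closure (D.pos_mem_closure h) (D.pos_mem_closure ha))

theorem exists_descent {w : D.Wa} (hw : D.length w ≠ 0) :
    ∃ a : D.simpleAffineRoots, D.act w a ∈ D.negAffineRoots := by
  by_contra! hcon
  apply hw
  have hpos : ∀ b ∈ AddSubmonoid.closure D.simpleAffineRoots,
      D.act w b ∈ AddSubmonoid.closure D.simpleAffineRoots := by
    intro b hb
    induction hb using AddSubmonoid.closure_induction with
    | mem x hx =>
      rcases D.pos_or_neg (D.act_mem_affineRoots w (D.simpleAffineRoots_subset hx)) with h | h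
      · exact D.pos_mem_closure h
      · exact absurd h (hcon ⟨x, hx⟩)
    | zero => exact AddSubmonoid.zero_mem _
    | add x y _ _ hx hy => rw [act_add]; exact AddSubmonoid.add_mem _ hx hy
  have : {a ∈ D.posAffineRoots | D.act w a ∈ D.negAffineRoots} = ∅ := by
    ext b
    simp only [Set.mem_ofPred_eq, Set.mem_empty_iff_false, iff_false, not_and]
    intro hb hb'
    exact D.not_pos_of_neg hb' (D.pos_of_mem_closure
      (D.act_mem_affineRoots w (D.mem_affineRoots_of_pos hb)) (hpos b (D.pos_mem_closure hb)))
  rw [length, this, Set.ncard_empty]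

theorem act_simpleRefl_pos (a : D.simpleAffineRoots) {b : V →ᵃ[ℝ] ℝ} (hb : b ∈ D.posAffineRoots)
    (hab : b ≠ a) : D.act (D.simpleRefl a) b ∈ D.posAffineRoots := by
  classical
  have hbR := D.mem_affineRoots_of_pos hb
  rcases D.pos_or_neg (D.act_mem_affineRoots (D.simpleRefl a) hbR) with h | h
  · exact h
  exfalso
  obtain ⟨φ, hadd, hφ⟩ := D.exists_functional fun x => if x = a then 0 else 1
  have key : ∀ x ∈ AddSubmonoid.closure D.simpleAffineRoots,
      (∃ n : ℕ, x = n • (a : V →ᵃ[ℝ] ℝ)) ∧ φ x = 0 ∨ 0 < φ x := by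
    intro x hx
    induction hx using AddSubmonoid.closure_induction with
    | mem x hx =>
      by_cases hxa : x = a
      · left; exact ⟨⟨1, by simp [hxa]⟩, by rw [hφ x hx, if_pos hxa]⟩
      · right; simp [hφ x hx, hxa]
    | zero => left; exact ⟨⟨0, by simp⟩, functional_zero hadd⟩
    | add x y _ _ hx hy =>
      rw [hadd]
      rcases hx with ⟨⟨n, rfl⟩, hx⟩ | hx
      · rcases hy with ⟨⟨m, rfl⟩, hy⟩ | hy
        · left; exact ⟨⟨n + m, by rw [add_smul]⟩, by rw [hx, hy, add_zero]⟩
        · right; linarith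
      · rcases hy with ⟨_, hy⟩ | hy
        · right; linarith
        · right; linarith
  have hneg : ∀ x, φ (-x) = -φ x := by
    intro x
    have : φ x + φ (-x) = 0 := by rw [← hadd, add_neg_cancel, functional_zero hadd]
    linarith
  obtain ⟨α, hα, m, hm⟩ := D.simpleAffineRoots_subset a.2
  obtain ⟨β, hβ, n, hn⟩ := hbR
  have hlina : grad (a : V →ᵃ[ℝ] ℝ) = α := by rw [hm]; simp [grad]
  have hlinb : grad b = β := by rw [hn]; simp [grad]
  obtain ⟨r, hr⟩ := D.isRootSystem.crystallographic α hα β hβ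
  have hφa : φ (a : V →ᵃ[ℝ] ℝ) = 0 := by simp [hφ _ a.2]
  have hφz : ∀ z : ℤ, φ ((z : ℝ) • (a : V →ᵃ[ℝ] ℝ)) = 0 := by
    let f : (V →ᵃ[ℝ] ℝ) →+ ℝ := ⟨⟨φ, functional_zero hadd⟩, hadd⟩
    intro z
    rw [Int.cast_smul_eq_zsmul]
    have := map_zsmul f z (a : V →ᵃ[ℝ] ℝ)
    change φ _ = z • φ _ at this
    rw [this, hφa, smul_zero]
  have h1 := key _ (D.pos_mem_closure hb)
  have h2 := key _ (D.pos_mem_closure h)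
  rw [act_simpleRefl, hlina, hlinb, hr, hneg, sub_eq_add_neg, hadd, hneg, hφz] at h2
  have h3 : φ b ≤ 0 := by
    rcases h2 with ⟨-, h2⟩ | h2 <;> linarith
  rcases h1 with ⟨⟨j, hj⟩, -⟩ | h1
  · have hβα : β = (j : ℝ) • α := by
      rw [← hlina, ← hlinb, hj, Nat.cast_smul_eq_nsmul]
      rfl
    rcases D.isRootSystem.reduced α hα j (hβα ▸ hβ) with h4 | h4
    · apply hab
      rw [hj]
      have : j = 1 := by exact_mod_cast h4
      simp [this]
    · have : (0 : ℝ) ≤ j := Nat.cast_nonneg j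
      linarith
  · linarith

theorem length_mul_simpleRefl {w : D.Wa} {a : D.simpleAffineRoots}
    (ha : D.act w a ∈ D.negAffineRoots) :
    D.length (w * D.simpleRefl a) = D.length w - 1 := by
  have hself : ∀ b, D.act (D.simpleRefl a) (D.act (D.simpleRefl a) b) = b := by
    intro b
    rw [← act_mul, simpleRefl_mul_self]
    rfl
  have hacta : D.act (D.simpleRefl a) a = -(a : V →ᵃ[ℝ] ℝ) := by
    have h0 : grad (a : V →ᵃ[ℝ] ℝ) ≠ 0 := by
      obtain ⟨α, hα, m, h⟩ := D.simpleAffineRoots_subset a.2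
      intro h0
      rw [h] at h0
      have : α = 0 := by simpa [grad] using h0
      exact D.isRootSystem.zero_notMem (this ▸ hα)
    rw [act_simpleRefl, apply_covector_self h0]
    module
  have hset : {b ∈ D.posAffineRoots | D.act (w * D.simpleRefl a) b ∈ D.negAffineRoots} =
      D.act (D.simpleRefl a) ''
        ({b ∈ D.posAffineRoots | D.act w b ∈ D.negAffineRoots} \ {(a : V →ᵃ[ℝ] ℝ)}) := by
    ext b
    simp only [Set.mem_ofPred_eq, Set.mem_image, Set.mem_sdiff, Set.mem_singleton_iff]
    constructor
    · rintro ⟨hb, hb'⟩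
      rw [act_mul] at hb'
      have hba : b ≠ a := by
        rintro rfl
        rw [hacta, act_neg] at hb'
        refine D.not_pos_of_neg ha ?_
        simpa [negAffineRoots] using hb'
      refine ⟨_, ⟨⟨D.act_simpleRefl_pos a hb hba, hb'⟩, fun h => ?_⟩, hself b⟩
      have h2 := hself b
      rw [h, hacta] at h2
      rw [← h2] at hb
      refine D.not_pos_of_neg (a := -(a : V →ᵃ[ℝ] ℝ)) ?_ hb
      simpa [negAffineRoots] using D.simple_pos a.2
    · rintro ⟨c, ⟨⟨hc, hc'⟩, hca⟩, rfl⟩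
      refine ⟨D.act_simpleRefl_pos a hc hca, ?_⟩
      rw [act_mul, hself]
      exact hc'
  rw [length, hset, Set.ncard_image_of_injective _ (Function.LeftInverse.injective hself),
    Set.ncard_sdiff_singleton_of_mem (by exact ⟨D.simple_pos a.2, ha⟩)]
  rfl

theorem exists_reducedExpr (w : D.Wa) : ∃ p : D.Ω × List D.simpleAffineRoots,
    p.2.length = D.length w ∧ w = (p.1 : D.Wa) * (p.2.map D.simpleRefl).prod := by
  induction hn : D.length w generalizing w with
  | zero => exact ⟨(⟨w, hn⟩, []), rfl, by simp⟩
  | succ n ih =>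
    obtain ⟨a, ha⟩ := D.exists_descent (w := w) (by omega)
    obtain ⟨⟨ω, l⟩, hl, h⟩ := ih (w * D.simpleRefl a) (by rw [D.length_mul_simpleRefl ha, hn]; rfl)
    refine ⟨(ω, l ++ [a]), by simpa using hl, ?_⟩
    have : w = w * D.simpleRefl a * D.simpleRefl a := by
      rw [mul_assoc, simpleRefl_mul_self, mul_one]
    rw [this, h]
    simp [mul_assoc]

/-- A reduced expression `w = ω s_{a_1} ⋯ s_{a_r}` of `w ∈ W^a`, with `ω` of length zero, simple
affine roots `a_1, …, a_r` and `r = l(w)`. -/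
def reducedExpr (w : D.Wa) : D.Ω × List D.simpleAffineRoots := (D.exists_reducedExpr w).choose

theorem reducedExpr_length (w : D.Wa) : (D.reducedExpr w).2.length = D.length w :=
  (D.exists_reducedExpr w).choose_spec.1

theorem reducedExpr_prod (w : D.Wa) :
    w = ((D.reducedExpr w).1 : D.Wa) * ((D.reducedExpr w).2.map D.simpleRefl).prod :=
  (D.exists_reducedExpr w).choose_spec.2

end RootDatum

/-! ### Real analytic functions and the operators acting on them -/

variable (V) in
/-- The space `C^ω(V)` of complex valued real analytic functions on `V`. -/
@[ext]
structure Comega where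
  /-- the underlying function -/
  toFun : V → ℂ
  analyticAt : ∀ v, AnalyticAt ℝ toFun v

namespace Comega

instance : CoeFun (Comega V) (fun _ => V → ℂ) := ⟨Comega.toFun⟩

instance : Zero (Comega V) := ⟨⟨fun _ => 0, fun _ => analyticAt_const⟩⟩

instance : Add (Comega V) :=
  ⟨fun f g => ⟨fun v => f v + g v, fun v => (f.analyticAt v).add (g.analyticAt v)⟩⟩

instance : Neg (Comega V) := ⟨fun f => ⟨fun v => -f v, fun v => (f.analyticAt v).neg⟩⟩

instance : Sub (Comega V) :=
  ⟨fun f g => ⟨fun v => f v - g v, fun v => (f.analyticAt v).sub (g.analyticAt v)⟩⟩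

instance : SMul ℂ (Comega V) :=
  ⟨fun c f => ⟨fun v => c * f v, fun v => analyticAt_const.mul (f.analyticAt v)⟩⟩

instance : AddCommGroup (Comega V) where
  add_assoc f g h := by ext v; exact add_assoc _ _ _
  zero_add f := by ext v; exact zero_add _
  add_zero f := by ext v; exact add_zero _
  add_comm f g := by ext v; exact add_comm _ _
  neg_add_cancel f := by ext v; exact neg_add_cancel _
  sub_eq_add_neg f g := by ext v; exact sub_eq_add_neg _ _
  nsmul := nsmulRec
  zsmul := zsmulRec

instance : Module ℂ (Comega V) where
  one_smul f := by ext v; exact one_mul _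
  mul_smul c d f := by ext v; exact mul_assoc _ _ _
  smul_zero c := by ext v; exact mul_zero _
  smul_add c f g := by ext v; exact mul_add _ _ _
  add_smul c d f := by ext v; exact add_mul _ _ _
  zero_smul f := by ext v; exact zero_mul _

end Comega

theorem analyticAt_affineMap {E : Type*} [NormedAddCommGroup E] [NormedSpace ℝ E]
    (g : V →ᵃ[ℝ] E) (v : V) : AnalyticAt ℝ g v := by
  have h : (g : V → E) = fun x => LinearMap.toContinuousLinearMap g.linear x + g 0 := by
    funext x
    have := g.map_vadd 0 x
    simpa using this
  rw [h]
  exact ((LinearMap.toContinuousLinearMap g.linear).analyticAt v).add analyticAt_const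

/-- The action of an affine transformation `g` on `C^ω(V)`, `(g f)(v) = f(g⁻¹ v)`. -/
def pullback (g : V ≃ᵃ[ℝ] V) : Comega V →ₗ[ℂ] Comega V where
  toFun f := ⟨fun v => f (g⁻¹ v), fun v =>
    AnalyticAt.fun_comp (f.analyticAt _) (analyticAt_affineMap (g⁻¹ : V ≃ᵃ[ℝ] V).toAffineMap v)⟩
  map_add' _ _ := rfl
  map_smul' _ _ := rfl

theorem integrand_analyticAt (a : V →ᵃ[ℝ] ℝ) (f : Comega V) (x : ℝ × V) :
    AnalyticAt ℝ (fun x : ℝ × V => (a x.2 : ℂ) *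
      f (x.2 - (x.1 * a x.2) • covector (grad a))) x := by
  have ha : AnalyticAt ℝ (fun x : ℝ × V => a x.2) x :=
    AnalyticAt.fun_comp (analyticAt_affineMap a _) analyticAt_snd
  refine AnalyticAt.mul ?_ ?_
  · exact (Complex.ofRealCLM.analyticAt _).fun_comp ha
  · exact AnalyticAt.fun_comp (f.analyticAt _)
      (analyticAt_snd.sub ((analyticAt_fst.mul ha).smul analyticAt_const))

theorem integral_rescale (a : V →ᵃ[ℝ] ℝ) (f : V → ℂ) (v : V) :
    ∫ t in (0 : ℝ)..a v, f (v - t • covector (grad a)) =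
      ∫ t in (0 : ℝ)..1, (a v : ℂ) * f (v - (t * a v) • covector (grad a)) := by
  have := intervalIntegral.smul_integral_comp_mul_right (a := (0 : ℝ)) (b := 1)
    (fun t => f (v - t • covector (grad a))) (a v)
  rw [zero_mul, one_mul] at this
  rw [← this, intervalIntegral.integral_const_mul]
  simp

/-- The integral operator `(I(a) f)(v) = ∫_0^{a(v)} f(v - t (Da)^∨) dt` on `C^ω(V)`. -/
def integralOp (a : V →ᵃ[ℝ] ℝ) : Comega V →ₗ[ℂ] Comega V where
  toFun f := ⟨fun v => ∫ t in (0 : ℝ)..a v, f (v - t • covector (grad a)), fun v => by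
    simp only [integral_rescale]
    exact analyticAt_integral_param (integrand_analyticAt a f) v 1⟩
  map_add' f g := by
    have hc : ∀ (h : Comega V) (v : V), Continuous fun t : ℝ =>
        h (v - t • covector (grad a)) := fun h v =>
      (continuous_iff_continuousAt.2 fun x => (h.analyticAt x).continuousAt).comp (by fun_prop)
    ext v
    exact intervalIntegral.integral_add ((hc f v).intervalIntegrable _ _)
      ((hc g v).intervalIntegrable _ _)
  map_smul' c f := by
    ext v
    exact intervalIntegral.integral_smul c _

/-- The directional derivative `∂_v` on `C^ω(V)`. -/
def dirDeriv : V →ₗ[ℝ] Module.End ℂ (Comega V) where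
  toFun v :=
    { toFun f := ⟨fun x => fderiv ℝ f x v, fun x =>
        ((ContinuousLinearMap.apply ℝ ℂ v).analyticAt _).fun_comp (f.analyticAt x).fderiv⟩
      map_add' f g := by
        ext x
        change fderiv ℝ (f.toFun + g.toFun) x v = _
        rw [fderiv_add (f.analyticAt x).differentiableAt (g.analyticAt x).differentiableAt]
        rfl
      map_smul' c f := by
        ext x
        change fderiv ℝ (c • f.toFun) x v = _
        rw [fderiv_const_smul (f.analyticAt x).differentiableAt]
        rfl }
  map_add' v w := by
    ext f x
    exact (fderiv ℝ f x).map_add v w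
  map_smul' r v := by
    ext f x
    exact (fderiv ℝ f x).map_smul r v

theorem dirDeriv_comm (v w : V) : dirDeriv v * dirDeriv w = dirDeriv w * dirDeriv v := by
  have key : ∀ (f : Comega V) (v w x : V), fderiv ℝ (fun y => fderiv ℝ f y v) x w =
      fderiv ℝ (fderiv ℝ f) x w v := by
    intro f v w x
    have := fderiv_clm_apply (𝕜 := ℝ) (f.analyticAt x).fderiv.differentiableAt
      (differentiableAt_const v : DifferentiableAt ℝ (fun _ : V => v) x)
    rw [this]
    simp
  ext f x
  change fderiv ℝ (fun y => fderiv ℝ f y w) x v =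
    fderiv ℝ (fun y => fderiv ℝ f y v) x w
  rw [key, key]
  exact ((f.analyticAt x).contDiffAt (n := ⊤)).isSymmSndFDerivAt_of_omega.eq v w

/-- The complexification `V_ℂ = ℂ ⊗ V`. -/
abbrev Complexified (V : Type*) [NormedAddCommGroup V] [InnerProductSpace ℝ V] := ℂ ⊗[ℝ] V

/-- The directional derivatives `∂_v` for `v ∈ V_ℂ`. -/
def dirDerivC : Complexified V →ₗ[ℂ] Module.End ℂ (Comega V) :=
  LinearMap.liftBaseChange ℂ dirDeriv

theorem dirDerivC_comm (v w : Complexified V) :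
    dirDerivC v * dirDerivC w = dirDerivC w * dirDerivC v := by
  induction v using TensorProduct.induction_on with
  | zero => simp
  | add x y hx hy => rw [map_add, add_mul, mul_add, hx, hy]
  | tmul c v =>
    induction w using TensorProduct.induction_on with
    | zero => simp
    | add x y hx hy => rw [map_add, add_mul, mul_add, hx, hy]
    | tmul d w =>
      simp only [dirDerivC, LinearMap.liftBaseChange_tmul]
      rw [smul_mul_smul_comm, smul_mul_smul_comm, dirDeriv_comm, mul_comm]

/-- The constant coefficient differential operator `p(∂)` on `C^ω(V)` for `p ∈ S(V_ℂ)`. -/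
def diffOp : SymmetricAlgebra ℂ (Complexified V) →ₐ[ℂ] Module.End ℂ (Comega V) :=
  RingCon.liftₐ (TensorAlgebra.symRingCon ℂ (Complexified V))
    (TensorAlgebra.lift ℂ (dirDerivC (V := V))) (RingCon.ringConGen_le.2 fun x y h => by
      induction h with
      | mul_comm x y =>
        rw [RingCon.ker_apply]
        simpa using dirDerivC_comm x y)

/-- The value `p(λ)` of `p ∈ S(V_ℂ)`, a polynomial function on `V_ℂ^*`, at `λ ∈ V_ℂ^*`. -/
def evalAt (lam : V →ₗ[ℝ] ℂ) : SymmetricAlgebra ℂ (Complexified V) →ₐ[ℂ] ℂ :=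
  SymmetricAlgebra.lift (LinearMap.liftBaseChange ℂ lam)

/-- The action on `S(V_ℂ)` of an invertible linear transformation of `V`. -/
def symAct (w : V ≃ₗ[ℝ] V) :
    SymmetricAlgebra ℂ (Complexified V) →ₐ[ℂ] SymmetricAlgebra ℂ (Complexified V) :=
  SymmetricAlgebra.lift (SymmetricAlgebra.ι ℂ (Complexified V) ∘ₗ (w : V →ₗ[ℝ] V).baseChange ℂ)

/-- The plane wave `e^λ : v ↦ e^{λ(v)}`. -/
def planeWave (lam : V →ₗ[ℝ] ℂ) : Comega V :=
  ⟨fun v => Complex.exp (lam v), fun v =>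
    (analyticAt_cexp.restrictScalars (𝕜 := ℝ)).fun_comp
      ((LinearMap.toContinuousLinearMap lam).analyticAt v)⟩

/-- The action `(wλ)(v) = λ(w⁻¹ v)` on `V_ℂ^* = Hom_ℝ(V, ℂ)`. -/
def dualAct (w : V ≃ₗ[ℝ] V) (lam : V →ₗ[ℝ] ℂ) : V →ₗ[ℝ] ℂ := lam ∘ₗ ((w⁻¹ : V ≃ₗ[ℝ] V) : V →ₗ[ℝ] V)

/-! ### The normalized intertwiners at critical level -/

namespace RootDatum

variable (D : RootDatum V)

/-- `k : R^a → ℂ` is a multiplicity function: it is `W^a`-invariant (values of `k` outside `R^a`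
are irrelevant). -/
def IsMultiplicity (k : (V →ᵃ[ℝ] ℝ) → ℂ) : Prop :=
  ∀ w : D.Wa, ∀ a ∈ D.affineRoots, k (D.act w a) = k a

/-- The set `C_k^{reg}` of all `λ ∈ V_ℂ^*` with `0 ≠ λ((Da)^∨) ≠ k_a` for all `a ∈ R^a`. -/
def Creg (k : (V →ᵃ[ℝ] ℝ) → ℂ) : Set (V →ₗ[ℝ] ℂ) :=
  {lam | ∀ a ∈ D.affineRoots, lam (covector (grad a)) ≠ 0 ∧ lam (covector (grad a)) ≠ k a}

/-- `J_{s_a}^k(λ) = (λ((Da)^∨) s_a + k_a) / (λ((Da)^∨) - k_a)` in `ℂ[W^a]`, for `a ∈ F^a`. -/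
def Jsimple (k : (V →ᵃ[ℝ] ℝ) → ℂ) (a : D.simpleAffineRoots) (lam : V →ₗ[ℝ] ℂ) :
    MonoidAlgebra ℂ D.Wa :=
  (lam (covector (grad (a : V →ᵃ[ℝ] ℝ))) - k a)⁻¹ •
    (lam (covector (grad (a : V →ᵃ[ℝ] ℝ))) • MonoidAlgebra.of ℂ D.Wa (D.simpleRefl a) + k a • 1)

/-- The cocycle value along a product of simple reflections, through
`J_{s_a u}^k(λ) = J_{s_a}^k((Du) λ) J_u^k(λ)`. -/
def Jlist (k : (V →ᵃ[ℝ] ℝ) → ℂ) :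
    List D.simpleAffineRoots → (V →ₗ[ℝ] ℂ) → MonoidAlgebra ℂ D.Wa
  | [], _ => 1
  | a :: l, lam =>
    D.Jsimple k a (dualAct (D.gradW (l.map D.simpleRefl).prod : V ≃ₗ[ℝ] V) lam) * Jlist k l lam

/-- The normalized intertwiner `J_w^k(λ) ∈ ℂ[W^a]` at critical level, for `w ∈ W^a`. It is the
cocycle, `J_{στ}^k(λ) = J_σ^k((Dτ) λ) J_τ^k(λ)`, with `J_{s_a}^k(λ)` as above for `a ∈ F^a` and
`J_ω^k(λ) = ω` for `ω ∈ Ω`; its value is computed along a reduced expression of `w`. -/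
def J (k : (V →ᵃ[ℝ] ℝ) → ℂ) (w : D.Wa) (lam : V →ₗ[ℝ] ℂ) : MonoidAlgebra ℂ D.Wa :=
  MonoidAlgebra.of ℂ D.Wa (D.reducedExpr w).1 * D.Jlist k (D.reducedExpr w).2 lam

/-! ### Integral-reflection operators -/

variable {M : Type*} [AddCommGroup M] [Module ℂ M]

/-- `Q_{k,M}(s_a) = s_a ⊗ s_a - k_a I(a) ⊗ Id_M` on `C^ω(V) ⊗ M`, for `a ∈ F^a`. -/
def Qsimple (k : (V →ᵃ[ℝ] ℝ) → ℂ) (ρ : Representation ℂ D.Wa M) (a : D.simpleAffineRoots) :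
    Module.End ℂ (Comega V ⊗[ℂ] M) :=
  TensorProduct.map (pullback (D.simpleRefl a : V ≃ᵃ[ℝ] V)) (ρ (D.simpleRefl a)) -
    k a • TensorProduct.map (integralOp (a : V →ᵃ[ℝ] ℝ)) (LinearMap.id : M →ₗ[ℂ] M)

/-- `Q_{k,M}(ω) = ω ⊗ ω` on `C^ω(V) ⊗ M`, for `ω ∈ Ω`. -/
def Qomega (ρ : Representation ℂ D.Wa M) (ω : D.Ω) : Module.End ℂ (Comega V ⊗[ℂ] M) :=
  TensorProduct.map (pullback ((ω : D.Wa) : V ≃ᵃ[ℝ] V)) (ρ (ω : D.Wa))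

/-- The action `Q_{k,M}(w)` of `w ∈ W^a` on `C^ω(V) ⊗ M` by integral-reflection operators. It is
the multiplicative extension of `Q_{k,M}(s_a)`, `a ∈ F^a`, and `Q_{k,M}(ω)`, `ω ∈ Ω`, and is
computed along a reduced expression of `w`. -/
def Q (k : (V →ᵃ[ℝ] ℝ) → ℂ) (ρ : Representation ℂ D.Wa M) (w : D.Wa) :
    Module.End ℂ (Comega V ⊗[ℂ] M) :=
  D.Qomega ρ (D.reducedExpr w).1 * ((D.reducedExpr w).2.map (D.Qsimple k ρ)).prod

/-- The space `F_ir^k(M)_λ`: all `f ∈ C^ω(V) ⊗ M` with `p(∂) f = p(λ) f` for all `W`-invariant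
`p ∈ S(V_ℂ)`. -/
def Fir (M : Type*) [AddCommGroup M] [Module ℂ M] (lam : V →ₗ[ℝ] ℂ) :
    Set (Comega V ⊗[ℂ] M) :=
  {f | ∀ p : SymmetricAlgebra ℂ (Complexified V), (∀ w ∈ D.W, symAct w p = p) →
    TensorProduct.map (diffOp p) LinearMap.id f = evalAt lam p • f}

/-- The space `F_ir^k(M)_λ^{W^a}` of all `f ∈ F_ir^k(M)_λ` that are invariant under the
action `Q_{k,M}` of `W^a`. -/
def FirInvariants (k : (V →ᵃ[ℝ] ℝ) → ℂ) (ρ : Representation ℂ D.Wa M) (lam : V →ₗ[ℝ] ℂ) :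
    Set (Comega V ⊗[ℂ] M) :=
  {f ∈ D.Fir M lam | ∀ w : D.Wa, D.Q k ρ w f = f}

/-- `ψ_λ^m = ∑_{w ∈ W} e^{wλ} ⊗ J_w^k(λ) m`; the sum is finite. -/
def psi (k : (V →ᵃ[ℝ] ℝ) → ℂ) (ρ : Representation ℂ D.Wa M) (lam : V →ₗ[ℝ] ℂ) (m : M) :
    Comega V ⊗[ℂ] M :=
  ∑ᶠ w : D.W, planeWave (dualAct (w : V ≃ₗ[ℝ] V) lam) ⊗ₜ[ℂ]
    ρ.asAlgebraHom (D.J k (D.ofW w) lam) m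

/-! ### The scalar case -/

/-- The factor `(λ(α^∨) + c) / (λ(α^∨) - c)`. -/
def factor (lam : V →ₗ[ℝ] ℂ) (α : Module.Dual ℝ V) (c : ℂ) : ℂ :=
  (lam (covector α) + c) / (lam (covector α) - c)

/-- `c_k(λ) = ∏_{α ∈ R^+} (λ(α^∨) - k_α) / λ(α^∨)`. -/
def cFunction (k : (V →ᵃ[ℝ] ℝ) → ℂ) (lam : V →ₗ[ℝ] ℂ) : ℂ :=
  ∏ᶠ α ∈ D.posRoots, (lam (covector α) - k α.toAffineMap) / lam (covector α)

/-- `ψ_λ = c_k(λ)⁻¹ ∑_{w ∈ W} c_k(wλ) e^{wλ}`. -/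
def psiScalar (k : (V →ᵃ[ℝ] ℝ) → ℂ) (lam : V →ₗ[ℝ] ℂ) : Comega V :=
  (D.cFunction k lam)⁻¹ • ∑ᶠ w : D.W, D.cFunction k (dualAct (w : V ≃ₗ[ℝ] V) lam) •
    planeWave (dualAct (w : V ≃ₗ[ℝ] V) lam)

/-- The `W`-orbit `Wθ` of the highest root. -/
def orbitTheta : Set (Module.Dual ℝ V) :=
  {β | ∃ w ∈ D.W, β = D.θ ∘ₗ ((w⁻¹ : V ≃ₗ[ℝ] V) : V →ₗ[ℝ] V)}

open Classical in
/-- The explicit scalars `j_y^k(λ)`. One has `θ(Y) = ℤ` or `θ(Y) = 2ℤ`, and the numbers `α(y)` for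
`α ∈ R` and, in the second case, `β(y) / 2` for `β ∈ Wθ`, are integers. -/
def jScalar (k : (V →ᵃ[ℝ] ℝ) → ℂ) (y : D.Y) (lam : V →ₗ[ℝ] ℂ) : ℂ :=
  if ∃ z ∈ D.Y, D.θ z = 1 then
    ∏ᶠ α ∈ D.posRoots, factor lam α (k α.toAffineMap) ^ ⌊α (y : V)⌋
  else
    (∏ᶠ α ∈ D.posRoots \ D.orbitTheta, factor lam α (k α.toAffineMap) ^ ⌊α (y : V)⌋) *
      ∏ᶠ β ∈ D.posRoots ∩ D.orbitTheta,
        factor lam β (k D.θ.toAffineMap) ^ ⌊β (y : V) / 2⌋ * factor lam β (k D.a₀) ^ ⌊β (y : V) / 2⌋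

end RootDatum

end BetheAnsatz

end

/-! The elements `J` and the operators `Q` are given through chosen reduced expressions. Three facts
carry the theorem.

The cocycle property (`J_mul`). It says that the product of simple intertwiners along a word depends
only on the element of W^a that the word represents. At critical level the weights cannot show this,
because translations act trivially on λ and elements of W^a with equal gradient are not separated.
The level is therefore first an indeterminate X. On ℂ[X][W^a], the group acts by left multiplication
and an affine function ξ acts by a Dunkl operator, as in a principal series module of the degenerate
double affine Hecke algebra. These operators are triangular for the length (`coeff_dunkl`), and for
regular λ their diagonal entries separate the elements of W^a (`eq_of_levelWeight_eq`). Hence a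
weight vector of weight gμ is determined by its coefficient at g (`IsWeightVector.eq_zero`). The
unnormalized intertwiner of any word for g is such a vector, so two words for g give proportional
vectors. The determinant character, extended to the group algebra, identifies the ratio as that of
the two denominators (`levelIntertwiner_proportional`). The denominators survive at X = 0 because λ
lies in C_k^reg, so setting X = 0 gives the claim at critical level (`wordIntertwiner_eq`).

Invariance as covariance (`superposition_mem_FirInvariants`). Since I(a)e^μ = (e^μ - s_a
e^μ)/μ(Da^∨) and the plane waves e^{wλ} are linearly independent, a sum of e^{wλ} ⊗ n_w is fixed by
a generator g exactly when n_{(Dg)w} = e^{(wλ)(g⁻¹0)} J_g(wλ) n_w for all w. By the cocycle property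
this condition is multiplicative in g. For n_w = J_w(λ)m, writing gw = w't_y reduces it to g = t_y
and w = 1, which is the Bethe ansatz equation (`isCovariant_iff`).

The trivial module. Here J_g(λ) acts by the product of (λ(Db^∨) + k_b)/(λ(Db^∨) - k_b) over the
inversions b of g (`scalarJ_eq_inversionProd`). For g = w in W this is c_k(wλ)/c_k(λ), so ψ_λ is the
case m = 1 of part (i). For g = t_y the inversions are affine roots α + m, and k is constant in m if
α takes the value 1 on Y and in general depends only on the parity of m. A root outside Wθ always
takes an odd value on some co-root (`exists_odd_of_notMem_orbitTheta`), so the parity can matter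
only on Wθ, which produces the two cases of j_y. -/

noncomputable section

namespace BetheAnsatz

variable {V : Type*} [NormedAddCommGroup V] [InnerProductSpace ℝ V] [FiniteDimensional ℝ V]

/-! ### Isometries and co-vectors -/

theorem ext_riesz {x y : V} (h : ∀ v, inner ℝ x v = inner ℝ y v) : x = y := ext_inner_right ℝ h

theorem riesz_add (ξ η : Module.Dual ℝ V) : riesz (ξ + η) = riesz ξ + riesz η :=
  ext_riesz fun v => by simp [inner_riesz, inner_add_left]

theorem riesz_smul (c : ℝ) (ξ : Module.Dual ℝ V) : riesz (c • ξ) = c • riesz ξ :=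
  ext_riesz fun v => by simp [inner_riesz, inner_smul_left]

theorem riesz_zero : riesz (0 : Module.Dual ℝ V) = 0 := by
  simpa using riesz_smul 0 (0 : Module.Dual ℝ V)

theorem riesz_eq_zero {ξ : Module.Dual ℝ V} (h : riesz ξ = 0) : ξ = 0 := by
  ext v
  rw [← inner_riesz, h]
  simp

theorem inner_riesz_pos {ξ : Module.Dual ℝ V} (h : ξ ≠ 0) :
    0 < inner ℝ (riesz ξ) (riesz ξ) :=
  lt_of_le_of_ne real_inner_self_nonneg fun h0 => h (riesz_eq_zero (inner_self_eq_zero.1 h0.symm))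

theorem riesz_neg (ξ : Module.Dual ℝ V) : riesz (-ξ) = -riesz ξ :=
  ext_riesz fun v => by simp [inner_riesz]

theorem covector_neg (ξ : Module.Dual ℝ V) : covector (-ξ) = -covector ξ := by
  simp [covector, riesz_neg]

theorem inner_refl (α : Module.Dual ℝ V) (x y : V) :
    inner ℝ (refl α x) (refl α y) = inner ℝ x y := by
  by_cases h : α = 0
  · subst h; simp [refl_apply]
  have h0 := (inner_riesz_pos h).ne'
  have h1 : inner ℝ x (riesz α) = α x := by rw [real_inner_comm, inner_riesz]
  simp only [refl_apply, covector, inner_sub_left, inner_sub_right, real_inner_smul_left,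
    real_inner_smul_right, h1, inner_riesz α y]
  set N := inner ℝ (riesz α) (riesz α)
  field_simp
  ring

theorem refl_mul_self (α : Module.Dual ℝ V) : refl α * refl α = 1 := by
  ext v
  exact reflFun_reflFun α v

theorem refl_inv (α : Module.Dual ℝ V) : (refl α)⁻¹ = refl α :=
  inv_eq_of_mul_eq_one_left (refl_mul_self α)

theorem det_refl {α : Module.Dual ℝ V} (h : α ≠ 0) :
    LinearMap.det (refl α : V →ₗ[ℝ] V) = -1 := by
  -- As a transvection v ↦ v + f(v)x with f = -α and x = α^∨, it has determinant 1 + f(x) = 1 - 2.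
  have : (refl α : V →ₗ[ℝ] V) = LinearMap.transvection (-α) (covector α) := by
    ext v
    simp [refl_apply, LinearMap.transvection.apply, sub_eq_add_neg]
  rw [this, LinearMap.transvection.det]
  simp [apply_covector_self h]
  norm_num

namespace RootDatum

variable (D : RootDatum V)

theorem inner_W {w : V ≃ₗ[ℝ] V} (hw : w ∈ D.W) (x y : V) :
    inner ℝ (w x) (w y) = inner ℝ x y := by
  induction hw using Subgroup.closure_induction generalizing x y with
  | mem g hg =>
    obtain ⟨α, -, rfl⟩ := hg
    exact inner_refl α x y
  | one => rfl
  | mul a b _ _ ha hb => exact (ha _ _).trans (hb _ _)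
  | inv a _ ha =>
    rw [← ha]
    change inner ℝ ((a * a⁻¹) x) ((a * a⁻¹) y) = _
    simp

/-- An isometry has its inverse as adjoint. -/
theorem riesz_comp {w : V ≃ₗ[ℝ] V} (hw : w ∈ D.W) (α : Module.Dual ℝ V) :
    riesz (α ∘ₗ ((w⁻¹ : V ≃ₗ[ℝ] V) : V →ₗ[ℝ] V)) = w (riesz α) := by
  refine ext_riesz fun v => ?_
  rw [inner_riesz, ← D.inner_W (D.W.inv_mem hw) (w (riesz α))]
  have : w⁻¹ (w (riesz α)) = riesz α := by
    change (w⁻¹ * w) _ = _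
    simp
  rw [this, inner_riesz]
  rfl

theorem inner_riesz_comp {w : V ≃ₗ[ℝ] V} (hw : w ∈ D.W) (α β : Module.Dual ℝ V) :
    inner ℝ (riesz (α ∘ₗ ((w⁻¹ : V ≃ₗ[ℝ] V) : V →ₗ[ℝ] V)))
      (riesz (β ∘ₗ ((w⁻¹ : V ≃ₗ[ℝ] V) : V →ₗ[ℝ] V))) = inner ℝ (riesz α) (riesz β) := by
  rw [D.riesz_comp hw, D.riesz_comp hw, D.inner_W hw]

theorem covector_comp {w : V ≃ₗ[ℝ] V} (hw : w ∈ D.W) (α : Module.Dual ℝ V) :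
    covector (α ∘ₗ ((w⁻¹ : V ≃ₗ[ℝ] V) : V →ₗ[ℝ] V)) = w (covector α) := by
  rw [covector, D.inner_riesz_comp hw, D.riesz_comp hw, covector, map_smul]

theorem grad_act (g : D.Wa) (a : V →ᵃ[ℝ] ℝ) :
    grad (D.act g a) = grad a ∘ₗ (((D.gradW g : V ≃ₗ[ℝ] V)⁻¹ : V ≃ₗ[ℝ] V) : V →ₗ[ℝ] V) := by
  rw [show ((D.gradW g : V ≃ₗ[ℝ] V)⁻¹ : V ≃ₗ[ℝ] V) = (D.gradW g⁻¹ : V ≃ₗ[ℝ] V) by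
    rw [map_inv]; rfl]
  rfl

theorem covector_grad_act (g : D.Wa) (a : V →ᵃ[ℝ] ℝ) :
    covector (grad (D.act g a)) = (D.gradW g : V ≃ₗ[ℝ] V) (covector (grad a)) := by
  rw [grad_act, D.covector_comp (D.gradW g).2]

theorem act_one (a : V →ᵃ[ℝ] ℝ) : D.act 1 a = a := by
  ext v
  rw [act_apply]
  simp

theorem act_inv_act (g : D.Wa) (a : V →ᵃ[ℝ] ℝ) : D.act g⁻¹ (D.act g a) = a := by
  rw [← act_mul, inv_mul_cancel, act_one]

theorem act_act_inv (g : D.Wa) (a : V →ᵃ[ℝ] ℝ) : D.act g (D.act g⁻¹ a) = a := by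
  rw [← act_mul, mul_inv_cancel, act_one]

theorem grad_ne_zero {a : V →ᵃ[ℝ] ℝ} (ha : a ∈ D.affineRoots) : grad a ≠ 0 := by
  obtain ⟨α, hα, m, rfl⟩ := ha
  intro h0
  have : α = 0 := by simpa [grad] using h0
  exact D.isRootSystem.zero_notMem (this ▸ hα)

theorem neg_mem_affineRoots {a : V →ᵃ[ℝ] ℝ} (ha : a ∈ D.affineRoots) : -a ∈ D.affineRoots := by
  obtain ⟨α, hα, m, rfl⟩ := ha
  exact ⟨-α, D.neg_mem_R hα, -m, by ext v; simp; ring⟩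

theorem neg_neg_of_pos {a : V →ᵃ[ℝ] ℝ} (ha : a ∈ D.posAffineRoots) : -a ∈ D.negAffineRoots := by
  simpa [negAffineRoots] using ha

theorem neg_pos_of_neg {a : V →ᵃ[ℝ] ℝ} (ha : a ∈ D.negAffineRoots) : -a ∈ D.posAffineRoots := ha

/-! ### Reflections in arbitrary affine roots -/

/-- The reflection `s_a ∈ W^a` in an affine root, extended by `1` to all affine functions. -/
def reflElt (a : V →ᵃ[ℝ] ℝ) : D.Wa :=
  open Classical in if h : a ∈ D.affineRoots then D.s ⟨a, h⟩ else 1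

theorem reflElt_apply {a : V →ᵃ[ℝ] ℝ} (ha : a ∈ D.affineRoots) (v : V) :
    (D.reflElt a : V ≃ᵃ[ℝ] V) v = v - a v • covector (grad a) := by
  rw [reflElt, dif_pos ha]
  rfl

theorem reflElt_simple (a : D.simpleAffineRoots) : D.reflElt a = D.simpleRefl a := by
  rw [reflElt, dif_pos (D.simpleAffineRoots_subset a.2)]
  rfl

theorem reflElt_mul_self (a : V →ᵃ[ℝ] ℝ) : D.reflElt a * D.reflElt a = 1 := by
  by_cases ha : a ∈ D.affineRoots
  · apply Subtype.ext
    ext v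
    change (D.reflElt a : V ≃ᵃ[ℝ] V) ((D.reflElt a : V ≃ᵃ[ℝ] V) v) = v
    simp only [D.reflElt_apply ha]
    rw [affine_apply _ (v - _), map_sub, map_smul, apply_covector_self (D.grad_ne_zero ha),
      affine_apply a v, smul_eq_mul]
    module
  · simp [reflElt, ha]

theorem reflElt_inv (a : V →ᵃ[ℝ] ℝ) : (D.reflElt a)⁻¹ = D.reflElt a :=
  inv_eq_of_mul_eq_one_left (D.reflElt_mul_self a)

theorem simpleRefl_inv (a : D.simpleAffineRoots) : (D.simpleRefl a)⁻¹ = D.simpleRefl a :=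
  inv_eq_of_mul_eq_one_left (D.simpleRefl_mul_self a)

theorem act_reflElt {a : V →ᵃ[ℝ] ℝ} (ha : a ∈ D.affineRoots) (b : V →ᵃ[ℝ] ℝ) :
    D.act (D.reflElt a) b = b - grad b (covector (grad a)) • a := by
  ext v
  rw [act_apply, reflElt_inv, D.reflElt_apply ha, affine_apply b, map_sub, map_smul]
  simp only [AffineMap.coe_sub, AffineMap.coe_smul, Pi.sub_apply, Pi.smul_apply, smul_eq_mul]
  rw [affine_apply b v]
  ring

theorem act_reflElt_self {a : V →ᵃ[ℝ] ℝ} (ha : a ∈ D.affineRoots) :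
    D.act (D.reflElt a) a = -a := by
  rw [D.act_reflElt ha, apply_covector_self (D.grad_ne_zero ha)]
  module

theorem act_simpleRefl_self (a : D.simpleAffineRoots) :
    D.act (D.simpleRefl a) a = -(a : V →ᵃ[ℝ] ℝ) := by
  rw [← reflElt_simple, D.act_reflElt_self (D.simpleAffineRoots_subset a.2)]

theorem reflElt_act (g : D.Wa) {a : V →ᵃ[ℝ] ℝ} (ha : a ∈ D.affineRoots) :
    D.reflElt (D.act g a) = g * D.reflElt a * g⁻¹ := by
  apply Subtype.ext
  ext v
  change _ = (g : V ≃ᵃ[ℝ] V) ((D.reflElt a : V ≃ᵃ[ℝ] V) (((g⁻¹ : D.Wa) : V ≃ᵃ[ℝ] V) v))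
  rw [D.reflElt_apply (D.act_mem_affineRoots g ha), D.reflElt_apply ha, act_apply,
    covector_grad_act]
  set x := ((g⁻¹ : D.Wa) : V ≃ᵃ[ℝ] V) v with hx
  have hv : v = (g : V ≃ᵃ[ℝ] V) x := by
    rw [hx]
    change v = ((g * g⁻¹ : D.Wa) : V ≃ᵃ[ℝ] V) v
    simp
  have h := (g : V ≃ᵃ[ℝ] V).map_vadd x (-(a x • covector (grad a)))
  simp only [vadd_eq_add] at h
  rw [sub_eq_add_neg, sub_eq_add_neg, add_comm x, h, ← hv, map_neg, map_smul]
  exact add_comm _ _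

/-! ### Inversions -/

/-- The set of inversions `R^{a,+} ∩ g⁻¹ R^{a,-}` of `g ∈ W^a`. -/
def inversions (g : D.Wa) : Set (V →ᵃ[ℝ] ℝ) :=
  {a ∈ D.posAffineRoots | D.act g a ∈ D.negAffineRoots}

theorem length_eq_ncard (g : D.Wa) : D.length g = (D.inversions g).ncard := rfl

theorem eq_simple_of_neg (a : D.simpleAffineRoots) {b : V →ᵃ[ℝ] ℝ} (hb : b ∈ D.posAffineRoots)
    (h : D.act (D.simpleRefl a) b ∈ D.negAffineRoots) : b = a := by
  by_contra hab
  exact D.not_pos_of_neg h (D.act_simpleRefl_pos a hb hab)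

theorem act_simpleRefl_neg (a : D.simpleAffineRoots) {b : V →ᵃ[ℝ] ℝ} (hb : b ∈ D.negAffineRoots)
    (hab : b ≠ -a) : D.act (D.simpleRefl a) b ∈ D.negAffineRoots := by
  have := D.act_simpleRefl_pos a hb fun h => hab (by rw [← h, neg_neg])
  rwa [act_neg] at this

/-- The only positive affine root that s_a makes negative is a, so s_a can change the sign of g b
only when g b = ±a. This recursion drives both the relations of the Dunkl operators and the product
formula for the scalar cocycle. -/
theorem inversions_simpleRefl_mul (a : D.simpleAffineRoots) {g : D.Wa}
    (h : D.act g⁻¹ a ∈ D.posAffineRoots) :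
    D.inversions (D.simpleRefl a * g) = insert (D.act g⁻¹ a) (D.inversions g) := by
  ext b
  simp only [inversions, Set.mem_insert_iff, Set.mem_ofPred_eq, act_mul]
  constructor
  · rintro ⟨hb, hb'⟩
    rcases D.pos_or_neg (D.act_mem_affineRoots g (D.mem_affineRoots_of_pos hb)) with h1 | h1
    · left
      rw [← D.eq_simple_of_neg a h1 hb', act_inv_act]
    · exact Or.inr ⟨hb, h1⟩
  · rintro (rfl | ⟨hb, hb'⟩)
    · refine ⟨h, ?_⟩
      rw [act_act_inv, act_simpleRefl_self]
      exact D.neg_neg_of_pos (D.simple_pos a.2)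
    · refine ⟨hb, D.act_simpleRefl_neg a hb' fun h1 => ?_⟩
      have h2 : b = -D.act g⁻¹ a := by rw [← act_neg, ← h1, act_inv_act]
      rw [h2] at hb
      exact D.not_pos_of_neg (D.neg_neg_of_pos h) hb

theorem act_inv_notMem_inversions (a : D.simpleAffineRoots) (g : D.Wa) :
    D.act g⁻¹ a ∉ D.inversions g := by
  rintro ⟨-, h⟩
  rw [act_act_inv] at h
  exact D.not_pos_of_neg h (D.simple_pos a.2)

/-- Without a sign condition on g⁻¹a only an inclusion remains, which suffices for length bounds and
for the exchange condition. -/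
theorem inversions_simpleRefl_mul_subset (a : D.simpleAffineRoots) (g : D.Wa) :
    D.inversions (D.simpleRefl a * g) ⊆ insert (D.act g⁻¹ a) (D.inversions g) := by
  rintro b ⟨hb, hb'⟩
  rw [act_mul] at hb'
  rcases D.pos_or_neg (D.act_mem_affineRoots g (D.mem_affineRoots_of_pos hb)) with h1 | h1
  · left
    rw [← D.eq_simple_of_neg a h1 hb', act_inv_act]
  · exact Or.inr ⟨hb, h1⟩

theorem nonneg_of_pos {a : V →ᵃ[ℝ] ℝ} (ha : a ∈ D.posAffineRoots) : 0 ≤ a 0 := by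
  rcases ha with ⟨α, hα, m, hm, rfl⟩ | ⟨α, hα, rfl⟩
  · simpa using hm.le
  · simp

/-- An inversion α + m has value m ≥ 0 at the origin, while its image under g has value α(g⁻¹0) + m
≤ 0 there, so m is confined to a bounded interval for each of the finitely many α. Finiteness is
needed because `ncard` is 0 on infinite sets: only with it does length 0 mean that there are no
inversions. -/
theorem inversions_finite (g : D.Wa) : (D.inversions g).Finite := by
  let f : Module.Dual ℝ V × ℤ → (V →ᵃ[ℝ] ℝ) := fun p =>
    p.1.toAffineMap + AffineMap.const ℝ V (p.2 : ℝ)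
  let x := ((g⁻¹ : D.Wa) : V ≃ᵃ[ℝ] V) 0
  have hfin : (D.R ×ˢ ⋃ α ∈ D.R, Set.Icc 0 ⌈-α x⌉).Finite :=
    D.isRootSystem.finite.prod (D.isRootSystem.finite.biUnion fun _ _ => Set.finite_Icc _ _)
  refine (hfin.image f).subset ?_
  rintro b ⟨hb, hb'⟩
  obtain ⟨α, hα, m, rfl⟩ := D.mem_affineRoots_of_pos hb
  have h1 := D.nonneg_of_pos hb
  have h2 := D.nonneg_of_pos (D.neg_pos_of_neg hb')
  have h3 : D.act g (α.toAffineMap + AffineMap.const ℝ V (m : ℝ)) 0 = α x + m := by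
    rw [act_apply]; simp [x]
  have h2' : 0 ≤ -(D.act g (α.toAffineMap + AffineMap.const ℝ V (m : ℝ)) 0) := h2
  rw [h3] at h2'
  refine ⟨(α, m), ⟨hα, Set.mem_biUnion hα ⟨?_, ?_⟩⟩, rfl⟩
  · simpa using h1
  · have h4 : (m : ℝ) ≤ -α x := by linarith
    exact_mod_cast h4.trans (Int.le_ceil _)

theorem inversions_omega (ω : D.Ω) : D.inversions ω = ∅ := by
  have h : (D.inversions ω).ncard = 0 := ω.2
  exact (Set.ncard_eq_zero (D.inversions_finite _)).1 h

theorem omega_pos (ω : D.Ω) {b : V →ᵃ[ℝ] ℝ} (hb : b ∈ D.posAffineRoots) :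
    D.act ω b ∈ D.posAffineRoots := by
  rcases D.pos_or_neg (D.act_mem_affineRoots ω (D.mem_affineRoots_of_pos hb)) with h | h
  · exact h
  · have : b ∈ D.inversions ω := ⟨hb, h⟩
    rw [inversions_omega] at this
    exact this.elim

theorem omega_neg_iff (ω : D.Ω) {b : V →ᵃ[ℝ] ℝ} (hb : b ∈ D.affineRoots) :
    D.act ω b ∈ D.negAffineRoots ↔ b ∈ D.negAffineRoots := by
  constructor
  · intro h
    rcases D.pos_or_neg hb with h1 | h1
    · exact absurd (D.omega_pos ω h1) (D.not_pos_of_neg h)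
    · exact h1
  · intro h
    have := D.omega_pos ω h
    rwa [act_neg] at this

theorem inversions_omega_mul (ω : D.Ω) (g : D.Wa) :
    D.inversions (ω * g) = D.inversions g := by
  ext b
  simp only [inversions, Set.mem_ofPred_eq, act_mul]
  refine and_congr_right fun hb => ?_
  exact D.omega_neg_iff ω (D.act_mem_affineRoots g (D.mem_affineRoots_of_pos hb))

theorem inversions_one : D.inversions 1 = ∅ := by
  ext b
  simp only [inversions, Set.mem_ofPred_eq, act_one, Set.mem_empty_iff_false, iff_false, not_and]
  exact fun h h' => D.not_pos_of_neg h' h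

/-! ### Lengths and the exchange condition -/

theorem length_simpleRefl_mul_le (a : D.simpleAffineRoots) (g : D.Wa) :
    D.length (D.simpleRefl a * g) ≤ D.length g + 1 :=
  (Set.ncard_le_ncard (D.inversions_simpleRefl_mul_subset a g)
    ((D.inversions_finite g).insert _)).trans (Set.ncard_insert_le _ _)

theorem length_omega_mul (ω : D.Ω) (g : D.Wa) : D.length (ω * g) = D.length g := by
  rw [length_eq_ncard, inversions_omega_mul, length_eq_ncard]

theorem length_list_le (l : List D.simpleAffineRoots) :
    D.length (l.map D.simpleRefl).prod ≤ l.length := by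
  induction l with
  | nil => simp [length_eq_ncard, inversions_one]
  | cons a l ih =>
    simp only [List.map_cons, List.prod_cons, List.length_cons]
    exact (D.length_simpleRefl_mul_le a _).trans (by omega)

/-- Induction on the word. An inversion c of s_a g is either g⁻¹a, and then s_a g s_c = g deletes
the first letter, or an inversion of g, and then a letter further to the right is deleted. -/
theorem exchange (l : List D.simpleAffineRoots) {c : V →ᵃ[ℝ] ℝ}
    (hc : c ∈ D.inversions (l.map D.simpleRefl).prod) :
    ∃ l' : List D.simpleAffineRoots, l'.length + 1 = l.length ∧
      (l'.map D.simpleRefl).prod = (l.map D.simpleRefl).prod * D.reflElt c := by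
  induction l with
  | nil =>
    rw [List.map_nil, List.prod_nil, inversions_one] at hc
    exact hc.elim
  | cons a l ih =>
    have hc' := D.inversions_simpleRefl_mul_subset a (l.map D.simpleRefl).prod
      (by simpa using hc)
    rcases hc' with h | h
    · refine ⟨l, rfl, ?_⟩
      have hR := D.mem_affineRoots_of_pos hc.1
      have h2 : D.act (l.map D.simpleRefl).prod c = a := by rw [h, act_act_inv]
      have h3 := D.reflElt_act (l.map D.simpleRefl).prod hR
      rw [h2, reflElt_simple] at h3
      simp only [List.map_cons, List.prod_cons]
      rw [h3]
      simp [mul_assoc, D.reflElt_mul_self c]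
    · obtain ⟨l', hl', hp⟩ := ih h
      exact ⟨a :: l', by simp [hl'], by simp [hp, mul_assoc]⟩

/-- Exchange removes a letter from a reduced expression, and the factor in Ω does not affect
lengths. This is the source of the triangularity of the Dunkl operators. -/
theorem length_mul_reflElt_lt (g : D.Wa) {c : V →ᵃ[ℝ] ℝ} (hc : c ∈ D.inversions g) :
    D.length (g * D.reflElt c) < D.length g := by
  have hg := D.reducedExpr_prod g
  have hl := D.reducedExpr_length g
  set ω := (D.reducedExpr g).1
  set l := (D.reducedExpr g).2
  rw [hg, inversions_omega_mul] at hc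
  obtain ⟨l', hl', hp⟩ := D.exchange l hc
  have h1 := D.length_list_le l'
  conv_lhs => rw [hg, mul_assoc, length_omega_mul, ← hp]
  omega

/-- If the word ends in a and keeps a positive, then the word without its last letter makes a
negative. Exchange therefore rewrites the whole product with two letters fewer, and induction
applies. -/
theorem prod_eq_one_of_pos (l : List D.simpleAffineRoots)
    (h : ∀ b ∈ D.posAffineRoots, D.act (l.map D.simpleRefl).prod b ∈ D.posAffineRoots) :
    (l.map D.simpleRefl).prod = 1 := by
  induction hn : l.length using Nat.strong_induction_on generalizing l with
  | _ n ih =>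
    rcases List.eq_nil_or_concat l with rfl | ⟨l₀, a, rfl⟩
    · simp
    · simp only [List.concat_eq_append] at h hn ⊢
      have ha := h a (D.simple_pos a.2)
      simp only [List.map_append, List.map_cons, List.map_nil, List.prod_append, List.prod_cons,
        List.prod_nil, mul_one, act_mul] at ha
      rw [act_simpleRefl_self, act_neg] at ha
      obtain ⟨l', hl', hp⟩ := D.exchange l₀ (c := a) ⟨D.simple_pos a.2, ha⟩
      rw [reflElt_simple] at hp
      have hp' : (List.map D.simpleRefl (l₀ ++ [a])).prod = (l'.map D.simpleRefl).prod := by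
        simp [hp]
      rw [hp'] at h ⊢
      refine ih l'.length ?_ l' h rfl
      rw [← hn]
      simp
      omega

end RootDatum

namespace RootDatum

variable (D : RootDatum V)

/-! ### The finite Weyl group -/

theorem exists_height : ∃ h : Module.Dual ℝ V →ₗ[ℝ] ℝ, ∀ f ∈ D.F, h f = 1 := by
  let b := Module.Basis.extend D.isRootBasis.linearIndependent
  refine ⟨b.constr ℝ fun _ => (1 : ℝ), fun f hf => ?_⟩
  have hf' : f ∈ D.isRootBasis.linearIndependent.extend (Set.subset_univ _) :=
    Module.Basis.subset_extend D.isRootBasis.linearIndependent hf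
  have := b.constr_basis ℝ (fun _ => (1 : ℝ)) ⟨f, hf'⟩
  simpa [b, Module.Basis.extend_apply_self] using this

theorem ne_zero_of_mem_R {α : Module.Dual ℝ V} (hα : α ∈ D.R) : α ≠ 0 :=
  fun h => D.isRootSystem.zero_notMem (h ▸ hα)

theorem refl_mem_W {α : Module.Dual ℝ V} (hα : α ∈ D.R) : refl α ∈ D.W :=
  Subgroup.subset_closure ⟨α, hα, rfl⟩

theorem comp_refl (β α : Module.Dual ℝ V) :
    β ∘ₗ (refl α : V →ₗ[ℝ] V) = β - β (covector α) • α := by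
  ext v
  simp [refl_apply, mul_comm]

theorem act_ofW (w : D.W) (a : V →ᵃ[ℝ] ℝ) (v : V) :
    D.act (D.ofW w) a v = a ((w : V ≃ₗ[ℝ] V)⁻¹ v) := by
  rw [act_apply, ← map_inv]
  rfl

theorem act_ofW_toAffineMap (w : D.W) (α : Module.Dual ℝ V) :
    D.act (D.ofW w) α.toAffineMap =
      (α ∘ₗ (((w : V ≃ₗ[ℝ] V)⁻¹ : V ≃ₗ[ℝ] V) : V →ₗ[ℝ] V)).toAffineMap := by
  ext v
  rw [act_ofW]
  rfl

theorem act_ofW_add_const (w : D.W) (α : Module.Dual ℝ V) (c : ℝ) :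
    D.act (D.ofW w) (α.toAffineMap + AffineMap.const ℝ V c) =
      (α ∘ₗ (((w : V ≃ₗ[ℝ] V)⁻¹ : V ≃ₗ[ℝ] V) : V →ₗ[ℝ] V)).toAffineMap +
        AffineMap.const ℝ V c := by
  ext v
  rw [act_ofW]
  rfl

theorem toAffineMap_pos {α : Module.Dual ℝ V} :
    α.toAffineMap ∈ D.posAffineRoots ↔ α ∈ D.posRoots := by
  constructor
  · rintro (⟨β, -, m, hm, h⟩ | ⟨β, hβ, h⟩)
    · have := congrArg (fun f : V →ᵃ[ℝ] ℝ => f 0) h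
      simp only [LinearMap.coe_toAffineMap, map_zero, AffineMap.coe_add, Pi.add_apply,
        AffineMap.const_apply, zero_add] at this
      have h2 : m = 0 := by exact_mod_cast this.symm
      omega
    · have : β = α := by
        ext v
        exact congrArg (fun f : V →ᵃ[ℝ] ℝ => f v) h
      exact this ▸ hβ
  · exact fun h => Or.inr ⟨α, h, rfl⟩

/-- A simple root, as a simple affine root. -/
def simpleRoot (α : D.F) : D.simpleAffineRoots :=
  ⟨(α : Module.Dual ℝ V).toAffineMap, Or.inl ⟨α, α.2, rfl⟩⟩

theorem simpleRefl_simpleRoot (α : D.F) :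
    D.simpleRefl (D.simpleRoot α) =
      D.ofW ⟨refl (α : Module.Dual ℝ V), D.refl_mem_W (D.isRootBasis.subset α.2)⟩ := by
  apply Subtype.ext
  ext v
  rfl

theorem comp_refl_pos {α : Module.Dual ℝ V} (hα : α ∈ D.F) {β : Module.Dual ℝ V}
    (hβ : β ∈ D.posRoots) (h : β ≠ α) :
    β ∘ₗ (refl α : V →ₗ[ℝ] V) ∈ D.posRoots := by
  have h1 := D.act_simpleRefl_pos (D.simpleRoot ⟨α, hα⟩) (D.toAffineMap_pos.2 hβ) (by
    intro h2
    apply h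
    ext v
    exact congrArg (fun f : V →ᵃ[ℝ] ℝ => f v) h2)
  rw [simpleRefl_simpleRoot, act_ofW_toAffineMap] at h1
  simpa [refl_inv] using D.toAffineMap_pos.1 h1

theorem refl_comp {w : V ≃ₗ[ℝ] V} (hw : w ∈ D.W) (α : Module.Dual ℝ V) :
    refl (α ∘ₗ ((w⁻¹ : V ≃ₗ[ℝ] V) : V →ₗ[ℝ] V)) = w * refl α * w⁻¹ := by
  ext v
  rw [refl_apply, D.covector_comp hw]
  change _ = w (refl α (w⁻¹ v))
  rw [refl_apply, map_sub, map_smul]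
  congr 1
  change v = (w * w⁻¹) v
  simp

theorem exists_simple_apply_pos {β : Module.Dual ℝ V} (hβ : β ∈ AddSubmonoid.closure D.F)
    (x : V) (h : 0 < β x) : ∃ α ∈ D.F, 0 < α x := by
  by_contra! hcon
  have : β x ≤ 0 := by
    clear h
    induction hβ using AddSubmonoid.closure_induction with
    | mem y hy => exact hcon y hy
    | zero => simp
    | add y z _ _ hy hz => simpa using add_nonpos hy hz
  linarith

theorem apply_covector_pos_iff {α : Module.Dual ℝ V} (hα : α ∈ D.R) (η : Module.Dual ℝ V) :
    0 < η (covector α) ↔ 0 < inner ℝ (riesz η) (riesz α) := by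
  have := inner_riesz_pos (D.ne_zero_of_mem_R hα)
  rw [apply_covector]
  constructor
  · intro h
    have h2 := mul_pos h this
    rw [div_mul_cancel₀ _ this.ne'] at h2
    linarith
  · intro h
    positivity

theorem height_nat {h : Module.Dual ℝ V →ₗ[ℝ] ℝ} (hh : ∀ f ∈ D.F, h f = 1)
    {β : Module.Dual ℝ V} (hβ : β ∈ AddSubmonoid.closure D.F) : ∃ n : ℕ, h β = n := by
  induction hβ using AddSubmonoid.closure_induction with
  | mem y hy => exact ⟨1, by simp [hh y hy]⟩
  | zero => exact ⟨0, by simp⟩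
  | add y z _ _ hy hz =>
    obtain ⟨n, hn⟩ := hy
    obtain ⟨m, hm⟩ := hz
    exact ⟨n + m, by simp [hn, hm]⟩

/-- Induction on the height. Since ⟨β, β⟩ > 0, some simple α pairs positively with β. If β is not
simple, s_αβ is then a positive root of smaller height, and s_β = s_α s_{s_αβ} s_α. -/
theorem refl_mem_closure_simple {β : Module.Dual ℝ V} (hβ : β ∈ D.posRoots) :
    refl β ∈ Subgroup.closure (refl '' D.F) := by
  obtain ⟨h, hh⟩ := D.exists_height
  obtain ⟨n, hn⟩ := D.height_nat hh hβ.2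
  induction n using Nat.strong_induction_on generalizing β with
  | _ n ih =>
    by_cases hF : β ∈ D.F
    · exact Subgroup.subset_closure ⟨β, hF, rfl⟩
    obtain ⟨α, hα, hpos⟩ := D.exists_simple_apply_pos hβ.2 (riesz β) (by
      rw [← inner_riesz]
      exact inner_riesz_pos (D.ne_zero_of_mem_R hβ.1))
    have hαR := D.isRootBasis.subset hα
    have hβα : 0 < β (covector α) := by
      rw [D.apply_covector_pos_iff hαR, real_inner_comm, inner_riesz]
      exact hpos
    have h1 := D.comp_refl_pos hα hβ (fun h => hF (h ▸ hα))
    obtain ⟨m, hm⟩ := D.height_nat hh h1.2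
    have hmn : m < n := by
      rw [comp_refl, map_sub, map_smul, hh α hα, hn, smul_eq_mul, mul_one] at hm
      have : (m : ℝ) < n := by linarith
      exact_mod_cast this
    have h2 := ih m hmn h1 hm
    have h3 := D.refl_comp (D.refl_mem_W hαR) β
    rw [refl_inv] at h3
    rw [h3] at h2
    have h4 : refl α ∈ Subgroup.closure (refl '' D.F) := Subgroup.subset_closure ⟨α, hα, rfl⟩
    have h5 := Subgroup.mul_mem _ (Subgroup.mul_mem _ h4 h2) h4
    have h6 : refl α * (refl α * refl β * refl α) * refl α = refl β := by
      rw [mul_assoc, mul_assoc (refl α * refl β), refl_mul_self, mul_one, ← mul_assoc,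
        refl_mul_self, one_mul]
    rwa [h6] at h5

theorem refl_neg (α : Module.Dual ℝ V) : refl (-α) = refl α := by
  ext v
  simp [refl_apply, covector_neg]

theorem pos_or_neg_mem_posRoots {α : Module.Dual ℝ V} (hα : α ∈ D.R) :
    α ∈ D.posRoots ∨ -α ∈ D.posRoots := by
  rcases D.isRootBasis.mem_or_neg_mem α hα with h | h
  · exact Or.inl ⟨hα, h⟩
  · exact Or.inr ⟨D.neg_mem_R hα, h⟩

theorem W_eq_closure_simple : D.W = Subgroup.closure (refl '' D.F) := by
  refine le_antisymm ((Subgroup.closure_le _).2 ?_)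
    (Subgroup.closure_mono (Set.image_mono D.isRootBasis.subset))
  rintro _ ⟨α, hα, rfl⟩
  rcases D.pos_or_neg_mem_posRoots hα with h | h
  · exact D.refl_mem_closure_simple h
  · have := D.refl_mem_closure_simple h
    rwa [refl_neg] at this

theorem ofW_eq_prod (w : D.W) :
    ∃ l : List D.F, (l.map fun α => D.simpleRefl (D.simpleRoot α)).prod = D.ofW w := by
  obtain ⟨w, hw⟩ := w
  have hw' := hw
  rw [W_eq_closure_simple] at hw'
  induction hw' using Subgroup.closure_induction_left with
  | one => exact ⟨[], by simp; rfl⟩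
  | mul_left x hx y hy ih =>
    obtain ⟨α, hα, rfl⟩ := hx
    rw [← W_eq_closure_simple] at hy
    obtain ⟨l, hl⟩ := ih hy
    refine ⟨⟨α, hα⟩ :: l, ?_⟩
    rw [List.map_cons, List.prod_cons, hl, simpleRefl_simpleRoot, ← map_mul]
    rfl
  | inv_mul_cancel x hx y hy ih =>
    obtain ⟨α, hα, rfl⟩ := hx
    rw [← W_eq_closure_simple] at hy
    obtain ⟨l, hl⟩ := ih hy
    refine ⟨⟨α, hα⟩ :: l, ?_⟩
    rw [List.map_cons, List.prod_cons, hl, simpleRefl_simpleRoot, ← map_mul]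
    congr 1

theorem ofW_injective : Function.Injective D.ofW := by
  intro w w' h
  apply Subtype.ext
  ext v
  exact congrArg (fun g : D.Wa => (g : V ≃ᵃ[ℝ] V) v) h

/-- Elements of W do not move the constant part of an affine root, so they preserve R + ℤ_{>0}.
Positivity on R^+ thus gives positivity on all of R^{a,+}. -/
theorem eq_one_of_posRoots (w : D.W)
    (h : ∀ α ∈ D.posRoots,
      α ∘ₗ (((w : V ≃ₗ[ℝ] V)⁻¹ : V ≃ₗ[ℝ] V) : V →ₗ[ℝ] V) ∈ D.posRoots) : w = 1 := by
  obtain ⟨l, hl⟩ := D.ofW_eq_prod w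
  apply D.ofW_injective
  rw [← hl, map_one]
  have := D.prod_eq_one_of_pos (l.map D.simpleRoot)
  rw [List.map_map] at this
  refine this fun b hb => ?_
  change D.act (l.map fun α => D.simpleRefl (D.simpleRoot α)).prod b ∈ _
  rw [hl]
  rcases hb with ⟨α, hα, m, hm, rfl⟩ | ⟨α, hα, rfl⟩
  · rw [act_ofW_add_const]
    exact Or.inl ⟨_, D.comp_mem_R (D.W.inv_mem w.2) hα, m, hm, rfl⟩
  · rw [act_ofW_toAffineMap, toAffineMap_pos]
    exact h α hα

/-- The roots need not span V^*, so the action on R does not see all of V directly. This confines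
the displacement of a vector to the part of V that the roots do see. -/
theorem apply_sub_self_mem_span_riesz {w : V ≃ₗ[ℝ] V} (hw : w ∈ D.W) (v : V) :
    w v - v ∈ Submodule.span ℝ (riesz '' D.R) := by
  induction hw using Subgroup.closure_induction'' generalizing v with
  | mem x hx =>
    obtain ⟨α, hα, rfl⟩ := hx
    have : refl α v - v = (-(α v * (2 / inner ℝ (riesz α) (riesz α)))) • riesz α := by
      rw [refl_apply, covector]
      module
    rw [this]
    exact Submodule.smul_mem _ _ (Submodule.subset_span ⟨α, hα, rfl⟩)
  | inv_mem x hx =>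
    obtain ⟨α, hα, rfl⟩ := hx
    have : (refl α)⁻¹ v - v = (-(α v * (2 / inner ℝ (riesz α) (riesz α)))) • riesz α := by
      rw [refl_inv, refl_apply, covector]
      module
    rw [this]
    exact Submodule.smul_mem _ _ (Submodule.subset_span ⟨α, hα, rfl⟩)
  | one => simp
  | mul a b _ _ ha hb =>
    have : (a * b) v - v = (a (b v) - b v) + (b v - v) := by
      change a (b v) - v = _
      abel
    rw [this]
    exact Submodule.add_mem _ (ha _) (hb _)

/-- W acts faithfully on the finite set R: if w and w' act alike, then wv - w'v lies in the span of
the vectors representing roots and is orthogonal to that span. -/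
instance finite_W : Finite D.W := by
  have : Finite D.R := D.isRootSystem.finite
  let f : D.W → (D.R → D.R) := fun w α =>
    ⟨(α : Module.Dual ℝ V) ∘ₗ ((w : V ≃ₗ[ℝ] V) : V →ₗ[ℝ] V), D.comp_mem_R w.2 α.2⟩
  refine Finite.of_injective f fun w w' h => ?_
  have h1 : ∀ α ∈ D.R, ∀ v, α ((w : V ≃ₗ[ℝ] V) v) = α ((w' : V ≃ₗ[ℝ] V) v) := by
    intro α hα v
    have := congrArg Subtype.val (congrFun h ⟨α, hα⟩)
    exact congrArg (fun g : Module.Dual ℝ V => g v) this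
  apply Subtype.ext
  ext v
  rw [← sub_eq_zero]
  set x := (w : V ≃ₗ[ℝ] V) v - (w' : V ≃ₗ[ℝ] V) v with hx
  have h2 : x ∈ Submodule.span ℝ (riesz '' D.R) := by
    have : x = ((w : V ≃ₗ[ℝ] V) v - v) - ((w' : V ≃ₗ[ℝ] V) v - v) := by rw [hx]; abel
    rw [this]
    exact Submodule.sub_mem _ (D.apply_sub_self_mem_span_riesz w.2 v) (D.apply_sub_self_mem_span_riesz w'.2 v)
  have h3 : ∀ y ∈ Submodule.span ℝ (riesz '' D.R), inner ℝ y x = 0 := by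
    intro y hy
    induction hy using Submodule.span_induction with
    | mem y hy =>
      obtain ⟨α, hα, rfl⟩ := hy
      rw [inner_riesz, hx, map_sub, h1 α hα, sub_self]
    | zero => simp
    | add y z _ _ hy hz => rw [inner_add_left, hy, hz, add_zero]
    | smul c y _ hy => rw [real_inner_smul_left, hy, mul_zero]
  exact inner_self_eq_zero.1 (h3 x h2)

/-! ### Freeness of the Weyl group on regular weights -/

theorem exists_dominant (η : Module.Dual ℝ V) :
    ∃ u ∈ D.W, ∀ α ∈ D.F, 0 ≤ (η ∘ₗ (u : V →ₗ[ℝ] V)) (covector α) := by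
  obtain ⟨h, hh⟩ := D.exists_height
  -- The height is maximized over the finite orbit. Applying s_α to the maximizer η' changes the
  -- height by -η'(α^∨), so this number cannot be positive.
  obtain ⟨u, hu⟩ := Finite.exists_max fun u : D.W => h (η ∘ₗ ((u : V ≃ₗ[ℝ] V) : V →ₗ[ℝ] V))
  refine ⟨u, u.2, fun α hα => ?_⟩
  have h1 := hu (u * ⟨refl α, D.refl_mem_W (D.isRootBasis.subset hα)⟩)
  have h2 : η ∘ₗ (((u * ⟨refl α, D.refl_mem_W (D.isRootBasis.subset hα)⟩ : D.W) : V ≃ₗ[ℝ] V) :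
      V →ₗ[ℝ] V) = (η ∘ₗ ((u : V ≃ₗ[ℝ] V) : V →ₗ[ℝ] V)) ∘ₗ (refl α : V →ₗ[ℝ] V) := rfl
  rw [h2, comp_refl, map_sub, map_smul, hh α hα, smul_eq_mul, mul_one] at h1
  linarith

theorem comp_ne_zero {u : V ≃ₗ[ℝ] V} (hu : u ∈ D.W) {E : Type*} [AddCommGroup E] [Module ℝ E]
    {η : V →ₗ[ℝ] E} (hη : ∀ α ∈ D.R, η (covector α) ≠ 0) {α : Module.Dual ℝ V} (hα : α ∈ D.R) :
    η (u (covector α)) ≠ 0 := by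
  rw [← D.covector_comp hu]
  exact hη _ (D.comp_mem_R (D.W.inv_mem hu) hα)

/-- A dominant conjugate η' of a regular η pairs strictly positively with every positive root. An
element that fixes η' preserves these pairings, hence preserves R^+, and so is trivial. -/
theorem eq_one_of_fix_real {η : Module.Dual ℝ V} (hη : ∀ α ∈ D.R, η (covector α) ≠ 0)
    {w : V ≃ₗ[ℝ] V} (hw : w ∈ D.W) (h : η ∘ₗ (w : V →ₗ[ℝ] V) = η) : w = 1 := by
  obtain ⟨u, hu, hdom⟩ := D.exists_dominant η
  set η' := η ∘ₗ (u : V →ₗ[ℝ] V) with hη'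
  have hpos : ∀ α ∈ D.posRoots, 0 < inner ℝ (riesz η') (riesz α) := by
    rintro α ⟨hαR, hα⟩
    have h0 : α = 0 ∨ 0 < inner ℝ (riesz η') (riesz α) := by
      clear hαR
      induction hα using AddSubmonoid.closure_induction with
      | mem x hx =>
        right
        rw [← D.apply_covector_pos_iff (D.isRootBasis.subset hx)]
        exact lt_of_le_of_ne (hdom x hx)
          (D.comp_ne_zero hu hη (D.isRootBasis.subset hx)).symm
      | zero => exact Or.inl rfl
      | add x y _ _ hx hy =>
        rcases hx with rfl | hx
        · simpa using hy
        · rcases hy with rfl | hy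
          · right; simpa using hx
          · right; rw [riesz_add, inner_add_right]; exact add_pos hx hy
    exact h0.resolve_left (D.ne_zero_of_mem_R hαR)
  have hfix : η' ∘ₗ ((u⁻¹ * w * u : V ≃ₗ[ℝ] V) : V →ₗ[ℝ] V) = η' := by
    ext v
    have h1 : η (w (u v)) = η (u v) := congrArg (fun f : Module.Dual ℝ V => f (u v)) h
    change η ((u * (u⁻¹ * w * u)) v) = η (u v)
    rw [show u * (u⁻¹ * w * u) = w * u by group]
    exact h1
  have hmem : u⁻¹ * w * u ∈ D.W := D.W.mul_mem (D.W.mul_mem (D.W.inv_mem hu) hw) hu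
  have h1 := D.eq_one_of_posRoots ⟨u⁻¹ * w * u, hmem⟩ fun α hα => by
    have h2 := D.comp_mem_R (D.W.inv_mem hmem) hα.1
    rcases D.pos_or_neg_mem_posRoots h2 with h3 | h3
    · exact h3
    · exfalso
      have h4 := hpos _ h3
      have h5 : η' ∘ₗ (((u⁻¹ * w * u)⁻¹ : V ≃ₗ[ℝ] V) : V →ₗ[ℝ] V) = η' := by
        conv_lhs => rw [← hfix]
        ext v
        change η' ((u⁻¹ * w * u * (u⁻¹ * w * u)⁻¹) v) = _
        simp
      rw [riesz_neg, inner_neg_right] at h4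
      have h6 := D.inner_riesz_comp hmem η' α
      rw [h5] at h6
      rw [h6] at h4
      linarith [hpos α hα]
  have h2 : u⁻¹ * w * u = 1 := congrArg Subtype.val h1
  have h3 : w = u * (u⁻¹ * w * u) * u⁻¹ := by group
  rw [h3, h2]
  simp

/-- Reduction to a real functional: each co-root excludes at most one real t for which Re λ + t Im λ
vanishes on it, so some t gives a regular real functional, fixed by w as well. -/
theorem eq_one_of_fix {lam : V →ₗ[ℝ] ℂ} (hlam : ∀ α ∈ D.R, lam (covector α) ≠ 0)
    {w : V ≃ₗ[ℝ] V} (hw : w ∈ D.W) (h : lam ∘ₗ (w : V →ₗ[ℝ] V) = lam) : w = 1 := by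
  let re : Module.Dual ℝ V := Complex.reLm ∘ₗ lam
  let im : Module.Dual ℝ V := Complex.imLm ∘ₗ lam
  have hfin : (⋃ α ∈ D.R, {t : ℝ | re (covector α) + t * im (covector α) = 0}).Finite := by
    refine D.isRootSystem.finite.biUnion fun α hα => Set.Subsingleton.finite ?_
    intro t ht t' ht'
    simp only [Set.mem_ofPred_eq] at ht ht'
    by_contra hne
    have h1 : (t - t') * im (covector α) = 0 := by linear_combination ht - ht'
    have h2 : im (covector α) = 0 := (mul_eq_zero.1 h1).resolve_left (sub_ne_zero.2 hne)
    rw [h2, mul_zero, add_zero] at ht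
    exact hlam α hα (Complex.ext ht h2)
  obtain ⟨t, ht⟩ := hfin.exists_notMem
  refine D.eq_one_of_fix_real (η := re + t • im) (fun α hα h0 => ht ?_) hw ?_
  · exact Set.mem_biUnion hα (by simpa using h0)
  · ext v
    have h1 : lam (w v) = lam v := congrArg (fun f : V →ₗ[ℝ] ℂ => f v) h
    simp [re, im, h1]

end RootDatum

/-! ### Representing vectors and the dual action -/

theorem riesz_surjective (v : V) : ∃ α : Module.Dual ℝ V, riesz α = v := by
  refine ⟨(innerSL ℝ v : V →ₗ[ℝ] ℝ), ext_riesz fun w => ?_⟩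
  rw [inner_riesz]
  rfl

theorem dualAct_apply (w : V ≃ₗ[ℝ] V) (lam : V →ₗ[ℝ] ℂ) (v : V) :
    dualAct w lam v = lam (w⁻¹ v) := rfl

theorem dualAct_one (lam : V →ₗ[ℝ] ℂ) : dualAct 1 lam = lam := rfl

theorem dualAct_mul (w w' : V ≃ₗ[ℝ] V) (lam : V →ₗ[ℝ] ℂ) :
    dualAct (w * w') lam = dualAct w (dualAct w' lam) := by
  ext v
  simp only [dualAct_apply, mul_inv_rev]
  rfl

namespace RootDatum

variable (D : RootDatum V)

/-! ### Weights with an indeterminate level -/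

/-- The value on an affine function `b` of the weight with gradient part `λ` whose
level is an indeterminate. -/
def levelWeight (lam : V →ₗ[ℝ] ℂ) (b : V →ᵃ[ℝ] ℝ) : Polynomial ℂ :=
  Polynomial.C (lam (riesz (grad b))) + Polynomial.C (b 0 : ℂ) * Polynomial.X

theorem levelWeight_sub_smul (lam : V →ₗ[ℝ] ℂ) (b c : V →ᵃ[ℝ] ℝ) (r : ℝ) :
    levelWeight lam (b - r • c) =
      levelWeight lam b - Polynomial.C (r : ℂ) * levelWeight lam c := by
  have h1 : riesz (grad (b - r • c)) = riesz (grad b) - r • riesz (grad c) := by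
    have : grad (b - r • c) = grad b + (-r) • grad c := by
      ext v
      simp [grad, sub_eq_add_neg]
    rw [this, riesz_add, riesz_smul]
    module
  have h2 : (b - r • c) 0 = b 0 - r * c 0 := rfl
  simp only [levelWeight, h1, h2, map_sub, map_smul, Complex.real_smul, Complex.ofReal_sub,
    Complex.ofReal_mul, map_mul]
  ring

theorem act_sub_smul (g : D.Wa) (b c : V →ᵃ[ℝ] ℝ) (r : ℝ) :
    D.act g (b - r • c) = D.act g b - r • D.act g c := rfl

theorem riesz_grad_act (g : D.Wa) (a : V →ᵃ[ℝ] ℝ) :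
    riesz (grad (D.act g a)) = (D.gradW g : V ≃ₗ[ℝ] V) (riesz (grad a)) := by
  rw [grad_act, D.riesz_comp (D.gradW g).2]

theorem gradW_inv_coe (g : D.Wa) :
    (D.gradW g⁻¹ : V ≃ₗ[ℝ] V) = (D.gradW g : V ≃ₗ[ℝ] V)⁻¹ := by
  rw [map_inv]
  rfl

theorem apply_eq_gradW (g : D.Wa) (v : V) :
    (g : V ≃ᵃ[ℝ] V) v = (D.gradW g : V ≃ₗ[ℝ] V) v + (g : V ≃ᵃ[ℝ] V) 0 := by
  have := (g : V ≃ᵃ[ℝ] V).map_vadd 0 v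
  simp only [vadd_eq_add, add_zero] at this
  exact this

/-- The coefficient of X in the weight of g⁻¹ξ is ξ(g0), which recovers the translation part of g.
The constant coefficient recovers (Dg)λ, hence Dg, because W acts freely on regular weights. Setting
X = 0 would lose the translation part, which is why the level is kept indeterminate. -/
theorem eq_of_levelWeight_eq {lam : V →ₗ[ℝ] ℂ} (hlam : ∀ α ∈ D.R, lam (covector α) ≠ 0)
    {g h : D.Wa} (H : ∀ ξ, levelWeight lam (D.act g⁻¹ ξ) = levelWeight lam (D.act h⁻¹ ξ)) :
    g = h := by
  have h0 : ∀ ξ, lam (riesz (grad (D.act g⁻¹ ξ))) = lam (riesz (grad (D.act h⁻¹ ξ))) := by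
    intro ξ
    simpa [levelWeight] using congrArg (Polynomial.eval 0) (H ξ)
  have h1 : ∀ ξ, D.act g⁻¹ ξ 0 = D.act h⁻¹ ξ 0 := by
    intro ξ
    have := congrArg (Polynomial.eval 1) (H ξ)
    simp only [levelWeight, h0 ξ, Polynomial.eval_add, Polynomial.eval_C, Polynomial.eval_mul,
      Polynomial.eval_X, mul_one, add_right_inj, Complex.ofReal_inj] at this
    exact this
  have h2 : (g : V ≃ᵃ[ℝ] V) 0 = (h : V ≃ᵃ[ℝ] V) 0 := by
    refine ext_riesz fun v => ?_
    obtain ⟨α, rfl⟩ := riesz_surjective v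
    have := h1 α.toAffineMap
    rw [act_apply, act_apply, inv_inv, inv_inv] at this
    rw [real_inner_comm, inner_riesz, real_inner_comm, inner_riesz]
    exact this
  have h3 : ∀ v, lam ((D.gradW g : V ≃ₗ[ℝ] V)⁻¹ v) = lam ((D.gradW h : V ≃ₗ[ℝ] V)⁻¹ v) := by
    intro v
    obtain ⟨α, rfl⟩ := riesz_surjective v
    have := h0 α.toAffineMap
    rw [riesz_grad_act, riesz_grad_act, gradW_inv_coe, gradW_inv_coe] at this
    exact this
  have h4 : (D.gradW g : V ≃ₗ[ℝ] V)⁻¹ * (D.gradW h : V ≃ₗ[ℝ] V) = 1 := by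
    refine D.eq_one_of_fix hlam (D.W.mul_mem (D.W.inv_mem (D.gradW g).2) (D.gradW h).2) ?_
    ext v
    have := h3 ((D.gradW h : V ≃ₗ[ℝ] V) v)
    change lam ((D.gradW g : V ≃ₗ[ℝ] V)⁻¹ ((D.gradW h : V ≃ₗ[ℝ] V) v)) = lam v
    rw [this]
    change lam (((D.gradW h : V ≃ₗ[ℝ] V)⁻¹ * (D.gradW h : V ≃ₗ[ℝ] V)) v) = lam v
    simp
  have h5 : (D.gradW g : V ≃ₗ[ℝ] V) = (D.gradW h : V ≃ₗ[ℝ] V) := inv_mul_eq_one.1 h4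
  apply Subtype.ext
  ext v
  rw [apply_eq_gradW, D.apply_eq_gradW h, h5, h2]

/-- The multiplicities, rescaled from co-roots to roots. -/
def rescaled (k : (V →ᵃ[ℝ] ℝ) → ℂ) (a : V →ᵃ[ℝ] ℝ) : ℂ :=
  k a * ((inner ℝ (riesz (grad a)) (riesz (grad a)) / 2 : ℝ) : ℂ)

/-- Weights are evaluated at `riesz (grad a)`, which unlike the co-vector is linear in a. The two
vectors differ by the factor |Da|²/2, and the multiplicities are scaled to match. -/
theorem rescaled_act {k : (V →ᵃ[ℝ] ℝ) → ℂ} (hk : D.IsMultiplicity k) (g : D.Wa)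
    {a : V →ᵃ[ℝ] ℝ} (ha : a ∈ D.affineRoots) : rescaled k (D.act g a) = rescaled k a := by
  rw [rescaled, hk g a ha, grad_act, D.inner_riesz_comp (D.gradW g).2, rescaled]

/-! ### Dunkl operators on the group algebra -/

/-- The group algebra of `W^a` over polynomials in the level. -/
abbrev LevelAlgebra : Type _ := MonoidAlgebra (Polynomial ℂ) D.Wa

/-- The inversions as a finite set. -/
def invFinset (g : D.Wa) : Finset (V →ᵃ[ℝ] ℝ) := (D.inversions_finite g).toFinset

theorem mem_invFinset {g : D.Wa} {c : V →ᵃ[ℝ] ℝ} : c ∈ D.invFinset g ↔ c ∈ D.inversions g :=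
  Set.Finite.mem_toFinset _

/-- The lower order terms of a Dunkl operator. -/
def dunklLower (k : (V →ᵃ[ℝ] ℝ) → ℂ) (ξ : V →ᵃ[ℝ] ℝ) (g : D.Wa) : D.LevelAlgebra :=
  ∑ c ∈ D.invFinset g, MonoidAlgebra.single (g * D.reflElt c)
    (Polynomial.C (rescaled k c * (grad (D.act g⁻¹ ξ) (covector (grad c)) : ℝ)))

/-- The action of the Dunkl operator attached to `ξ` on a group element. -/
def dunklBasis (k : (V →ᵃ[ℝ] ℝ) → ℂ) (lam : V →ₗ[ℝ] ℂ) (ξ : V →ᵃ[ℝ] ℝ) (g : D.Wa) :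
    D.LevelAlgebra :=
  MonoidAlgebra.single g (levelWeight lam (D.act g⁻¹ ξ)) + D.dunklLower k ξ g

/-- The action of an affine function `ξ` on the principal series module of the degenerate double
affine Hecke algebra, realized on the group algebra of `W^a`. -/
def dunkl (k : (V →ᵃ[ℝ] ℝ) → ℂ) (lam : V →ₗ[ℝ] ℂ) (ξ : V →ᵃ[ℝ] ℝ) :
    D.LevelAlgebra →ₗ[Polynomial ℂ] D.LevelAlgebra where
  toFun x := Finsupp.linearCombination (Polynomial ℂ) (D.dunklBasis k lam ξ) x.coeff
  map_add' x y := by rw [MonoidAlgebra.coeff_add, map_add]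
  map_smul' r x := by rw [MonoidAlgebra.coeff_smul, map_smul]; rfl

theorem dunkl_single (k : (V →ᵃ[ℝ] ℝ) → ℂ) (lam : V →ₗ[ℝ] ℂ) (ξ : V →ᵃ[ℝ] ℝ) (g : D.Wa)
    (r : Polynomial ℂ) :
    D.dunkl k lam ξ (MonoidAlgebra.single g r) = r • D.dunklBasis k lam ξ g := by
  change Finsupp.linearCombination (Polynomial ℂ) (D.dunklBasis k lam ξ) (Finsupp.single g r) = _
  rw [Finsupp.linearCombination_single]

theorem levelAlgebra_ext {M : Type*} [AddCommGroup M] [Module (Polynomial ℂ) M]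
    {f f' : D.LevelAlgebra →ₗ[Polynomial ℂ] M}
    (h : ∀ g, f (MonoidAlgebra.single g 1) = f' (MonoidAlgebra.single g 1)) : f = f' := by
  refine LinearMap.ext fun x => ?_
  induction x using MonoidAlgebra.induction_linear with
  | zero => simp
  | add x y hx hy => rw [map_add, map_add, hx, hy]
  | single g r =>
    have : (MonoidAlgebra.single g r : D.LevelAlgebra) = r • MonoidAlgebra.single g 1 := by
      rw [MonoidAlgebra.smul_single', mul_one]
    rw [this, map_smul, map_smul, h]

section Relations

variable {k : (V →ᵃ[ℝ] ℝ) → ℂ} (lam : V →ₗ[ℝ] ℂ)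

/-- No correction term arises, because g and ωg have the same inversions. -/
theorem dunkl_omega (ω : D.Ω) (ξ : V →ᵃ[ℝ] ℝ) (x : D.LevelAlgebra) :
    D.dunkl k lam ξ (MonoidAlgebra.single (ω : D.Wa) 1 * x) =
      MonoidAlgebra.single (ω : D.Wa) 1 * D.dunkl k lam (D.act (ω : D.Wa)⁻¹ ξ) x := by
  have : D.dunkl k lam ξ ∘ₗ LinearMap.mulLeft _ (MonoidAlgebra.single (ω : D.Wa) 1) =
      LinearMap.mulLeft _ (MonoidAlgebra.single (ω : D.Wa) 1) ∘ₗ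
        D.dunkl k lam (D.act (ω : D.Wa)⁻¹ ξ) := by
    refine D.levelAlgebra_ext fun g => ?_
    simp only [LinearMap.comp_apply, LinearMap.mulLeft_apply, MonoidAlgebra.single_mul_single,
      mul_one, dunkl_single, one_smul, dunklBasis, dunklLower, mul_add, Finset.mul_sum, one_mul,
      mul_inv_rev, act_mul, mul_assoc, invFinset, inversions_omega_mul]
  exact congrArg (fun f => f x) this

/-- The one new inversion of s_a g is c = g⁻¹a, and s_a g s_c = g, so it accounts for the multiple
of g. The minus sign appears because s_a reverses the pairing: (s_aξ)(Da^∨) = -ξ(Da^∨) on gradients.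
-/
theorem dunklBasis_simple_of_pos (hk : D.IsMultiplicity k) (a : D.simpleAffineRoots) (ξ : V →ᵃ[ℝ] ℝ) (g : D.Wa)
    (h : D.act g⁻¹ a ∈ D.posAffineRoots) :
    D.dunklBasis k lam ξ (D.simpleRefl a * g) =
      MonoidAlgebra.single (D.simpleRefl a) 1 * D.dunklBasis k lam (D.act (D.simpleRefl a) ξ) g -
        Polynomial.C (rescaled k a * (grad ξ (covector (grad (a : V →ᵃ[ℝ] ℝ))) : ℝ)) •
          MonoidAlgebra.single g 1 := by
  classical
  have haR := D.simpleAffineRoots_subset a.2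
  have hset : D.invFinset (D.simpleRefl a * g) = insert (D.act g⁻¹ a) (D.invFinset g) := by
    ext c
    simp only [mem_invFinset, Finset.mem_insert, D.inversions_simpleRefl_mul a h,
      Set.mem_insert_iff]
  have hnot : D.act g⁻¹ a ∉ D.invFinset g := by
    rw [mem_invFinset]
    exact D.act_inv_notMem_inversions a g
  have hact : D.act (D.simpleRefl a * g)⁻¹ ξ = D.act g⁻¹ (D.act (D.simpleRefl a) ξ) := by
    rw [mul_inv_rev, act_mul, simpleRefl_inv]
  have helt : D.simpleRefl a * g * D.reflElt (D.act g⁻¹ a) = g := by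
    rw [D.reflElt_act g⁻¹ haR, reflElt_simple, inv_inv]
    have := D.simpleRefl_mul_self a
    calc _ = D.simpleRefl a * D.simpleRefl a * g := by group
      _ = g := by rw [this, one_mul]
  have hval : grad (D.act g⁻¹ (D.act (D.simpleRefl a) ξ)) (covector (grad (D.act g⁻¹ a))) =
      -grad ξ (covector (grad (a : V →ᵃ[ℝ] ℝ))) := by
    rw [covector_grad_act, grad_act]
    change grad (D.act (D.simpleRefl a) ξ)
      (((D.gradW g⁻¹ : V ≃ₗ[ℝ] V)⁻¹ * (D.gradW g⁻¹ : V ≃ₗ[ℝ] V)) _) = _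
    rw [inv_mul_cancel, act_simpleRefl]
    change grad ξ _ - grad ξ _ * grad (a : V →ᵃ[ℝ] ℝ) _ = _
    simp only [LinearEquiv.coe_one, id_eq]
    rw [apply_covector_self (D.grad_ne_zero haR)]
    ring
  rw [dunklBasis, dunklLower, hset, Finset.sum_insert hnot, helt, hact, hval,
    D.rescaled_act hk _ haR, dunklBasis, dunklLower]
  simp only [mul_add, Finset.mul_sum, MonoidAlgebra.single_mul_single, one_mul, mul_assoc]
  rw [MonoidAlgebra.smul_single', mul_one, Complex.ofReal_neg, mul_neg, Polynomial.C_neg]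
  have hneg : (MonoidAlgebra.single g (-Polynomial.C (rescaled k a *
      (grad ξ (covector (grad (a : V →ᵃ[ℝ] ℝ))) : ℝ))) : D.LevelAlgebra) =
      -MonoidAlgebra.single g (Polynomial.C (rescaled k a *
      (grad ξ (covector (grad (a : V →ᵃ[ℝ] ℝ))) : ℝ))) := by
    rw [eq_neg_iff_add_eq_zero, ← MonoidAlgebra.single_add]
    simp
  rw [hneg]
  abel

/-- This is the cross relation of the degenerate double affine Hecke algebra; it suffices to check
it on group elements. -/
theorem dunkl_simple (hk : D.IsMultiplicity k) (a : D.simpleAffineRoots) (ξ : V →ᵃ[ℝ] ℝ) (x : D.LevelAlgebra) :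
    D.dunkl k lam ξ (MonoidAlgebra.single (D.simpleRefl a) 1 * x) =
      MonoidAlgebra.single (D.simpleRefl a) 1 * D.dunkl k lam (D.act (D.simpleRefl a) ξ) x -
        Polynomial.C (rescaled k a * (grad ξ (covector (grad (a : V →ᵃ[ℝ] ℝ))) : ℝ)) • x := by
  have haR := D.simpleAffineRoots_subset a.2
  have : D.dunkl k lam ξ ∘ₗ LinearMap.mulLeft _ (MonoidAlgebra.single (D.simpleRefl a) 1) =
      LinearMap.mulLeft _ (MonoidAlgebra.single (D.simpleRefl a) 1) ∘ₗ
        D.dunkl k lam (D.act (D.simpleRefl a) ξ) -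
        Polynomial.C (rescaled k a * (grad ξ (covector (grad (a : V →ᵃ[ℝ] ℝ))) : ℝ)) •
          LinearMap.id := by
    refine D.levelAlgebra_ext fun g => ?_
    simp only [LinearMap.comp_apply, LinearMap.mulLeft_apply, MonoidAlgebra.single_mul_single,
      mul_one, dunkl_single, one_smul, LinearMap.sub_apply, LinearMap.smul_apply, LinearMap.id_apply]
    rcases D.pos_or_neg (D.act_mem_affineRoots g⁻¹ haR) with h | h
    · exact D.dunklBasis_simple_of_pos lam hk a ξ g h
    -- If g⁻¹a is negative, the positive case applies to s_a g with s_aξ in place of ξ. Multiplying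
    -- that identity by s_a from the left gives the relation for g.
    · have hpos : D.act (D.simpleRefl a * g)⁻¹ a ∈ D.posAffineRoots := by
        rw [mul_inv_rev, act_mul, simpleRefl_inv, act_simpleRefl_self, act_neg]
        exact D.neg_pos_of_neg h
      have h1 := D.dunklBasis_simple_of_pos lam hk a (D.act (D.simpleRefl a) ξ) _ hpos
      rw [← mul_assoc, simpleRefl_mul_self, one_mul, ← act_mul, simpleRefl_mul_self, act_one] at h1
      have hval : grad (D.act (D.simpleRefl a) ξ) (covector (grad (a : V →ᵃ[ℝ] ℝ))) =
          -grad ξ (covector (grad (a : V →ᵃ[ℝ] ℝ))) := by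
        rw [act_simpleRefl]
        change grad ξ _ - grad ξ _ * grad (a : V →ᵃ[ℝ] ℝ) _ = _
        rw [apply_covector_self (D.grad_ne_zero haR)]
        ring
      rw [h1, hval, mul_sub, ← mul_assoc, MonoidAlgebra.single_mul_single, simpleRefl_mul_self,
        mul_smul_comm, MonoidAlgebra.single_mul_single, ← mul_assoc, simpleRefl_mul_self]
      simp only [one_mul, mul_one, Complex.ofReal_neg, mul_neg, Polynomial.C_neg, neg_smul]
      rw [← MonoidAlgebra.one_def, one_mul]
      abel
  exact congrArg (fun f => f x) this

end Relations

/-! ### Weight vectors -/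

/-- Weight vectors of the principal series module, of weight `gμ`. -/
def IsWeightVector (k : (V →ᵃ[ℝ] ℝ) → ℂ) (lam : V →ₗ[ℝ] ℂ) (g : D.Wa) (x : D.LevelAlgebra) :
    Prop :=
  ∀ ξ, D.dunkl k lam ξ x = levelWeight lam (D.act g⁻¹ ξ) • x

variable {D} {k : (V →ᵃ[ℝ] ℝ) → ℂ} {lam : V →ₗ[ℝ] ℂ}

theorem isWeightVector_one : D.IsWeightVector k lam 1 1 := by
  intro ξ
  have : D.invFinset 1 = ∅ := by
    ext c
    rw [mem_invFinset, inversions_one]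
    simp
  rw [MonoidAlgebra.one_def, dunkl_single, dunklBasis, dunklLower, this]
  simp

theorem IsWeightVector.omega_mul {g : D.Wa} {x : D.LevelAlgebra}
    (h : D.IsWeightVector k lam g x) (ω : D.Ω) :
    D.IsWeightVector k lam (ω * g) (MonoidAlgebra.single (ω : D.Wa) 1 * x) := by
  intro ξ
  rw [dunkl_omega, h, mul_smul_comm, mul_inv_rev, act_mul]

/-- Let L be the weight of g⁻¹a and K the rescaled multiplicity. On x, the function s_aξ acts by the
weight of ξ minus ξ(Da^∨)L. The correction term of `dunkl_simple`, multiplied by L, lowers the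
eigenvalue on the summand Kx by the same amount, so both summands of (L s_a + K)x acquire the weight
of s_aξ. -/
theorem IsWeightVector.simple_mul (hk : D.IsMultiplicity k) {g : D.Wa} {x : D.LevelAlgebra}
    (h : D.IsWeightVector k lam g x) (a : D.simpleAffineRoots) :
    D.IsWeightVector k lam (D.simpleRefl a * g)
      ((levelWeight lam (D.act g⁻¹ a) • MonoidAlgebra.single (D.simpleRefl a) 1 +
        Polynomial.C (rescaled k a) • 1) * x) := by
  intro ξ
  rw [mul_inv_rev, act_mul, simpleRefl_inv, add_mul, smul_mul_assoc, smul_mul_assoc, one_mul,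
    map_add, map_smul, map_smul, D.dunkl_simple lam hk, h, h, mul_smul_comm, act_simpleRefl,
    act_sub_smul, levelWeight_sub_smul]
  simp only [smul_sub, smul_add, smul_smul, sub_mul, map_mul, sub_smul]
  ring_nf
  abel

theorem IsWeightVector.sub_smul {g : D.Wa} {x y : D.LevelAlgebra}
    (hx : D.IsWeightVector k lam g x) (hy : D.IsWeightVector k lam g y) (r s : Polynomial ℂ) :
    D.IsWeightVector k lam g (r • x - s • y) := by
  intro ξ
  rw [map_sub, map_smul, map_smul, hx, hy, smul_sub, smul_comm r, smul_comm s]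

/-- Triangularity: every lower order term of h sits at some h s_c that is strictly shorter than h.
-/
theorem coeff_dunklLower {ξ : V →ᵃ[ℝ] ℝ} {g h : D.Wa} (hgh : D.length h ≤ D.length g) :
    (D.dunklLower k ξ h).coeff g = 0 := by
  classical
  rw [dunklLower, MonoidAlgebra.coeff_sum, Finsupp.finsetSum_apply]
  refine Finset.sum_eq_zero fun c hc => ?_
  rw [MonoidAlgebra.coeff_single, Finsupp.single_apply, if_neg]
  intro h1
  have := D.length_mul_reflElt_lt h (D.mem_invFinset.1 hc)
  rw [h1] at this
  omega

theorem coeff_dunkl {ξ : V →ᵃ[ℝ] ℝ} {x : D.LevelAlgebra} {g : D.Wa}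
    (hg : ∀ h ∈ x.coeff.support, D.length h ≤ D.length g) :
    (D.dunkl k lam ξ x).coeff g = levelWeight lam (D.act g⁻¹ ξ) * x.coeff g := by
  classical
  change (Finsupp.linearCombination (Polynomial ℂ) (D.dunklBasis k lam ξ) x.coeff).coeff g = _
  rw [Finsupp.linearCombination_apply, Finsupp.sum, MonoidAlgebra.coeff_sum,
    Finsupp.finsetSum_apply]
  have h1 : ∀ h ∈ x.coeff.support, (x.coeff h • D.dunklBasis k lam ξ h).coeff g =
      if h = g then levelWeight lam (D.act g⁻¹ ξ) * x.coeff g else 0 := by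
    intro h hh
    rw [MonoidAlgebra.coeff_smul_apply, dunklBasis, MonoidAlgebra.coeff_add, Finsupp.add_apply,
      coeff_dunklLower (hg h hh), add_zero, MonoidAlgebra.coeff_single, Finsupp.single_apply]
    split_ifs with heq
    · rw [heq, smul_eq_mul, mul_comm]
    · simp
  rw [Finset.sum_congr rfl h1, Finset.sum_ite_eq']
  split_ifs with hmem
  · rfl
  · rw [Finsupp.notMem_support_iff.1 hmem, mul_zero]

/-- At an element g of maximal length in the support, triangularity shows that the weight of x is
gμ. Regularity then forces g = w, where the coefficient vanishes by assumption. -/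
theorem IsWeightVector.eq_zero (hlam : ∀ α ∈ D.R, lam (covector α) ≠ 0) {w : D.Wa}
    {x : D.LevelAlgebra} (hx : D.IsWeightVector k lam w x) (h0 : x.coeff w = 0) : x = 0 := by
  by_contra hne
  have hs : x.coeff.support.Nonempty := by
    rw [Finsupp.support_nonempty_iff]
    exact fun h => hne (MonoidAlgebra.coeff_eq_zero.1 h)
  obtain ⟨g, hg, hmax⟩ := Finset.exists_max_image _ D.length hs
  have hg0 : x.coeff g ≠ 0 := Finsupp.mem_support_iff.1 hg
  have hgw : g = w := by
    refine D.eq_of_levelWeight_eq hlam fun ξ => ?_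
    have h1 := coeff_dunkl (k := k) (lam := lam) (ξ := ξ) hmax
    rw [hx ξ, MonoidAlgebra.coeff_smul_apply, smul_eq_mul] at h1
    exact (mul_right_cancel₀ hg0 h1).symm
  exact hg0 (hgw ▸ h0)

end RootDatum

namespace RootDatum

variable (D : RootDatum V)

/-! ### Intertwiners along arbitrary words -/

/-- The element of `W^a` of a letter, which is either an element of `Ω` or a simple affine root. -/
def letterElt : D.Ω ⊕ D.simpleAffineRoots → D.Wa := Sum.elim (fun ω => (ω : D.Wa)) D.simpleRefl

/-- The element of `W^a` represented by a word. -/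
def wordElt (l : List (D.Ω ⊕ D.simpleAffineRoots)) : D.Wa := (l.map D.letterElt).prod

theorem wordElt_nil : D.wordElt [] = 1 := rfl

theorem wordElt_inl (ω : D.Ω) (l : List (D.Ω ⊕ D.simpleAffineRoots)) :
    D.wordElt (Sum.inl ω :: l) = ω * D.wordElt l := rfl

theorem wordElt_inr (a : D.simpleAffineRoots) (l : List (D.Ω ⊕ D.simpleAffineRoots)) :
    D.wordElt (Sum.inr a :: l) = D.simpleRefl a * D.wordElt l := rfl

theorem wordElt_append (l l' : List (D.Ω ⊕ D.simpleAffineRoots)) :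
    D.wordElt (l ++ l') = D.wordElt l * D.wordElt l' := by
  simp [wordElt]

theorem wordElt_map_inr (l : List D.simpleAffineRoots) :
    D.wordElt (l.map Sum.inr) = (l.map D.simpleRefl).prod := by
  rw [wordElt, List.map_map]
  rfl

/-- The intertwiner of a word with level an indeterminate, without denominators. -/
def levelIntertwiner (k : (V →ᵃ[ℝ] ℝ) → ℂ) (lam : V →ₗ[ℝ] ℂ) :
    List (D.Ω ⊕ D.simpleAffineRoots) → D.LevelAlgebra
  | [] => 1
  | Sum.inl ω :: l => MonoidAlgebra.single (ω : D.Wa) 1 * levelIntertwiner k lam l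
  | Sum.inr a :: l =>
    (levelWeight lam (D.act (D.wordElt l)⁻¹ a) • MonoidAlgebra.single (D.simpleRefl a) 1 +
      Polynomial.C (rescaled k a) • 1) * levelIntertwiner k lam l

/-- The denominator of the normalized intertwiner of a word with level an indeterminate. -/
def levelDenom (k : (V →ᵃ[ℝ] ℝ) → ℂ) (lam : V →ₗ[ℝ] ℂ) :
    List (D.Ω ⊕ D.simpleAffineRoots) → Polynomial ℂ
  | [] => 1
  | Sum.inl _ :: l => levelDenom k lam l
  | Sum.inr a :: l =>
    (levelWeight lam (D.act (D.wordElt l)⁻¹ a) - Polynomial.C (rescaled k a)) * levelDenom k lam l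

/-- The normalized intertwiner at critical level of a word. -/
def wordIntertwiner (k : (V →ᵃ[ℝ] ℝ) → ℂ) :
    List (D.Ω ⊕ D.simpleAffineRoots) → (V →ₗ[ℝ] ℂ) → MonoidAlgebra ℂ D.Wa
  | [], _ => 1
  | Sum.inl ω :: l, lam => MonoidAlgebra.of ℂ D.Wa ω * wordIntertwiner k l lam
  | Sum.inr a :: l, lam =>
    D.Jsimple k a (dualAct (D.gradW (D.wordElt l) : V ≃ₗ[ℝ] V) lam) * wordIntertwiner k l lam

/-- The determinant of the gradient, as a character of `W^a`. -/
def detChar : D.Wa →* Polynomial ℂ where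
  toFun g := Polynomial.C ((LinearMap.det ((D.gradW g : V ≃ₗ[ℝ] V) : V →ₗ[ℝ] V) : ℝ) : ℂ)
  map_one' := by
    simp
  map_mul' g h := by
    have : (((D.gradW (g * h) : D.W) : V ≃ₗ[ℝ] V) : V →ₗ[ℝ] V) =
      ((D.gradW g : V ≃ₗ[ℝ] V) : V →ₗ[ℝ] V) * ((D.gradW h : V ≃ₗ[ℝ] V) : V →ₗ[ℝ] V) := rfl
    rw [this, map_mul, Complex.ofReal_mul, map_mul]

theorem detChar_simple (a : D.simpleAffineRoots) : D.detChar (D.simpleRefl a) = -1 := by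
  have h : (((D.gradW (D.simpleRefl a) : D.W) : V ≃ₗ[ℝ] V) : V →ₗ[ℝ] V) =
    (refl (grad (a : V →ᵃ[ℝ] ℝ)) : V →ₗ[ℝ] V) := rfl
  change Polynomial.C _ = _
  rw [h, det_refl (D.grad_ne_zero (D.simpleAffineRoots_subset a.2))]
  simp

theorem detChar_ne_zero (g : D.Wa) : D.detChar g ≠ 0 := by
  intro h
  have h1 : D.detChar (g * g⁻¹) = 1 := by rw [mul_inv_cancel, map_one]
  rw [map_mul, h, zero_mul] at h1
  exact zero_ne_one h1

/-- The extension of the determinant character to the group algebra. -/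
def detHom : D.LevelAlgebra →ₐ[Polynomial ℂ] Polynomial ℂ :=
  MonoidAlgebra.lift (Polynomial ℂ) (Polynomial ℂ) D.Wa D.detChar

theorem detHom_single (g : D.Wa) : D.detHom (MonoidAlgebra.single g 1) = D.detChar g := by
  rw [detHom, MonoidAlgebra.lift_single, one_smul]

variable {D} {k : (V →ᵃ[ℝ] ℝ) → ℂ} {lam : V →ₗ[ℝ] ℂ}

/-- The sign of s_a is -1, so a factor L s_a + K becomes -(L - K), minus a factor of the
denominator. Hence the character detects that the intertwiner is nonzero and measures its
normalization. -/
theorem detHom_levelIntertwiner (l : List (D.Ω ⊕ D.simpleAffineRoots)) :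
    D.detHom (D.levelIntertwiner k lam l) = D.detChar (D.wordElt l) * D.levelDenom k lam l := by
  induction l with
  | nil => simp [levelIntertwiner, levelDenom, wordElt_nil]
  | cons t l ih =>
    rcases t with ω | a
    · rw [levelIntertwiner, levelDenom, wordElt_inl, map_mul, ih, detHom_single, map_mul, mul_assoc]
    · rw [levelIntertwiner, levelDenom, wordElt_inr, map_mul, ih, map_add, map_smul, map_smul,
        detHom_single, map_one, map_mul, detChar_simple, smul_eq_mul, smul_eq_mul]
      ring

theorem isWeightVector_levelIntertwiner (hk : D.IsMultiplicity k)
    (l : List (D.Ω ⊕ D.simpleAffineRoots)) :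
    D.IsWeightVector k lam (D.wordElt l) (D.levelIntertwiner k lam l) := by
  induction l with
  | nil => exact isWeightVector_one
  | cons t l ih =>
    rcases t with ω | a
    · exact ih.omega_mul ω
    · exact ih.simple_mul hk a

/-- Both vectors have the same weight, so they are proportional, and the difference of their cross
multiples is killed by the determinant character. Such a difference must vanish, since the character
is nonzero on the intertwiner of l. -/
theorem levelIntertwiner_proportional (hk : D.IsMultiplicity k)
    (hlam : ∀ α ∈ D.R, lam (covector α) ≠ 0) {l l' : List (D.Ω ⊕ D.simpleAffineRoots)}
    (h : D.wordElt l = D.wordElt l') (hd : D.levelDenom k lam l ≠ 0) :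
    D.levelDenom k lam l' • D.levelIntertwiner k lam l =
      D.levelDenom k lam l • D.levelIntertwiner k lam l' := by
  have h1 : D.IsWeightVector k lam (D.wordElt l) (D.levelIntertwiner k lam l) :=
    isWeightVector_levelIntertwiner hk l
  have h2 : D.IsWeightVector k lam (D.wordElt l) (D.levelIntertwiner k lam l') :=
    h ▸ isWeightVector_levelIntertwiner hk l'
  rw [← sub_eq_zero]
  set z := D.levelDenom k lam l' • D.levelIntertwiner k lam l -
      D.levelDenom k lam l • D.levelIntertwiner k lam l' with hz
  have hzw : D.IsWeightVector k lam (D.wordElt l) z := h1.sub_smul h2 _ _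
  have hzd : D.detHom z = 0 := by
    rw [hz, map_sub, map_smul, map_smul, detHom_levelIntertwiner, detHom_levelIntertwiner, h,
      smul_eq_mul, smul_eq_mul]
    ring
  refine hzw.eq_zero hlam ?_
  -- Cross-multiplying z and the intertwiner with their coefficients at the element of the word
  -- gives a weight vector with zero coefficient there, hence 0. Applying `detHom`, which kills z
  -- but not the intertwiner, leaves that the coefficient of z is 0.
  have h3 := (h1.sub_smul hzw (z.coeff (D.wordElt l))
    ((D.levelIntertwiner k lam l).coeff (D.wordElt l))).eq_zero hlam (by
      rw [MonoidAlgebra.coeff_sub, Finsupp.sub_apply, MonoidAlgebra.coeff_smul_apply,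
        MonoidAlgebra.coeff_smul_apply, smul_eq_mul, smul_eq_mul, mul_comm, sub_self])
  have h4 := congrArg D.detHom h3
  rw [map_sub, map_smul, map_smul, hzd, smul_zero, sub_zero, map_zero, detHom_levelIntertwiner,
    smul_eq_mul] at h4
  exact (mul_eq_zero.1 h4).resolve_right (mul_ne_zero (D.detChar_ne_zero _) hd)

/-! ### Specialization to the critical level -/

theorem dualAct_gradW_covector (g : D.Wa) (a : V →ᵃ[ℝ] ℝ) :
    dualAct (D.gradW g : V ≃ₗ[ℝ] V) lam (covector (grad a)) =
      lam (covector (grad (D.act g⁻¹ a))) := by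
  rw [covector_grad_act, gradW_inv_coe]
  rfl

theorem dualAct_mem_Creg (hk : D.IsMultiplicity k) (hlam : lam ∈ D.Creg k) (g : D.Wa) :
    dualAct (D.gradW g : V ≃ₗ[ℝ] V) lam ∈ D.Creg k := by
  intro a ha
  rw [dualAct_gradW_covector]
  have := hlam _ (D.act_mem_affineRoots g⁻¹ ha)
  rwa [hk _ a ha] at this

theorem apply_covector_ne_zero (hlam : lam ∈ D.Creg k) :
    ∀ α ∈ D.R, lam (covector α) ≠ 0 := by
  intro α hα
  exact (hlam _ (D.toAffineMap_mem_affineRoots hα)).1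

theorem eval_levelWeight (g : D.Wa) {a : V →ᵃ[ℝ] ℝ} (ha : a ∈ D.affineRoots) :
    (levelWeight lam (D.act g⁻¹ a)).eval 0 =
      ((inner ℝ (riesz (grad a)) (riesz (grad a)) / 2 : ℝ) : ℂ) *
        dualAct (D.gradW g : V ≃ₗ[ℝ] V) lam (covector (grad a)) := by
  rw [dualAct_gradW_covector, covector, map_smul, grad_act,
    D.inner_riesz_comp (D.gradW g⁻¹).2, ← grad_act]
  have h0 := (inner_riesz_pos (D.grad_ne_zero ha)).ne'
  simp only [levelWeight, Polynomial.eval_add, Polynomial.eval_C, Polynomial.eval_mul,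
    Polynomial.eval_X, mul_zero, add_zero, Complex.real_smul]
  rw [← mul_assoc, ← Complex.ofReal_mul, div_mul_div_comm, mul_comm (inner ℝ _ _), div_self,
    Complex.ofReal_one, one_mul]
  exact mul_ne_zero two_ne_zero h0

theorem Jsimple_smul (a : D.simpleAffineRoots) {mu : V →ₗ[ℝ] ℂ} (hmu : mu ∈ D.Creg k) :
    (mu (covector (grad (a : V →ᵃ[ℝ] ℝ))) - k a) • D.Jsimple k a mu =
      mu (covector (grad (a : V →ᵃ[ℝ] ℝ))) • MonoidAlgebra.of ℂ D.Wa (D.simpleRefl a) +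
        k a • 1 := by
  rw [Jsimple, smul_smul, mul_inv_cancel₀, one_smul]
  exact sub_ne_zero.2 (hmu a (D.simpleAffineRoots_subset a.2)).2

/-- Each step of a word contributes a positive multiple of (wλ)(Da^∨) - k_a for some w, which is
nonzero since C_k^reg is stable under W. -/
theorem eval_levelDenom_ne_zero (hk : D.IsMultiplicity k) (hlam : lam ∈ D.Creg k)
    (l : List (D.Ω ⊕ D.simpleAffineRoots)) : (D.levelDenom k lam l).eval 0 ≠ 0 := by
  induction l with
  | nil => simp [levelDenom]
  | cons t l ih =>
    rcases t with ω | a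
    · exact ih
    · have haR := D.simpleAffineRoots_subset a.2
      rw [levelDenom, Polynomial.eval_mul, Polynomial.eval_sub, eval_levelWeight _ haR,
        Polynomial.eval_C, rescaled, mul_comm (k a), ← mul_sub]
      refine mul_ne_zero (mul_ne_zero ?_ (sub_ne_zero.2 ?_)) ih
      · exact Complex.ofReal_ne_zero.2 (div_pos (inner_riesz_pos (D.grad_ne_zero haR)) two_pos).ne'
      · exact (dualAct_mem_Creg hk hlam _ a haR).2

variable (D) in
/-- The specialization of the level to zero. -/
def critical : D.LevelAlgebra →+* MonoidAlgebra ℂ D.Wa :=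
  MonoidAlgebra.mapRingHom D.Wa (Polynomial.evalRingHom 0)

theorem critical_single (g : D.Wa) :
    D.critical (MonoidAlgebra.single g 1) = MonoidAlgebra.of ℂ D.Wa g := by
  simp [critical]

theorem critical_smul (r : Polynomial ℂ) (x : D.LevelAlgebra) :
    D.critical (r • x) = r.eval 0 • D.critical x := by
  ext g
  simp [critical]

theorem critical_levelIntertwiner (hk : D.IsMultiplicity k) (hlam : lam ∈ D.Creg k)
    (l : List (D.Ω ⊕ D.simpleAffineRoots)) :
    D.critical (D.levelIntertwiner k lam l) =
      (D.levelDenom k lam l).eval 0 • D.wordIntertwiner k l lam := by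
  induction l with
  | nil => simp [levelIntertwiner, levelDenom, wordIntertwiner]
  | cons t l ih =>
    rcases t with ω | a
    · rw [levelIntertwiner, levelDenom, wordIntertwiner, map_mul, ih, critical_single,
        mul_smul_comm]
    · have haR := D.simpleAffineRoots_subset a.2
      rw [levelIntertwiner, levelDenom, wordIntertwiner, map_mul, ih, map_add, critical_smul,
        critical_smul, critical_single, map_one, Polynomial.eval_mul, Polynomial.eval_sub,
        eval_levelWeight _ haR, Polynomial.eval_C, rescaled, mul_comm (k a), ← mul_sub,
        mul_smul, mul_smul, ← smul_add, ← Jsimple_smul a (dualAct_mem_Creg hk hlam _),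
        smul_mul_assoc, smul_mul_assoc, mul_smul_comm, ← smul_smul, ← smul_smul]

/-- The identity between cross multiples holds over ℂ[X], so it may be specialized at X = 0, where
the nonzero denominators cancel. -/
theorem wordIntertwiner_eq (hk : D.IsMultiplicity k) (hlam : lam ∈ D.Creg k)
    {l l' : List (D.Ω ⊕ D.simpleAffineRoots)} (h : D.wordElt l = D.wordElt l') :
    D.wordIntertwiner k l lam = D.wordIntertwiner k l' lam := by
  have hd := eval_levelDenom_ne_zero hk hlam l
  have hd' := eval_levelDenom_ne_zero hk hlam l'
  have h1 := congrArg D.critical (levelIntertwiner_proportional hk (apply_covector_ne_zero hlam) h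
    (fun h0 => hd (by rw [h0, Polynomial.eval_zero])))
  rw [critical_smul, critical_smul, critical_levelIntertwiner hk hlam,
    critical_levelIntertwiner hk hlam, smul_smul, smul_smul,
    mul_comm ((D.levelDenom k lam l').eval 0)] at h1
  exact smul_right_injective _ (mul_ne_zero hd hd') h1

/-! ### The cocycle property -/

theorem wordIntertwiner_append (l l' : List (D.Ω ⊕ D.simpleAffineRoots)) (lam : V →ₗ[ℝ] ℂ) :
    D.wordIntertwiner k (l ++ l') lam =
      D.wordIntertwiner k l (dualAct (D.gradW (D.wordElt l') : V ≃ₗ[ℝ] V) lam) *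
        D.wordIntertwiner k l' lam := by
  induction l with
  | nil => simp [wordIntertwiner]
  | cons t l ih =>
    rcases t with ω | a
    · rw [List.cons_append, wordIntertwiner, ih, wordIntertwiner, mul_assoc]
    · rw [List.cons_append, wordIntertwiner, ih, wordIntertwiner, wordElt_append, map_mul,
        mul_assoc, Subgroup.coe_mul, dualAct_mul]

theorem wordIntertwiner_map_inr (l : List D.simpleAffineRoots) (lam : V →ₗ[ℝ] ℂ) :
    D.wordIntertwiner k (l.map Sum.inr) lam = D.Jlist k l lam := by
  induction l with
  | nil => rfl
  | cons a l ih => rw [List.map_cons, wordIntertwiner, ih, wordElt_map_inr, Jlist]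

variable (D) in
/-- A reduced expression, as a word. -/
def reducedWord (w : D.Wa) : List (D.Ω ⊕ D.simpleAffineRoots) :=
  Sum.inl (D.reducedExpr w).1 :: (D.reducedExpr w).2.map Sum.inr

theorem wordElt_reducedWord (w : D.Wa) : D.wordElt (D.reducedWord w) = w := by
  rw [reducedWord, wordElt_inl, wordElt_map_inr, ← reducedExpr_prod]

theorem J_eq_reducedWord (w : D.Wa) (lam : V →ₗ[ℝ] ℂ) :
    D.J k w lam = D.wordIntertwiner k (D.reducedWord w) lam := by
  rw [reducedWord, wordIntertwiner, wordIntertwiner_map_inr, J]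

theorem J_wordElt (hk : D.IsMultiplicity k) (hlam : lam ∈ D.Creg k)
    (l : List (D.Ω ⊕ D.simpleAffineRoots)) :
    D.J k (D.wordElt l) lam = D.wordIntertwiner k l lam := by
  rw [J_eq_reducedWord]
  exact wordIntertwiner_eq hk hlam (wordElt_reducedWord _)

/-- Concatenating reduced words for g and h gives a word for gh, in general not reduced.
Independence of the word makes this harmless. -/
theorem J_mul (hk : D.IsMultiplicity k) (hlam : lam ∈ D.Creg k) (g h : D.Wa) :
    D.J k (g * h) lam =
      D.J k g (dualAct (D.gradW h : V ≃ₗ[ℝ] V) lam) * D.J k h lam := by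
  have h1 := J_wordElt hk hlam (D.reducedWord g ++ D.reducedWord h)
  rw [wordElt_append, wordElt_reducedWord, wordElt_reducedWord, wordIntertwiner_append,
    wordElt_reducedWord] at h1
  rw [h1, J_eq_reducedWord, J_eq_reducedWord h]

theorem J_one (hk : D.IsMultiplicity k) (hlam : lam ∈ D.Creg k) : D.J k 1 lam = 1 :=
  J_wordElt hk hlam []

theorem J_simple (hk : D.IsMultiplicity k) (hlam : lam ∈ D.Creg k) (a : D.simpleAffineRoots) :
    D.J k (D.simpleRefl a) lam = D.Jsimple k a lam := by
  have := J_wordElt hk hlam [Sum.inr a]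
  rw [wordElt_inr, wordElt_nil, mul_one] at this
  rw [this, wordIntertwiner, wordIntertwiner, mul_one]
  rfl

theorem J_omega (hk : D.IsMultiplicity k) (hlam : lam ∈ D.Creg k) (ω : D.Ω) :
    D.J k ω lam = MonoidAlgebra.of ℂ D.Wa ω := by
  have := J_wordElt hk hlam [Sum.inl ω]
  rw [wordElt_inl, wordElt_nil, mul_one] at this
  rw [this, wordIntertwiner, wordIntertwiner, mul_one]

end RootDatum

/-! ### Plane waves -/

/-- Plane waves are characters of the additive group V, so Dedekind's theorem applies once they are
distinct. The derivative of e^{tμ(v)} at t = 0 recovers μ(v). -/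
theorem linearIndependent_planeWave :
    LinearIndependent ℂ (planeWave : (V →ₗ[ℝ] ℂ) → Comega V) := by
  let ev : Comega V →ₗ[ℂ] (Multiplicative V → ℂ) :=
    { toFun := fun f v => f v.toAdd
      map_add' := fun _ _ => rfl
      map_smul' := fun _ _ => rfl }
  let ch : (V →ₗ[ℝ] ℂ) → (Multiplicative V →* ℂ) := fun mu =>
    { toFun := fun v => Complex.exp (mu v.toAdd)
      map_one' := by simp
      map_mul' := fun x y => by simp [Complex.exp_add] }
  have hch : Function.Injective ch := by
    intro mu nu h
    ext v
    have h1 : ∀ t : ℝ, Complex.exp (t * mu v) = Complex.exp (t * nu v) := by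
      intro t
      have := congrArg (fun f : Multiplicative V →* ℂ => f (Multiplicative.ofAdd (t • v))) h
      simpa [ch] using this
    have hd : ∀ c : ℂ, HasDerivAt (fun t : ℝ => Complex.exp (t * c)) c 0 := by
      intro c
      have h2 : HasDerivAt (fun t : ℝ => (t : ℂ) * c) c 0 := by
        simpa using (Complex.ofRealCLM.hasDerivAt (x := (0 : ℝ))).mul_const c
      simpa using h2.cexp
    have h3 := hd (nu v)
    simp_rw [← h1] at h3
    exact (hd (mu v)).unique h3
  have h1 := (linearIndependent_monoidHom (Multiplicative V) ℂ).comp ch hch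
  exact LinearIndependent.of_comp ev h1

theorem pullback_planeWave (g : V ≃ᵃ[ℝ] V) (mu : V →ₗ[ℝ] ℂ) :
    pullback g (planeWave mu) =
      Complex.exp (mu (g⁻¹ 0)) • planeWave (dualAct g.linear mu) := by
  ext v
  change Complex.exp (mu (g⁻¹ v)) =
    Complex.exp (mu (g⁻¹ 0)) * Complex.exp (mu (g.linear⁻¹ v))
  have h := (g⁻¹ : V ≃ᵃ[ℝ] V).map_vadd 0 v
  simp only [vadd_eq_add, add_zero] at h
  rw [h, ← Complex.exp_add, map_add, add_comm]
  rfl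

/-- With c = μ(Da^∨) the integrand is e^{μ(v)}e^{-ct}, and at the endpoint t = a(v) it takes the
value of e^μ at s_a v. -/
theorem integralOp_planeWave (a : V →ᵃ[ℝ] ℝ) {mu : V →ₗ[ℝ] ℂ}
    (h : mu (covector (grad a)) ≠ 0) {g : V ≃ᵃ[ℝ] V}
    (hg : ∀ v, g⁻¹ v = v - a v • covector (grad a)) :
    integralOp a (planeWave mu) =
      (mu (covector (grad a)))⁻¹ • (planeWave mu - pullback g (planeWave mu)) := by
  ext v
  change ∫ t in (0 : ℝ)..a v, Complex.exp (mu (v - t • covector (grad a))) =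
    (mu (covector (grad a)))⁻¹ * (Complex.exp (mu v) - Complex.exp (mu (g⁻¹ v)))
  set c := mu (covector (grad a)) with hc
  have h1 : ∀ t : ℝ, Complex.exp (mu (v - t • covector (grad a))) =
      Complex.exp (mu v) * Complex.exp (-c * t) := by
    intro t
    rw [← Complex.exp_add, map_sub, map_smul, Complex.real_smul, ← hc]
    congr 1
    ring
  simp_rw [h1]
  have h2 : mu (g⁻¹ v) = mu v + -c * a v := by
    rw [hg, map_sub, map_smul, Complex.real_smul, ← hc]
    ring
  rw [intervalIntegral.integral_const_mul, integral_exp_mul_complex (neg_ne_zero.2 h), h2,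
    Complex.exp_add]
  simp only [Complex.ofReal_zero, mul_zero, Complex.exp_zero]
  field_simp
  ring

theorem dirDeriv_planeWave (mu : V →ₗ[ℝ] ℂ) (v : V) :
    dirDeriv v (planeWave mu) = mu v • planeWave mu := by
  ext x
  change fderiv ℝ (fun y => Complex.exp (mu y)) x v = mu v * Complex.exp (mu x)
  have h1 : HasFDerivAt (fun y => mu y) (LinearMap.toContinuousLinearMap mu) x :=
    (LinearMap.toContinuousLinearMap mu).hasFDerivAt
  rw [h1.cexp.fderiv]
  simp [mul_comm]

theorem dirDerivC_planeWave (mu : V →ₗ[ℝ] ℂ) (x : Complexified V) :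
    dirDerivC x (planeWave mu) = LinearMap.liftBaseChange ℂ mu x • planeWave mu := by
  induction x using TensorProduct.induction_on with
  | zero => simp
  | add x y hx hy => rw [map_add, map_add, LinearMap.add_apply, hx, hy, add_smul]
  | tmul c v =>
    rw [dirDerivC, LinearMap.liftBaseChange_tmul, LinearMap.liftBaseChange_tmul,
      LinearMap.smul_apply, dirDeriv_planeWave, smul_smul, smul_eq_mul]

theorem diffOp_ι (x : Complexified V) :
    diffOp (SymmetricAlgebra.ι ℂ (Complexified V) x) = dirDerivC x := by
  change TensorAlgebra.lift ℂ (dirDerivC (V := V)) (TensorAlgebra.ι ℂ x) = _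
  rw [TensorAlgebra.lift_ι_apply]

theorem diffOp_planeWave (mu : V →ₗ[ℝ] ℂ) (p : SymmetricAlgebra ℂ (Complexified V)) :
    diffOp p (planeWave mu) = evalAt mu p • planeWave mu := by
  induction p using SymmetricAlgebra.induction with
  | algebraMap r =>
    rw [AlgHom.commutes, AlgHom.commutes]
    rfl
  | ι x => rw [diffOp_ι, dirDerivC_planeWave, evalAt, SymmetricAlgebra.lift_ι_apply]
  | mul a b ha hb =>
    rw [map_mul, map_mul, Module.End.mul_apply, hb, map_smul, ha, smul_smul, mul_comm]
  | add a b ha hb => rw [map_add, map_add, LinearMap.add_apply, ha, hb, add_smul]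

theorem evalAt_symAct (mu : V →ₗ[ℝ] ℂ) (w : V ≃ₗ[ℝ] V)
    (p : SymmetricAlgebra ℂ (Complexified V)) :
    evalAt mu (symAct w⁻¹ p) = evalAt (dualAct w mu) p := by
  induction p using SymmetricAlgebra.induction with
  | algebraMap r => simp only [AlgHom.commutes]
  | ι x =>
    rw [symAct, SymmetricAlgebra.lift_ι_apply, evalAt, evalAt, LinearMap.comp_apply,
      SymmetricAlgebra.lift_ι_apply, SymmetricAlgebra.lift_ι_apply]
    induction x using TensorProduct.induction_on with
    | zero => simp
    | add x y hx hy => rw [map_add, map_add, map_add, hx, hy]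
    | tmul c v =>
      rw [LinearMap.baseChange_tmul, LinearMap.liftBaseChange_tmul, LinearMap.liftBaseChange_tmul]
      rfl
  | mul a b ha hb => rw [map_mul, map_mul, ha, hb, map_mul]
  | add a b ha hb => rw [map_add, map_add, ha, hb, map_add]

/-- Elementary tensors over a linearly independent family have unique coefficients. -/
theorem sum_tmul_injective {E M ι : Type*} [AddCommGroup E] [Module ℂ E] [AddCommGroup M]
    [Module ℂ M] [Fintype ι] {e : ι → E} (he : LinearIndependent ℂ e) {n n' : ι → M}
    (h : ∑ i, e i ⊗ₜ[ℂ] n i = ∑ i, e i ⊗ₜ[ℂ] n' i) : n = n' := by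
  classical
  obtain ⟨f, hf⟩ := (Finsupp.linearCombination ℂ e).exists_leftInverse_of_injective
    (LinearMap.ker_eq_bot.2 he)
  have hfe : ∀ i, f (e i) = Finsupp.single i 1 := by
    intro i
    have := congrArg (fun g => g (Finsupp.single i 1)) hf
    simpa using this
  funext j
  let φ : E ⊗[ℂ] M →ₗ[ℂ] M :=
    TensorProduct.lid ℂ M ∘ₗ TensorProduct.map (Finsupp.lapply j ∘ₗ f) LinearMap.id
  have hφ : ∀ n : ι → M, φ (∑ i, e i ⊗ₜ[ℂ] n i) = n j := by
    intro n
    simp [φ, hfe, Finsupp.single_apply]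
  rw [← hφ n, h, hφ]

namespace RootDatum

variable (D : RootDatum V)

/-! ### Superpositions of the plane waves in a Weyl group orbit -/

variable {M : Type*} [AddCommGroup M] [Module ℂ M]

instance fintypeW : Fintype D.W := Fintype.ofFinite D.W

/-- The function `∑_{w ∈ W} e^{wλ} ⊗ n_w`. -/
def superposition (lam : V →ₗ[ℝ] ℂ) (n : D.W → M) : Comega V ⊗[ℂ] M :=
  ∑ w : D.W, planeWave (dualAct (w : V ≃ₗ[ℝ] V) lam) ⊗ₜ[ℂ] n w

variable {D} {k : (V →ᵃ[ℝ] ℝ) → ℂ} {lam : V →ₗ[ℝ] ℂ}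

/-- A W-invariant p takes the same value at every wλ. The differential equations thus hold for
arbitrary coefficients, and only invariance under `Q` restricts them. -/
theorem superposition_mem_Fir (n : D.W → M) : D.superposition lam n ∈ D.Fir M lam := by
  intro p hp
  rw [superposition, map_sum, Finset.smul_sum]
  refine Finset.sum_congr rfl fun w _ => ?_
  rw [TensorProduct.map_tmul, diffOp_planeWave, ← evalAt_symAct, hp _ (D.W.inv_mem w.2),
    LinearMap.id_apply, TensorProduct.smul_tmul']

theorem dualAct_injective (hlam : ∀ α ∈ D.R, lam (covector α) ≠ 0) :
    Function.Injective fun w : D.W => dualAct (w : V ≃ₗ[ℝ] V) lam := by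
  intro w w' h
  have h1 : (w : V ≃ₗ[ℝ] V)⁻¹ * (w' : V ≃ₗ[ℝ] V) = 1 := by
    refine D.eq_one_of_fix hlam (D.W.mul_mem (D.W.inv_mem w.2) w'.2) ?_
    ext v
    have h2 := congrArg (fun f : V →ₗ[ℝ] ℂ => f ((w' : V ≃ₗ[ℝ] V) v)) h
    simp only [dualAct_apply] at h2
    change lam ((w : V ≃ₗ[ℝ] V)⁻¹ ((w' : V ≃ₗ[ℝ] V) v)) = lam v
    rw [h2]
    change lam (((w' : V ≃ₗ[ℝ] V)⁻¹ * (w' : V ≃ₗ[ℝ] V)) v) = lam v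
    simp
  exact Subtype.ext (inv_mul_eq_one.1 h1)

theorem superposition_injective (hlam : ∀ α ∈ D.R, lam (covector α) ≠ 0) {n n' : D.W → M} :
    D.superposition lam n = D.superposition lam n' ↔ n = n' := by
  refine ⟨fun h => ?_, fun h => h ▸ rfl⟩
  exact sum_tmul_injective (linearIndependent_planeWave.comp _ (dualAct_injective hlam)) h

theorem superposition_sub (n n' : D.W → M) :
    D.superposition lam n - D.superposition lam n' =
      D.superposition lam fun w => n w - n' w := by
  rw [superposition, superposition, superposition, ← Finset.sum_sub_distrib]
  simp only [TensorProduct.tmul_sub]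

theorem pullback_superposition (g : D.Wa) (n : D.W → M) (T : M →ₗ[ℂ] M) :
    TensorProduct.map (pullback (g : V ≃ᵃ[ℝ] V)) T (D.superposition lam n) =
      D.superposition lam fun w =>
        Complex.exp (dualAct (((D.gradW g)⁻¹ * w : D.W) : V ≃ₗ[ℝ] V) lam
          ((g : V ≃ᵃ[ℝ] V)⁻¹ 0)) • T (n ((D.gradW g)⁻¹ * w)) := by
  rw [superposition, superposition, map_sum, ← Equiv.sum_comp (Equiv.mulLeft (D.gradW g)⁻¹)]
  refine Finset.sum_congr rfl fun w _ => ?_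
  simp only [Equiv.coe_mulLeft]
  rw [TensorProduct.map_tmul, pullback_planeWave, TensorProduct.smul_tmul]
  congr 2
  change dualAct (D.gradW g : V ≃ₗ[ℝ] V) _ = _
  rw [← dualAct_mul, ← Subgroup.coe_mul, mul_inv_cancel_left]

variable (k lam) in
/-- The covariance of a family `(n_w)` of coefficients under `g ∈ W^a`. -/
def IsCovariant (ρ : Representation ℂ D.Wa M) (n : D.W → M) (g : D.Wa) : Prop :=
  ∀ w : D.W, n (D.gradW g * w) =
    Complex.exp (dualAct (w : V ≃ₗ[ℝ] V) lam ((g : V ≃ᵃ[ℝ] V)⁻¹ 0)) •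
      ρ.asAlgebraHom (D.J k g (dualAct (w : V ≃ₗ[ℝ] V) lam)) (n w)

theorem gradW_ofW (w : D.W) : D.gradW (D.ofW w) = w := rfl

theorem dualAct_W_mem_Creg (hk : D.IsMultiplicity k) (hlam : lam ∈ D.Creg k) (w : D.W) :
    dualAct (w : V ≃ₗ[ℝ] V) lam ∈ D.Creg k :=
  dualAct_mem_Creg hk hlam (D.ofW w)

theorem inv_mul_apply_zero (g h : V ≃ᵃ[ℝ] V) :
    (g * h)⁻¹ 0 = h.linear⁻¹ (g⁻¹ 0) + h⁻¹ 0 := by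
  rw [mul_inv_rev]
  change h⁻¹ (g⁻¹ 0) = _
  have := (h⁻¹ : V ≃ᵃ[ℝ] V).map_vadd 0 (g⁻¹ 0)
  simp only [vadd_eq_add, add_zero] at this
  exact this

/-- The group algebra factors multiply by the cocycle property, the exponentials because (gh)⁻¹0 =
(Dh)⁻¹(g⁻¹0) + h⁻¹0. -/
theorem IsCovariant.mul (hk : D.IsMultiplicity k) (hlam : lam ∈ D.Creg k)
    {ρ : Representation ℂ D.Wa M} {n : D.W → M} {g h : D.Wa}
    (hg : IsCovariant k lam ρ n g) (hh : IsCovariant k lam ρ n h) :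
    IsCovariant k lam ρ n (g * h) := by
  intro w
  have hlin : (h : V ≃ᵃ[ℝ] V).linear = (D.gradW h : V ≃ₗ[ℝ] V) := rfl
  rw [map_mul, mul_assoc, hg, hh, J_mul hk (dualAct_W_mem_Creg hk hlam w), map_mul,
    Module.End.mul_apply, map_smul, smul_smul, ← Complex.exp_add, Subgroup.coe_mul, dualAct_mul,
    Subgroup.coe_mul, inv_mul_apply_zero, map_add, hlin]
  rfl

theorem isCovariant_one (hk : D.IsMultiplicity k) (hlam : lam ∈ D.Creg k)
    {ρ : Representation ℂ D.Wa M} {n : D.W → M} : IsCovariant k lam ρ n 1 := by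
  intro w
  rw [J_one hk (dualAct_W_mem_Creg hk hlam w)]
  simp

theorem isCovariant_of_letters (hk : D.IsMultiplicity k) (hlam : lam ∈ D.Creg k)
    {ρ : Representation ℂ D.Wa M} {n : D.W → M}
    (hs : ∀ a, IsCovariant k lam ρ n (D.simpleRefl a))
    (hω : ∀ ω : D.Ω, IsCovariant k lam ρ n ω) (g : D.Wa) : IsCovariant k lam ρ n g := by
  rw [← wordElt_reducedWord g]
  induction D.reducedWord g with
  | nil => exact isCovariant_one hk hlam
  | cons t l ih =>
    rcases t with ω | a
    · exact (hω ω).mul hk hlam ih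
    · exact (hs a).mul hk hlam ih

theorem Qomega_superposition (hk : D.IsMultiplicity k) (hlam : lam ∈ D.Creg k)
    (ρ : Representation ℂ D.Wa M) (n : D.W → M) (ω : D.Ω) :
    D.Qomega ρ ω (D.superposition lam n) = D.superposition lam n ↔
      IsCovariant k lam ρ n ω := by
  rw [Qomega, pullback_superposition, superposition_injective (apply_covector_ne_zero hlam)]
  constructor
  · intro h w
    have := congrFun h (D.gradW ω * w)
    rw [inv_mul_cancel_left] at this
    rw [← this, J_omega hk (dualAct_W_mem_Creg hk hlam w)]
    simp
  · intro h
    funext w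
    have := h ((D.gradW ω)⁻¹ * w)
    rw [mul_inv_cancel_left, J_omega hk (dualAct_W_mem_Creg hk hlam _)] at this
    rw [this]
    simp

theorem simpleRefl_coe_inv_apply (a : D.simpleAffineRoots) (v : V) :
    (D.simpleRefl a : V ≃ᵃ[ℝ] V)⁻¹ v = v - (a : V →ᵃ[ℝ] ℝ) v • covector (grad (a : V →ᵃ[ℝ] ℝ)) := by
  rw [← Subgroup.coe_inv, simpleRefl_inv]
  rfl

theorem integralOp_superposition (hk : D.IsMultiplicity k) (hlam : lam ∈ D.Creg k)
    (a : D.simpleAffineRoots) (n : D.W → M) :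
    TensorProduct.map (integralOp (a : V →ᵃ[ℝ] ℝ)) LinearMap.id (D.superposition lam n) =
      D.superposition lam (fun w =>
        (dualAct (w : V ≃ₗ[ℝ] V) lam (covector (grad (a : V →ᵃ[ℝ] ℝ))))⁻¹ • n w) -
      TensorProduct.map (pullback (D.simpleRefl a : V ≃ᵃ[ℝ] V)) LinearMap.id
        (D.superposition lam (fun w =>
          (dualAct (w : V ≃ₗ[ℝ] V) lam (covector (grad (a : V →ᵃ[ℝ] ℝ))))⁻¹ • n w)) := by
  rw [superposition, superposition, map_sum, map_sum, ← Finset.sum_sub_distrib]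
  refine Finset.sum_congr rfl fun w _ => ?_
  rw [TensorProduct.map_tmul, integralOp_planeWave (g := (D.simpleRefl a : V ≃ᵃ[ℝ] V)) _
    (dualAct_W_mem_Creg hk hlam w _ (D.simpleAffineRoots_subset a.2)).1
    (simpleRefl_coe_inv_apply a), TensorProduct.map_tmul, TensorProduct.smul_tmul,
    TensorProduct.sub_tmul]
  rfl

theorem asAlgebraHom_Jsimple (ρ : Representation ℂ D.Wa M) (a : D.simpleAffineRoots)
    (mu : V →ₗ[ℝ] ℂ) (m : M) :
    ρ.asAlgebraHom (D.Jsimple k a mu) m =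
      (mu (covector (grad (a : V →ᵃ[ℝ] ℝ))) - k a)⁻¹ •
        (mu (covector (grad (a : V →ᵃ[ℝ] ℝ))) • ρ (D.simpleRefl a) m + k a • m) := by
  rw [Jsimple, map_smul, map_add, map_smul, map_smul, map_one]
  simp

/-- Comparing the coefficients of one plane wave gives an equation between n at w and at s_a w.
Solving it for one of them produces exactly the operator J_{s_a}. -/
theorem Qsimple_superposition (hk : D.IsMultiplicity k) (hlam : lam ∈ D.Creg k)
    (ρ : Representation ℂ D.Wa M) (n : D.W → M) (a : D.simpleAffineRoots) :
    D.Qsimple k ρ a (D.superposition lam n) = D.superposition lam n ↔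
      IsCovariant k lam ρ n (D.simpleRefl a) := by
  have haR := D.simpleAffineRoots_subset a.2
  set σ := D.gradW (D.simpleRefl a) with hσ
  have hσσ : σ⁻¹ = σ := by rw [hσ, ← map_inv, simpleRefl_inv]
  have hflip : ∀ w : D.W, dualAct ((σ * w : D.W) : V ≃ₗ[ℝ] V) lam
      (covector (grad (a : V →ᵃ[ℝ] ℝ))) =
      -dualAct (w : V ≃ₗ[ℝ] V) lam (covector (grad (a : V →ᵃ[ℝ] ℝ))) := by
    intro w
    rw [Subgroup.coe_mul, dualAct_mul, hσ, dualAct_gradW_covector, simpleRefl_inv,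
      act_simpleRefl_self]
    have : grad (-(a : V →ᵃ[ℝ] ℝ)) = -grad (a : V →ᵃ[ℝ] ℝ) := rfl
    rw [this, covector_neg, map_neg]
  -- Here c is the weight at Da^∨, κ the multiplicity and e the exponential from the pulled-back
  -- plane wave. The two equations have differences of sides proportional by (c - κ)/c, which is
  -- finite and nonzero by regularity.
  have key : ∀ (e c κ : ℂ) (x y z : M), c ≠ 0 → c ≠ κ →
      (e • x - κ • ((-c)⁻¹ • z - e • (c⁻¹ • y)) = z ↔
        z = e • (c - κ)⁻¹ • (c • x + κ • y)) := by
    intro e c κ x y z hc hcκ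
    have hcκ' := sub_ne_zero.2 hcκ
    have h1 : e • x - κ • ((-c)⁻¹ • z - e • (c⁻¹ • y)) - z =
        ((c - κ) * c⁻¹) • (e • (c - κ)⁻¹ • (c • x + κ • y) - z) := by
      match_scalars <;> field_simp <;> ring
    rw [← sub_eq_zero, h1, smul_eq_zero_iff_right (mul_ne_zero hcκ' (inv_ne_zero hc)), sub_eq_zero]
    exact eq_comm
  rw [Qsimple, LinearMap.sub_apply, LinearMap.smul_apply, integralOp_superposition hk hlam,
    pullback_superposition, pullback_superposition, superposition_sub]
  have hsmul : ∀ n' : D.W → M, k a • D.superposition lam n' =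
      D.superposition lam fun w => k a • n' w := by
    intro n'
    rw [superposition, superposition, Finset.smul_sum]
    simp only [TensorProduct.tmul_smul]
  rw [hsmul, superposition_sub, superposition_injective (apply_covector_ne_zero hlam), ← hσ, hσσ]
  have hσ2 : σ * σ = 1 := mul_eq_one_iff_eq_inv.2 hσσ.symm
  constructor
  · intro h w
    have h1 := congrFun h (σ * w)
    have hreg := dualAct_W_mem_Creg hk hlam w _ haR
    simp only [← mul_assoc, hσ2, one_mul, hflip, LinearMap.id_apply] at h1
    rw [key _ _ _ _ _ _ hreg.1 hreg.2] at h1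
    rw [J_simple hk (dualAct_W_mem_Creg hk hlam w), asAlgebraHom_Jsimple]
    exact h1
  · intro h
    funext w
    have h1 := h (σ * w)
    have hreg := dualAct_W_mem_Creg hk hlam (σ * w) _ haR
    rw [J_simple hk (dualAct_W_mem_Creg hk hlam _), asAlgebraHom_Jsimple, ← hσ,
      ← key _ _ _ _ _ _ hreg.1 hreg.2, ← mul_assoc, hσ2, one_mul] at h1
    simp only [hflip, neg_neg, LinearMap.id_apply] at h1 ⊢
    exact h1

end RootDatum

namespace RootDatum

variable {D : RootDatum V} {k : (V →ᵃ[ℝ] ℝ) → ℂ} {lam : V →ₗ[ℝ] ℂ}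
  {M : Type*} [AddCommGroup M] [Module ℂ M]

/-! ### Invariance under the generators -/

/-- On generators the choice of reduced expression is forced, so `Q` takes its prescribed values
there. -/
theorem reducedExpr_omega (ω : D.Ω) : D.reducedExpr ω = (ω, []) := by
  have h1 := D.reducedExpr_length ω
  have h2 := D.reducedExpr_prod ω
  rw [show D.length ω = 0 from ω.2, List.length_eq_zero_iff] at h1
  rw [h1, List.map_nil, List.prod_nil, mul_one] at h2
  exact Prod.ext (Subtype.ext h2.symm) h1

theorem length_simpleRefl (a : D.simpleAffineRoots) : D.length (D.simpleRefl a) = 1 := by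
  have h := D.inversions_simpleRefl_mul (g := 1) a (by
    rw [inv_one, act_one]
    exact D.simple_pos a.2)
  rw [mul_one, inversions_one, inv_one, act_one] at h
  rw [length_eq_ncard, h]
  simp

theorem reducedExpr_simpleRefl (a : D.simpleAffineRoots) :
    ((D.reducedExpr (D.simpleRefl a)).1 : D.Wa) = 1 ∧
      (D.reducedExpr (D.simpleRefl a)).2 = [a] := by
  have h1 := D.reducedExpr_length (D.simpleRefl a)
  have h2 := D.reducedExpr_prod (D.simpleRefl a)
  rw [length_simpleRefl, List.length_eq_one_iff] at h1
  obtain ⟨b, hb⟩ := h1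
  rw [hb, List.map_cons, List.map_nil, List.prod_cons, List.prod_nil, mul_one] at h2
  have hba : b = a := by
    -- From s_a = ωs_b it follows that s_a sends b to -ωb, which is negative, and a is the only
    -- positive affine root made negative by s_a.
    refine Subtype.ext (D.eq_simple_of_neg a (D.simple_pos b.2) ?_)
    rw [h2, act_mul, act_simpleRefl_self, act_neg]
    exact D.neg_neg_of_pos (D.omega_pos _ (D.simple_pos b.2))
  subst hba
  exact ⟨(mul_eq_right.1 h2.symm), hb⟩

theorem Q_omega (ρ : Representation ℂ D.Wa M) (ω : D.Ω) : D.Q k ρ ω = D.Qomega ρ ω := by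
  rw [Q, reducedExpr_omega]
  simp

theorem pullback_one : pullback (1 : V ≃ᵃ[ℝ] V) = LinearMap.id := by
  ext f v
  change f ((1 : V ≃ᵃ[ℝ] V)⁻¹ v) = f v
  simp

theorem Q_simpleRefl (ρ : Representation ℂ D.Wa M) (a : D.simpleAffineRoots) :
    D.Q k ρ (D.simpleRefl a) = D.Qsimple k ρ a := by
  obtain ⟨h1, h2⟩ := reducedExpr_simpleRefl a
  have h3 : D.Qomega ρ (D.reducedExpr (D.simpleRefl a)).1 = 1 := by
    rw [Qomega, h1, map_one, Subgroup.coe_one, pullback_one]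
    exact TensorProduct.map_id
  rw [Q, h3, h2]
  simp

/-- Each `Q w` is a product of generators, and every generator occurs as some `Q w`. Hence the fixed
vectors agree, and multiplicativity of `Q` is not required. -/
theorem Q_fixed_iff (ρ : Representation ℂ D.Wa M) (f : Comega V ⊗[ℂ] M) :
    (∀ w : D.Wa, D.Q k ρ w f = f) ↔
      (∀ a, D.Qsimple k ρ a f = f) ∧ ∀ ω, D.Qomega ρ ω f = f := by
  constructor
  · intro h
    exact ⟨fun a => by rw [← Q_simpleRefl, h], fun ω => by rw [← Q_omega (k := k), h]⟩
  · rintro ⟨hs, hω⟩ w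
    have h1 : ∀ l : List D.simpleAffineRoots, (l.map (D.Qsimple k ρ)).prod f = f := by
      intro l
      induction l with
      | nil => simp
      | cons a l ih => rw [List.map_cons, List.prod_cons, Module.End.mul_apply, ih, hs]
    rw [Q, Module.End.mul_apply, h1, hω]

theorem superposition_mem_FirInvariants (hk : D.IsMultiplicity k) (hlam : lam ∈ D.Creg k)
    (ρ : Representation ℂ D.Wa M) (n : D.W → M) :
    D.superposition lam n ∈ D.FirInvariants k ρ lam ↔ ∀ g, IsCovariant k lam ρ n g := by
  have : D.superposition lam n ∈ D.FirInvariants k ρ lam ↔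
      ∀ w : D.Wa, D.Q k ρ w (D.superposition lam n) = D.superposition lam n :=
    ⟨fun h => h.2, fun h => ⟨superposition_mem_Fir n, h⟩⟩
  rw [this, Q_fixed_iff]
  simp only [Qsimple_superposition hk hlam, Qomega_superposition hk hlam]
  exact ⟨fun h => isCovariant_of_letters hk hlam h.1 h.2, fun h => ⟨fun a => h _, fun ω => h _⟩⟩

/-! ### Bethe ansatz equations -/

theorem gradW_transl (y : D.Y) : D.gradW (D.transl y) = 1 := rfl

theorem transl_inv_zero (y : D.Y) : (D.transl y : V ≃ᵃ[ℝ] V)⁻¹ 0 = -(y : V) := by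
  change -(y : V) + 0 = _
  rw [add_zero]

theorem exists_eq_ofW_mul_transl (g : D.Wa) :
    ∃ y : D.Y, g = D.ofW (D.gradW g) * D.transl y := by
  obtain ⟨w, hw, y, hy, h⟩ := g.2
  refine ⟨⟨y, hy⟩, Subtype.ext ?_⟩
  have h1 : (D.gradW g : V ≃ₗ[ℝ] V) = w := by
    change (g : V ≃ᵃ[ℝ] V).linear = w
    rw [h]
    rfl
  change (g : V ≃ᵃ[ℝ] V) =
    (D.gradW g : V ≃ₗ[ℝ] V).toAffineEquiv * AffineEquiv.constVAdd ℝ V y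
  rw [h1]
  exact h

/-- Covariance under t_y at w = 1 is the Bethe ansatz equation for y. Conversely, gw = w't_y with w'
= (Dg)w, and the cocycle property evaluates J_{gw}(λ)m along both factorizations. -/
theorem isCovariant_iff (hk : D.IsMultiplicity k) (hlam : lam ∈ D.Creg k)
    (ρ : Representation ℂ D.Wa M) (m : M) :
    (∀ g, IsCovariant k lam ρ (fun w => ρ.asAlgebraHom (D.J k (D.ofW w) lam) m) g) ↔
      ∀ y : D.Y, ρ.asAlgebraHom (D.J k (D.transl y) lam) m = Complex.exp (lam (y : V)) • m := by
  have hone : ρ.asAlgebraHom (D.J k (D.ofW 1) lam) m = m := by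
    rw [map_one D.ofW, J_one hk hlam, map_one, Module.End.one_apply]
  constructor
  · intro h y
    have h1 := h (D.transl y) 1
    rw [gradW_transl, mul_one, transl_inv_zero] at h1
    simp only [hone, Subgroup.coe_one, dualAct_one, map_neg] at h1
    conv_rhs => rw [h1]
    rw [smul_smul, ← Complex.exp_add, add_neg_cancel, Complex.exp_zero, one_smul]
  · intro h g w
    obtain ⟨y, hy⟩ := exists_eq_ofW_mul_transl (g * D.ofW w)
    have hgrad : D.gradW (g * D.ofW w) = D.gradW g * w := by rw [map_mul, gradW_ofW]
    rw [hgrad] at hy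
    have h1 := J_mul hk hlam g (D.ofW w)
    have h2 := J_mul hk hlam (D.ofW (D.gradW g * w)) (D.transl y)
    rw [gradW_transl, Subgroup.coe_one, dualAct_one, ← hy, h1, gradW_ofW] at h2
    have h3 := congrArg (fun x => ρ.asAlgebraHom x m) h2
    simp only [map_mul ρ.asAlgebraHom, Module.End.mul_apply, h y, map_smul] at h3
    -- Evaluating the inverses of both sides of gw = w't_y at the origin gives w⁻¹(g⁻¹0) = -y, so
    -- the two exponentials cancel.
    have h4 : dualAct (w : V ≃ₗ[ℝ] V) lam ((g : V ≃ᵃ[ℝ] V)⁻¹ 0) = -lam y := by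
      have h5 := congrArg (fun x : D.Wa => (x : V ≃ᵃ[ℝ] V)⁻¹ 0) hy
      simp only [Subgroup.coe_mul, inv_mul_apply_zero, transl_inv_zero] at h5
      have h6 : (D.ofW w : V ≃ᵃ[ℝ] V)⁻¹ 0 = 0 := map_zero ((w : V ≃ₗ[ℝ] V)⁻¹)
      have h7 : (D.ofW (D.gradW g * w) : V ≃ᵃ[ℝ] V)⁻¹ 0 = 0 :=
        map_zero (((D.gradW g * w : D.W) : V ≃ₗ[ℝ] V)⁻¹)
      have h8 : (D.transl y : V ≃ᵃ[ℝ] V).linear⁻¹ (0 : V) = 0 :=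
        map_zero (D.transl y : V ≃ᵃ[ℝ] V).linear⁻¹
      rw [h6, h7, h8, zero_add, add_zero] at h5
      rw [← map_neg, ← h5]
      rfl
    rw [h3, h4, smul_smul, ← Complex.exp_add, neg_add_cancel, Complex.exp_zero, one_smul]

theorem psi_eq_superposition (ρ : Representation ℂ D.Wa M) (m : M) :
    D.psi k ρ lam m =
      D.superposition lam fun w => ρ.asAlgebraHom (D.J k (D.ofW w) lam) m :=
  finsum_eq_sum_of_fintype _

theorem psi_mem_FirInvariants (hk : D.IsMultiplicity k) (hlam : lam ∈ D.Creg k)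
    (ρ : Representation ℂ D.Wa M) (m : M) :
    D.psi k ρ lam m ∈ D.FirInvariants k ρ lam ↔
      ∀ y : D.Y, ρ.asAlgebraHom (D.J k (D.transl y) lam) m = Complex.exp (lam (y : V)) • m := by
  rw [psi_eq_superposition, superposition_mem_FirInvariants hk hlam, isCovariant_iff hk hlam]

end RootDatum

theorem factor_neg_mul {lam : V →ₗ[ℝ] ℂ} {α : Module.Dual ℝ V} {c : ℂ}
    (h : lam (covector α) ≠ c) (h' : -lam (covector α) ≠ c) :
    RootDatum.factor lam (-α) c * RootDatum.factor lam α c = 1 := by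
  have h1 : lam (covector α) - c ≠ 0 := sub_ne_zero.2 h
  have h2 : lam (covector α) + c ≠ 0 := fun h0 => h' (by linear_combination -h0)
  have h3 : -lam (covector α) - c ≠ 0 := fun h0 => h2 (by linear_combination -h0)
  rw [RootDatum.factor, RootDatum.factor, covector_neg, map_neg]
  field_simp
  ring

namespace RootDatum

variable {D : RootDatum V} {k : (V →ᵃ[ℝ] ℝ) → ℂ} {lam : V →ₗ[ℝ] ℂ}

/-! ### The scalar cocycle -/

variable (D) in
/-- The scalar by which `J_g^k(λ)` acts in the trivial module. -/
def scalarJ (k : (V →ᵃ[ℝ] ℝ) → ℂ) (g : D.Wa) (lam : V →ₗ[ℝ] ℂ) : ℂ :=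
  (Representation.trivial ℂ D.Wa ℂ).asAlgebraHom (D.J k g lam) 1

theorem scalarJ_mul (hk : D.IsMultiplicity k) (hlam : lam ∈ D.Creg k) (g h : D.Wa) :
    D.scalarJ k (g * h) lam =
      D.scalarJ k g (dualAct (D.gradW h : V ≃ₗ[ℝ] V) lam) * D.scalarJ k h lam := by
  have h1 : ∀ (f : Module.End ℂ ℂ) (c : ℂ), f c = f 1 * c := by
    intro f c
    have := f.map_smul c 1
    rw [smul_eq_mul, mul_one, smul_eq_mul] at this
    rw [this, mul_comm]
  rw [scalarJ, J_mul hk hlam, map_mul, Module.End.mul_apply, h1]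
  rfl

theorem scalarJ_one (hk : D.IsMultiplicity k) (hlam : lam ∈ D.Creg k) :
    D.scalarJ k 1 lam = 1 := by
  rw [scalarJ, J_one hk hlam, map_one (Representation.asAlgebraHom _)]
  rfl

theorem scalarJ_omega (hk : D.IsMultiplicity k) (hlam : lam ∈ D.Creg k) (ω : D.Ω) :
    D.scalarJ k ω lam = 1 := by
  rw [scalarJ, J_omega hk hlam]
  simp

theorem scalarJ_simple (hk : D.IsMultiplicity k) (hlam : lam ∈ D.Creg k)
    (a : D.simpleAffineRoots) :
    D.scalarJ k (D.simpleRefl a) lam = factor lam (grad (a : V →ᵃ[ℝ] ℝ)) (k a) := by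
  rw [scalarJ, J_simple hk hlam, asAlgebraHom_Jsimple, factor, div_eq_inv_mul]
  simp

theorem mult_neg (hk : D.IsMultiplicity k) {a : V →ᵃ[ℝ] ℝ} (ha : a ∈ D.affineRoots) :
    k (-a) = k a := by
  rw [← D.act_reflElt_self ha, hk _ a ha]

theorem factor_neg_mul_root (hk : D.IsMultiplicity k) (hlam : lam ∈ D.Creg k) {a : V →ᵃ[ℝ] ℝ}
    (ha : a ∈ D.affineRoots) :
    factor lam (-grad a) (k a) * factor lam (grad a) (k a) = 1 := by
  refine factor_neg_mul (hlam a ha).2 ?_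
  have := (hlam _ (D.neg_mem_affineRoots ha)).2
  rw [mult_neg hk ha] at this
  have h2 : grad (-a) = -grad a := rfl
  rwa [h2, covector_neg, map_neg] at this

theorem factor_act (hk : D.IsMultiplicity k) (g : D.Wa) {a : V →ᵃ[ℝ] ℝ}
    (ha : a ∈ D.affineRoots) :
    factor (dualAct (D.gradW g : V ≃ₗ[ℝ] V) lam) (grad a) (k a) =
      factor lam (grad (D.act g⁻¹ a)) (k (D.act g⁻¹ a)) := by
  rw [factor, factor, dualAct_gradW_covector, hk _ a ha]

variable (D) in
/-- The product of the factors of `λ` over the inversions of `g`. -/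
def inversionProd (k : (V →ᵃ[ℝ] ℝ) → ℂ) (lam : V →ₗ[ℝ] ℂ) (g : D.Wa) : ℂ :=
  ∏ b ∈ D.invFinset g, factor lam (grad b) (k b)

theorem inversionProd_simple_of_pos (hk : D.IsMultiplicity k) (a : D.simpleAffineRoots)
    {g : D.Wa} (h : D.act g⁻¹ a ∈ D.posAffineRoots) :
    D.inversionProd k lam (D.simpleRefl a * g) =
      factor (dualAct (D.gradW g : V ≃ₗ[ℝ] V) lam) (grad (a : V →ᵃ[ℝ] ℝ)) (k a) *
        D.inversionProd k lam g := by
  classical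
  have hset : D.invFinset (D.simpleRefl a * g) = insert (D.act g⁻¹ a) (D.invFinset g) := by
    ext c
    simp only [mem_invFinset, Finset.mem_insert, D.inversions_simpleRefl_mul a h,
      Set.mem_insert_iff]
  have hnot : D.act g⁻¹ a ∉ D.invFinset g := by
    rw [mem_invFinset]
    exact D.act_inv_notMem_inversions a g
  rw [inversionProd, hset, Finset.prod_insert hnot,
    factor_act hk g (D.simpleAffineRoots_subset a.2), inversionProd]

/-- If g⁻¹a is negative, multiplication by s_a removes the inversion -g⁻¹a instead of adding one.
The formula is unchanged, because the factors of b and -b are inverse to each other. -/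
theorem inversionProd_simple (hk : D.IsMultiplicity k) (hlam : lam ∈ D.Creg k)
    (a : D.simpleAffineRoots) (g : D.Wa) :
    D.inversionProd k lam (D.simpleRefl a * g) =
      factor (dualAct (D.gradW g : V ≃ₗ[ℝ] V) lam) (grad (a : V →ᵃ[ℝ] ℝ)) (k a) *
        D.inversionProd k lam g := by
  have haR := D.simpleAffineRoots_subset a.2
  rcases D.pos_or_neg (D.act_mem_affineRoots g⁻¹ haR) with h | h
  · exact inversionProd_simple_of_pos hk a h
  · have hact : D.act (D.simpleRefl a * g)⁻¹ a = -D.act g⁻¹ a := by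
      rw [mul_inv_rev, act_mul, simpleRefl_inv, act_simpleRefl_self, act_neg]
    have hpos : D.act (D.simpleRefl a * g)⁻¹ a ∈ D.posAffineRoots := by
      rw [hact]
      exact D.neg_pos_of_neg h
    have h1 := inversionProd_simple_of_pos (lam := lam) hk a hpos
    have hR := D.act_mem_affineRoots g⁻¹ haR
    have h2 := factor_neg_mul_root hk hlam hR
    rw [← mul_assoc, simpleRefl_mul_self, one_mul, factor_act hk _ haR, hact, mult_neg hk hR,
      show grad (-D.act g⁻¹ a) = -grad (D.act g⁻¹ (a : V →ᵃ[ℝ] ℝ)) from rfl] at h1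
    rw [factor_act hk _ haR, h1, ← mul_assoc, mul_comm (factor lam (grad _) _), h2, one_mul]

/-- Both sides obey the same recursion along words, even along words that are not reduced. -/
theorem scalarJ_eq_inversionProd (hk : D.IsMultiplicity k) (hlam : lam ∈ D.Creg k) (g : D.Wa) :
    D.scalarJ k g lam = D.inversionProd k lam g := by
  rw [← wordElt_reducedWord g]
  induction D.reducedWord g with
  | nil =>
    rw [wordElt_nil, scalarJ_one hk hlam, inversionProd, invFinset]
    simp [inversions_one]
  | cons t l ih =>
    rcases t with ω | a
    · rw [wordElt_inl, scalarJ_mul hk hlam, ih, scalarJ_omega hk (dualAct_mem_Creg hk hlam _),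
        one_mul, inversionProd, inversionProd, invFinset, invFinset]
      simp only [inversions_omega_mul]
    · rw [wordElt_inr, scalarJ_mul hk hlam, ih, scalarJ_simple hk (dualAct_mem_Creg hk hlam _),
        inversionProd_simple hk hlam]

/-! ### The `c`-function -/

theorem posRoots_finite : D.posRoots.Finite := D.isRootSystem.finite.subset fun _ h => h.1

variable (D) in
/-- The positive roots as a finite set. -/
def posFinset : Finset (Module.Dual ℝ V) := (posRoots_finite (D := D)).toFinset

theorem mem_posFinset {α : Module.Dual ℝ V} : α ∈ D.posFinset ↔ α ∈ D.posRoots :=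
  Set.Finite.mem_toFinset _

theorem cFunction_eq_prod (lam : V →ₗ[ℝ] ℂ) :
    D.cFunction k lam =
      ∏ α ∈ D.posFinset, (lam (covector α) - k α.toAffineMap) / lam (covector α) :=
  finprod_mem_eq_finite_toFinset_prod _ _

theorem cFunction_ne_zero (hlam : lam ∈ D.Creg k) : D.cFunction k lam ≠ 0 := by
  rw [cFunction_eq_prod]
  refine Finset.prod_ne_zero_iff.2 fun α hα => ?_
  have h := hlam _ (D.toAffineMap_mem_affineRoots (mem_posFinset.1 hα).1)
  exact div_ne_zero (sub_ne_zero.2 h.2) h.1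

theorem mult_comp (hk : D.IsMultiplicity k) (w : D.W) {α : Module.Dual ℝ V} (hα : α ∈ D.R) :
    k (α ∘ₗ (((w : V ≃ₗ[ℝ] V)⁻¹ : V ≃ₗ[ℝ] V) : V →ₗ[ℝ] V)).toAffineMap = k α.toAffineMap := by
  rw [← act_ofW_toAffineMap, hk _ _ (D.toAffineMap_mem_affineRoots hα)]

/-- The reflection s_α permutes the positive roots other than α and preserves k. Only the factor of
α changes, its λ(α^∨) being replaced by the negative. -/
theorem cFunction_simple (hk : D.IsMultiplicity k) (hlam : lam ∈ D.Creg k) {α : Module.Dual ℝ V}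
    (hα : α ∈ D.F) :
    D.cFunction k (dualAct (refl α) lam) = factor lam α (k α.toAffineMap) * D.cFunction k lam := by
  classical
  have hαR := D.isRootBasis.subset hα
  have hαP : α ∈ D.posFinset := mem_posFinset.2 ⟨hαR, AddSubmonoid.subset_closure hα⟩
  have hcov : ∀ β, dualAct (refl α) lam (covector β) =
      lam (covector (β ∘ₗ (refl α : V →ₗ[ℝ] V))) := by
    intro β
    have := D.covector_comp (D.refl_mem_W hαR) β
    rw [refl_inv] at this
    rw [this, dualAct_apply, refl_inv]
  have hinv : ∀ β : Module.Dual ℝ V,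
      (β ∘ₗ (refl α : V →ₗ[ℝ] V)) ∘ₗ (refl α : V →ₗ[ℝ] V) = β := by
    intro β
    ext v
    exact congrArg β (reflFun_reflFun α v)
  have hself : α ∘ₗ (refl α : V →ₗ[ℝ] V) = -α := by
    rw [comp_refl, apply_covector_self (D.ne_zero_of_mem_R hαR)]
    module
  rw [cFunction_eq_prod, cFunction_eq_prod, ← Finset.mul_prod_erase _ _ hαP,
    ← Finset.mul_prod_erase D.posFinset (fun α => (lam (covector α) - k α.toAffineMap) /
      lam (covector α)) hαP, ← mul_assoc]
  congr 1
  · have h := hlam _ (D.toAffineMap_mem_affineRoots hαR)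
    have h1 : lam (covector α) ≠ 0 := h.1
    have h2 : lam (covector α) - k α.toAffineMap ≠ 0 := sub_ne_zero.2 h.2
    rw [hcov, hself, covector_neg, map_neg, factor]
    field_simp
    ring
  · have hmem : ∀ β ∈ D.posFinset.erase α,
        β ∘ₗ (refl α : V →ₗ[ℝ] V) ∈ D.posFinset.erase α := by
      intro β hβ
      rw [Finset.mem_erase, mem_posFinset] at hβ ⊢
      refine ⟨fun h => ?_, D.comp_refl_pos hα hβ.2 hβ.1⟩
      have h1 := hinv β
      rw [h, hself] at h1
      have h2 : (-α).toAffineMap ∈ D.posAffineRoots := by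
        rw [h1]
        exact D.toAffineMap_pos.2 hβ.2
      have h3 := D.toAffineMap_pos.2 (mem_posFinset.1 hαP)
      exact D.not_pos_of_neg (D.neg_neg_of_pos h3) h2
    refine Finset.prod_nbij' (fun β => β ∘ₗ (refl α : V →ₗ[ℝ] V))
      (fun β => β ∘ₗ (refl α : V →ₗ[ℝ] V)) hmem hmem (fun β _ => hinv β) (fun β _ => hinv β) ?_
    intro β hβ
    have h1 := mult_comp hk ⟨refl α, D.refl_mem_W hαR⟩
      (mem_posFinset.1 (Finset.mem_of_mem_erase hβ)).1
    simp only [refl_inv] at h1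
    rw [hcov, h1]

/-- Along a word in the simple reflections of W, the c-function and the scalar cocycle change by the
same factor at each letter. This identifies the coefficients of ψ_λ with those of the vector-valued
ψ. -/
theorem scalarJ_ofW (hk : D.IsMultiplicity k) (hlam : lam ∈ D.Creg k) (w : D.W) :
    D.scalarJ k (D.ofW w) lam * D.cFunction k lam =
      D.cFunction k (dualAct (w : V ≃ₗ[ℝ] V) lam) := by
  obtain ⟨l, hl⟩ := D.ofW_eq_prod w
  induction l generalizing w with
  | nil =>
    have : w = 1 := D.ofW_injective (by rw [← hl, map_one]; rfl)
    rw [this, map_one, scalarJ_one hk hlam, one_mul, Subgroup.coe_one, dualAct_one]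
  | cons α l ih =>
    have hαR := D.isRootBasis.subset α.2
    let r : D.W := ⟨refl (α : Module.Dual ℝ V), D.refl_mem_W hαR⟩
    rw [List.map_cons, List.prod_cons] at hl
    have h1 : (l.map fun α => D.simpleRefl (D.simpleRoot α)).prod = D.ofW (r⁻¹ * w) := by
      rw [map_mul, ← hl, map_inv, ← D.simpleRefl_simpleRoot, inv_mul_cancel_left]
    have h2 := ih _ h1
    have hw : w = r * (r⁻¹ * w) := by rw [mul_inv_cancel_left]
    have hreg := dualAct_W_mem_Creg hk hlam (r⁻¹ * w)
    have h3 := scalarJ_mul hk hlam (D.ofW r) (D.ofW (r⁻¹ * w))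
    rw [← map_mul, ← hw, gradW_ofW, ← D.simpleRefl_simpleRoot, scalarJ_simple hk hreg] at h3
    rw [h3, mul_assoc, h2]
    have h4 := cFunction_simple hk hreg α.2
    conv_rhs => rw [hw, Subgroup.coe_mul, dualAct_mul]
    exact h4.symm

theorem psiScalar_tmul (hk : D.IsMultiplicity k) (hlam : lam ∈ D.Creg k) :
    D.psiScalar k lam ⊗ₜ[ℂ] (1 : ℂ) =
      D.psi k (Representation.trivial ℂ D.Wa ℂ) lam 1 := by
  rw [psi_eq_superposition, superposition, psiScalar, finsum_eq_sum_of_fintype, Finset.smul_sum,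
    TensorProduct.sum_tmul]
  refine Finset.sum_congr rfl fun w _ => ?_
  rw [smul_smul, ← scalarJ_ofW hk hlam, TensorProduct.smul_tmul, smul_eq_mul, mul_one]
  congr 1
  have := cFunction_ne_zero hlam
  rw [mul_comm, mul_assoc, mul_inv_cancel₀ this, mul_one]
  rfl

/-! ### Evenness of roots outside the orbit of the highest root -/

theorem inner_nonneg_of_dominant {η : Module.Dual ℝ V} (hη : ∀ α ∈ D.F, 0 ≤ η (covector α))
    {β : Module.Dual ℝ V} (hβ : β ∈ AddSubmonoid.closure D.F) :
    0 ≤ inner ℝ (riesz η) (riesz β) := by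
  induction hβ using AddSubmonoid.closure_induction with
  | mem x hx =>
    have h1 := hη x hx
    have h2 := inner_riesz_pos (D.ne_zero_of_mem_R (D.isRootBasis.subset hx))
    rw [apply_covector] at h1
    have h3 := mul_nonneg h1 h2.le
    rw [div_mul_cancel₀ _ h2.ne'] at h3
    linarith
  | zero => simp [riesz_zero]
  | add x y _ _ hx hy => rw [riesz_add, inner_add_right]; exact add_nonneg hx hy

/-- As s_αθ is a root, θ - s_αθ = θ(α^∨)α is a nonnegative combination of simple roots. -/
theorem highestRoot_dominant {α : Module.Dual ℝ V} (hα : α ∈ D.F) : 0 ≤ D.θ (covector α) := by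
  obtain ⟨h, hh⟩ := D.exists_height
  have hαR := D.isRootBasis.subset hα
  have h1 := D.isHighestRoot.sub_mem _
    (D.isRootSystem.reflection_mem α hαR D.θ D.isHighestRoot.mem)
  obtain ⟨n, hn⟩ := D.height_nat hh h1
  rw [sub_sub_cancel, map_smul, hh α hα, smul_eq_mul, mul_one] at hn
  rw [hn]
  exact Nat.cast_nonneg n

theorem riesz_sub (ξ η : Module.Dual ℝ V) : riesz (ξ - η) = riesz ξ - riesz η := by
  rw [sub_eq_add_neg, riesz_add, riesz_neg, sub_eq_add_neg]

/-- Suppose that α has only even pairings with co-roots, and let α' be a dominant conjugate. As θ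
and α' are dominant and θ - α' is a nonnegative combination of simple roots, |α'|² ≤ ⟨α', θ⟩ ≤ |θ|².
Evenness of α'(θ^∨) makes ⟨α', θ⟩ an integral multiple of |θ|², so it equals |θ|². Then |θ - α'|² ≤
0 and α' = θ. -/
theorem exists_odd_of_notMem_orbitTheta {α : Module.Dual ℝ V} (hα : α ∈ D.R)
    (h : α ∉ D.orbitTheta) : ∃ γ ∈ D.R, ∃ n : ℤ, Odd n ∧ α (covector γ) = n := by
  by_contra! hcon
  apply h
  obtain ⟨u, hu, hdom⟩ := D.exists_dominant α
  set α' := α ∘ₗ (u : V →ₗ[ℝ] V) with hα'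
  have hα'R : α' ∈ D.R := D.comp_mem_R hu hα
  have hθ0 := inner_riesz_pos (D.ne_zero_of_mem_R D.isHighestRoot.mem)
  have hα0 := inner_riesz_pos (D.ne_zero_of_mem_R hα'R)
  have h1 := inner_nonneg_of_dominant hdom (D.isHighestRoot.sub_mem _ hα'R)
  have h2 := inner_nonneg_of_dominant (fun _ => highestRoot_dominant)
    (D.isHighestRoot.sub_mem _ hα'R)
  have h3 : α' (covector D.θ) = α (covector (D.θ ∘ₗ ((u⁻¹ : V ≃ₗ[ℝ] V) : V →ₗ[ℝ] V))) := by
    rw [D.covector_comp hu]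
    rfl
  have h4 : D.θ ∘ₗ ((u⁻¹ : V ≃ₗ[ℝ] V) : V →ₗ[ℝ] V) ∈ D.R :=
    D.comp_mem_R (D.W.inv_mem hu) D.isHighestRoot.mem
  obtain ⟨n, hn⟩ := D.isRootSystem.crystallographic _ h4 α hα
  have heven : Even n := by
    rw [← Int.not_odd_iff_even]
    exact fun hodd => hcon _ h4 n hodd hn
  obtain ⟨r, rfl⟩ := heven
  rw [hn, apply_covector] at h3
  rw [riesz_sub, inner_sub_right] at h1 h2
  rw [real_inner_comm] at h2
  rw [real_inner_comm (riesz α') (riesz D.θ)] at h2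
  set x := inner ℝ (riesz D.θ) (riesz D.θ)
  set y := inner ℝ (riesz α') (riesz α')
  set z := inner ℝ (riesz α') (riesz D.θ) with hz
  have h5 : z = r * x := by
    rw [div_eq_iff hθ0.ne'] at h3
    push_cast at h3
    linarith
  have hr : r = 1 := by
    have hr0 : 0 < r := by
      by_contra! hle
      have : (r : ℝ) ≤ 0 := by exact_mod_cast hle
      nlinarith
    have hr1 : r ≤ 1 := by
      by_contra! hle
      have : (2 : ℝ) ≤ r := by exact_mod_cast hle
      nlinarith
    omega
  rw [hr, Int.cast_one, one_mul] at h5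
  have h6 : inner ℝ (riesz (D.θ - α')) (riesz (D.θ - α')) ≤ 0 := by
    rw [riesz_sub, inner_sub_left, inner_sub_right, inner_sub_right,
      real_inner_comm (riesz α') (riesz D.θ)]
    change x - z - (z - y) ≤ 0
    linarith
  have h7 : D.θ - α' = 0 :=
    riesz_eq_zero (inner_self_eq_zero.1 (le_antisymm h6 real_inner_self_nonneg))
  refine ⟨u, hu, ?_⟩
  rw [sub_eq_zero.1 h7, hα']
  ext v
  change α v = α ((u * u⁻¹) v)
  simp

end RootDatum

/-! ### Products of periodic factors over integer intervals -/

theorem prod_Ico_int {R : Type*} [CommMonoid R] (p : ℤ → R) (a : ℤ) (N : ℕ) :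
    ∏ m ∈ Finset.Ico a (a + N), p m = ∏ i ∈ Finset.range N, p (a + i) := by
  symm
  refine Finset.prod_nbij' (fun i : ℕ => a + (i : ℤ)) (fun m => (m - a).toNat) ?_ ?_ ?_ ?_ ?_
  · intro i hi
    simp only [Finset.mem_range, Finset.mem_Ico] at hi ⊢
    omega
  · intro m hm
    simp only [Finset.mem_range, Finset.mem_Ico] at hm ⊢
    omega
  · intro i _
    simp
  · intro m hm
    simp only [Finset.mem_Ico] at hm
    omega
  · intro i _
    rfl

theorem prod_Ico_of_periodic {R : Type*} [CommMonoid R] {p : ℤ → R} (hp : ∀ m, p (m + 2) = p m)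
    (a : ℤ) (N : ℕ) : ∏ m ∈ Finset.Ico a (a + (2 * N : ℕ)), p m = (p a * p (a + 1)) ^ N := by
  rw [prod_Ico_int]
  have hper : ∀ (b : ℤ) (N : ℕ), p (b + (2 * N : ℕ)) = p b := by
    intro b N
    induction N with
    | zero => simp
    | succ N ih =>
      rw [← ih, ← hp (b + (2 * N : ℕ))]
      congr 1
      push_cast
      ring
  induction N with
  | zero => simp
  | succ N ih =>
    rw [show 2 * (N + 1) = 2 * N + 1 + 1 by ring, Finset.prod_range_succ, Finset.prod_range_succ, ih,
      pow_succ, mul_assoc, hper]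
    congr 2
    rw [← hper (a + 1) N]
    congr 1
    push_cast
    ring

namespace RootDatum

variable {D : RootDatum V} {k : (V →ᵃ[ℝ] ℝ) → ℂ} {lam : V →ₗ[ℝ] ℂ}

/-! ### Inversions of translations -/

/-- The affine function `β + m`. -/
def affRoot (β : Module.Dual ℝ V) (m : ℤ) : V →ᵃ[ℝ] ℝ :=
  β.toAffineMap + AffineMap.const ℝ V (m : ℝ)

theorem affRoot_zero (β : Module.Dual ℝ V) : affRoot β 0 = β.toAffineMap := by
  ext v
  simp [affRoot]

theorem affRoot_mem {β : Module.Dual ℝ V} (hβ : β ∈ D.R) (m : ℤ) : affRoot β m ∈ D.affineRoots :=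
  ⟨β, hβ, m, rfl⟩

theorem grad_affRoot (β : Module.Dual ℝ V) (m : ℤ) : grad (affRoot β m) = β := by
  simp [affRoot, grad]

theorem affRoot_apply_zero (β : Module.Dual ℝ V) (m : ℤ) : affRoot β m 0 = m := by
  simp [affRoot]

theorem neg_affRoot (β : Module.Dual ℝ V) (m : ℤ) : -affRoot β m = affRoot (-β) (-m) := by
  ext v
  simp [affRoot]
  ring

theorem affRoot_injective {β γ : Module.Dual ℝ V} {m n : ℤ} (h : affRoot β m = affRoot γ n) :
    β = γ ∧ m = n := by
  refine ⟨by rw [← grad_affRoot β m, h, grad_affRoot], ?_⟩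
  have := affRoot_apply_zero β m
  rw [h, affRoot_apply_zero] at this
  exact_mod_cast this.symm

theorem affRoot_pos_iff {β : Module.Dual ℝ V} (hβ : β ∈ D.R) (m : ℤ) :
    affRoot β m ∈ D.posAffineRoots ↔ 0 < m ∨ m = 0 ∧ β ∈ D.posRoots := by
  constructor
  · rintro (⟨γ, hγ, n, hn, h⟩ | ⟨γ, hγ, h⟩)
    · obtain ⟨-, rfl⟩ := affRoot_injective h
      exact Or.inl hn
    · rw [← affRoot_zero] at h
      obtain ⟨rfl, rfl⟩ := affRoot_injective h
      exact Or.inr ⟨rfl, hγ⟩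
  · rintro (h | ⟨rfl, h⟩)
    · exact Or.inl ⟨β, hβ, m, h, rfl⟩
    · rw [affRoot_zero]
      exact D.toAffineMap_pos.2 h

theorem neg_mem_posRoots_iff {β : Module.Dual ℝ V} (hβ : β ∈ D.R) :
    -β ∈ D.posRoots ↔ β ∉ D.posRoots := by
  constructor
  · intro h h'
    have h1 := D.toAffineMap_pos.2 h
    exact D.not_pos_of_neg (D.neg_neg_of_pos (D.toAffineMap_pos.2 h')) h1
  · exact fun h => (D.pos_or_neg_mem_posRoots hβ).resolve_left h

theorem affRoot_neg_iff {β : Module.Dual ℝ V} (hβ : β ∈ D.R) (m : ℤ) :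
    affRoot β m ∈ D.negAffineRoots ↔ m < 0 ∨ m = 0 ∧ β ∉ D.posRoots := by
  change -affRoot β m ∈ D.posAffineRoots ↔ _
  rw [neg_affRoot, affRoot_pos_iff (D.neg_mem_R hβ), neg_mem_posRoots_iff hβ]
  simp

theorem act_transl_affRoot {β : Module.Dual ℝ V} (m : ℤ) {y : D.Y} {n : ℤ}
    (hn : β (y : V) = n) : D.act (D.transl y) (affRoot β m) = affRoot β (m - n) := by
  ext v
  rw [act_apply]
  change affRoot β m (-(y : V) + v) = _
  simp [affRoot, hn]
  ring

open Classical in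
variable (D) in
/-- The shifts `m` for which `β + m` is an inversion of a translation `t_y` with `β(y) = n`. -/
def shifts (β : Module.Dual ℝ V) (n : ℤ) : Finset ℤ :=
  if β ∈ D.posRoots then Finset.Ico 0 n else Finset.Ico 1 (n + 1)

/-- Translation over y replaces β + m by β + m - n. The endpoint m = 0 is positive only if β is
positive, and the endpoint m = n becomes negative only if β is not, which gives the interval [0, n)
or [1, n]. -/
theorem affRoot_mem_inversions_transl {β : Module.Dual ℝ V} (hβ : β ∈ D.R) (m : ℤ) {y : D.Y}
    {n : ℤ} (hn : β (y : V) = n) :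
    affRoot β m ∈ D.inversions (D.transl y) ↔ m ∈ D.shifts β n := by
  change affRoot β m ∈ D.posAffineRoots ∧ D.act (D.transl y) (affRoot β m) ∈ D.negAffineRoots ↔ _
  rw [act_transl_affRoot m hn, affRoot_pos_iff hβ, affRoot_neg_iff hβ, shifts]
  by_cases h : β ∈ D.posRoots
  · simp only [h, if_true, Finset.mem_Ico, and_true, not_true, and_false, or_false]
    omega
  · simp only [h, if_false, Finset.mem_Ico, and_true, not_false_eq_true, and_false, or_false]
    omega

variable (D) in
/-- The contribution of the affine roots with gradient `β` to the scalar cocycle of a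
translation. -/
def rootProd (k : (V →ᵃ[ℝ] ℝ) → ℂ) (lam : V →ₗ[ℝ] ℂ) (β : Module.Dual ℝ V) (n : ℤ) : ℂ :=
  ∏ m ∈ D.shifts β n, factor lam β (k (affRoot β m))

theorem apply_Y_eq_floor {β : Module.Dual ℝ V} (hβ : β ∈ D.R) (y : D.Y) :
    β (y : V) = (⌊β (y : V)⌋ : ℤ) := by
  obtain ⟨n, hn⟩ := D.exists_int_of_mem_Y hβ y.2
  rw [hn, Int.floor_intCast]

/-- The inversions are grouped by gradient, and the gradients into pairs ±α. -/
theorem inversionProd_transl (y : D.Y) :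
    D.inversionProd k lam (D.transl y) =
      ∏ α ∈ D.posFinset, D.rootProd k lam α ⌊α (y : V)⌋ * D.rootProd k lam (-α) ⌊(-α) (y : V)⌋ := by
  classical
  set Rf := D.isRootSystem.finite.toFinset with hRf
  have hmem : ∀ {β}, β ∈ Rf ↔ β ∈ D.R := Set.Finite.mem_toFinset _
  have h1 : D.inversionProd k lam (D.transl y) =
      ∏ β ∈ Rf, D.rootProd k lam β ⌊β (y : V)⌋ := by
    symm
    simp only [rootProd]
    rw [Finset.prod_sigma']
    refine Finset.prod_nbij (fun p => affRoot p.1 p.2) ?_ ?_ ?_ ?_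
    · rintro ⟨β, m⟩ h
      rw [Finset.mem_sigma] at h
      rw [mem_invFinset, affRoot_mem_inversions_transl (hmem.1 h.1) m
        (apply_Y_eq_floor (hmem.1 h.1) y)]
      exact h.2
    · rintro ⟨β, m⟩ - ⟨γ, n⟩ - h
      obtain ⟨rfl, rfl⟩ := affRoot_injective h
      rfl
    · rintro b hb
      rw [Finset.mem_coe, mem_invFinset] at hb
      obtain ⟨β, hβ, m, h⟩ := D.mem_affineRoots_of_pos hb.1
      change b = affRoot β m at h
      subst h
      rw [affRoot_mem_inversions_transl hβ m (apply_Y_eq_floor hβ y)] at hb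
      exact ⟨⟨β, m⟩, by simpa using ⟨hmem.2 hβ, hb⟩, rfl⟩
    · rintro ⟨β, m⟩ -
      rw [grad_affRoot]
  have h2 : Rf = D.posFinset ∪ D.posFinset.image Neg.neg := by
    ext β
    rw [hmem, Finset.mem_union, Finset.mem_image]
    constructor
    · intro h
      rcases D.pos_or_neg_mem_posRoots h with h | h
      · exact Or.inl (mem_posFinset.2 h)
      · exact Or.inr ⟨-β, mem_posFinset.2 h, neg_neg β⟩
    · rintro (h | ⟨γ, h, rfl⟩)
      · exact (mem_posFinset.1 h).1
      · exact D.neg_mem_R (mem_posFinset.1 h).1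
  have h3 : Disjoint D.posFinset (D.posFinset.image Neg.neg) := by
    rw [Finset.disjoint_left]
    intro β hβ hβ'
    obtain ⟨γ, h, rfl⟩ := Finset.mem_image.1 hβ'
    exact (neg_mem_posRoots_iff (mem_posFinset.1 h).1).1 (mem_posFinset.1 hβ) (mem_posFinset.1 h)
  rw [h1, h2, Finset.prod_union h3, Finset.prod_image neg_injective.injOn,
    Finset.prod_mul_distrib]

theorem mult_affRoot_neg (hk : D.IsMultiplicity k) {α : Module.Dual ℝ V} (hα : α ∈ D.R) (m : ℤ) :
    k (affRoot (-α) m) = k (affRoot α (-m)) := by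
  rw [← mult_neg hk (affRoot_mem hα _), neg_affRoot, neg_neg]

theorem mult_affRoot_sub (hk : D.IsMultiplicity k) {α : Module.Dual ℝ V} (hα : α ∈ D.R) (m : ℤ)
    {y : D.Y} {n : ℤ} (hn : α (y : V) = n) : k (affRoot α (m - n)) = k (affRoot α m) := by
  rw [← act_transl_affRoot m hn, hk _ _ (affRoot_mem hα m)]

/-- Translation over α^∨ shifts the constant by α(α^∨) = 2. -/
theorem mult_affRoot_add_two (hk : D.IsMultiplicity k) {α : Module.Dual ℝ V} (hα : α ∈ D.R)
    (m : ℤ) : k (affRoot α (m + 2)) = k (affRoot α m) := by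
  have h := mult_affRoot_sub hk hα (m + 2) (y := ⟨covector α, D.covector_mem_Y hα⟩) (n := 2)
    (by simpa using apply_covector_self (D.ne_zero_of_mem_R hα))
  rw [← h, add_sub_cancel_right]

/-- An odd value 2r + 1 is reduced to 1 by subtracting r times α^∨ from y. -/
theorem exists_apply_eq_one {α : Module.Dual ℝ V} (hα : α ∈ D.R) {y : V} (hy : y ∈ D.Y) {n : ℤ}
    (hn : α y = n) (hodd : Odd n) : ∃ z ∈ D.Y, α z = 1 := by
  obtain ⟨r, rfl⟩ := hodd
  refine ⟨y - (r : ℝ) • covector α, D.Y.sub_mem hy (D.int_smul_mem_Y rfl (D.covector_mem_Y hα)), ?_⟩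
  rw [map_sub, map_smul, apply_covector_self (D.ne_zero_of_mem_R hα), hn, smul_eq_mul]
  push_cast
  ring

theorem mult_affRoot_const (hk : D.IsMultiplicity k) {α : Module.Dual ℝ V} (hα : α ∈ D.R)
    (h : ∃ z ∈ D.Y, α z = 1) (m : ℤ) : k (affRoot α m) = k α.toAffineMap := by
  obtain ⟨z, hz, h1⟩ := h
  have h2 := mult_affRoot_sub hk hα m (y := ⟨(m : ℝ) • z, D.int_smul_mem_Y rfl hz⟩) (n := m)
    (by simp [h1])
  rw [← h2, sub_self, affRoot_zero]

theorem rootProd_pos {α : Module.Dual ℝ V} (hα : α ∈ D.posRoots) (n : ℤ) :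
    D.rootProd k lam α n = ∏ m ∈ Finset.Ico 0 n, factor lam α (k (affRoot α m)) := by
  rw [rootProd, shifts, if_pos hα]

theorem rootProd_neg {α : Module.Dual ℝ V} (hα : α ∈ D.posRoots) (n : ℤ) :
    D.rootProd k lam (-α) n =
      ∏ m ∈ Finset.Ico 1 (n + 1), factor lam (-α) (k (affRoot (-α) m)) := by
  have : -α ∉ D.posRoots := by
    rw [← neg_mem_posRoots_iff (D.neg_mem_R hα.1), neg_neg]
    exact hα
  rw [rootProd, shifts, if_neg this]

theorem factor_neg_affRoot (hk : D.IsMultiplicity k) (hlam : lam ∈ D.Creg k)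
    {α : Module.Dual ℝ V} (hα : α ∈ D.R) (m : ℤ) :
    factor lam (-α) (k (affRoot α m)) = (factor lam α (k (affRoot α m)))⁻¹ := by
  have := factor_neg_mul_root hk hlam (affRoot_mem hα m)
  rw [grad_affRoot] at this
  exact eq_inv_of_mul_eq_one_left this

/-- At most one of α and -α contributes, according to the sign of n. The factors of -α are inverse
to those of α and supply the negative powers. -/
theorem rootProd_mul_of_const (hk : D.IsMultiplicity k) (hlam : lam ∈ D.Creg k)
    {α : Module.Dual ℝ V} (hα : α ∈ D.posRoots) (h : ∀ m, k (affRoot α m) = k α.toAffineMap)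
    (n : ℤ) :
    D.rootProd k lam α n * D.rootProd k lam (-α) (-n) = factor lam α (k α.toAffineMap) ^ n := by
  have hf := factor_neg_affRoot hk hlam hα.1 0
  rw [h] at hf
  rw [rootProd_pos hα, rootProd_neg hα]
  simp only [mult_affRoot_neg hk hα.1, h, hf, Finset.prod_const, Int.card_Ico]
  rcases le_total 0 n with hn | hn
  · lift n to ℕ using hn
    have : (-(n : ℤ) + 1 - 1).toNat = 0 := by omega
    rw [this, pow_zero, mul_one, zpow_natCast]
    simp
  · obtain ⟨N, rfl⟩ : ∃ N : ℕ, n = -N := ⟨(-n).toNat, by omega⟩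
    have : (-(N : ℤ) - 0).toNat = 0 := by omega
    rw [this, pow_zero, one_mul, zpow_neg, zpow_natCast, inv_pow]
    simp

/-- The multiplicities along α + ℤ have period 2, and an interval of length 2|q| covers |q| full
periods, each with one factor of either parity. -/
theorem rootProd_mul_of_even (hk : D.IsMultiplicity k) (hlam : lam ∈ D.Creg k)
    {α : Module.Dual ℝ V} (hα : α ∈ D.posRoots) (q : ℤ) :
    D.rootProd k lam α (2 * q) * D.rootProd k lam (-α) (-(2 * q)) =
      factor lam α (k α.toAffineMap) ^ q * factor lam α (k (affRoot α 1)) ^ q := by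
  have hp : ∀ m, factor lam α (k (affRoot α (m + 2))) = factor lam α (k (affRoot α m)) :=
    fun m => by rw [mult_affRoot_add_two hk hα.1]
  have hp' : ∀ m, factor lam (-α) (k (affRoot (-α) (m + 2))) =
      factor lam (-α) (k (affRoot (-α) m)) :=
    fun m => by rw [mult_affRoot_add_two hk (D.neg_mem_R hα.1)]
  rw [rootProd_pos hα, rootProd_neg hα, ← mul_zpow]
  rcases le_total 0 q with hq | hq
  · lift q to ℕ using hq
    have h1 := prod_Ico_of_periodic (p := fun m => factor lam α (k (affRoot α m))) hp 0 q
    rw [zero_add, zero_add, affRoot_zero] at h1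
    push_cast at h1
    rw [h1, Finset.Ico_eq_empty (by omega : ¬(1 : ℤ) < -(2 * (q : ℤ)) + 1), Finset.prod_empty,
      mul_one, zpow_natCast]
  · obtain ⟨N, rfl⟩ : ∃ N : ℕ, q = -N := ⟨(-q).toNat, by omega⟩
    have h1 := prod_Ico_of_periodic
      (p := fun m => factor lam (-α) (k (affRoot (-α) m))) hp' 1 N
    have h2 : -(2 * -(N : ℤ)) + 1 = 1 + (2 * N : ℕ) := by push_cast; ring
    -- The interval for -α starts at 1, so one period carries the multiplicities of -α + 1 and -α +
    -- 2, which are those of α - 1 and α - 2. Periodicity moves them to α + 1 and α.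
    have h3 : k (affRoot α (-1)) = k (affRoot α 1) := by
      rw [← mult_affRoot_add_two hk hα.1 (-1)]
      norm_num
    have h4 : k (affRoot α (-2)) = k (affRoot α 0) := by
      rw [← mult_affRoot_add_two hk hα.1 (-2)]
      norm_num
    rw [Finset.Ico_eq_empty (by omega : ¬(0 : ℤ) < 2 * -(N : ℤ)), Finset.prod_empty, one_mul, h2,
      h1, mult_affRoot_neg hk hα.1, mult_affRoot_neg hk hα.1, show (1 : ℤ) + 1 = 2 by norm_num,
      h3, h4, factor_neg_affRoot hk hlam hα.1, factor_neg_affRoot hk hlam hα.1, affRoot_zero,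
      zpow_neg, zpow_natCast, ← inv_pow, mul_inv, mul_comm]

/-! ### The explicit scalars -/

theorem exists_apply_eq_one_of_orbit {β : Module.Dual ℝ V} (hβ : β ∈ D.orbitTheta)
    (h : ∃ z ∈ D.Y, D.θ z = 1) : ∃ z ∈ D.Y, β z = 1 := by
  obtain ⟨w, hw, rfl⟩ := hβ
  obtain ⟨z, hz, h1⟩ := h
  refine ⟨w z, D.W_apply_mem_Y hw hz, ?_⟩
  change D.θ ((w⁻¹ * w) z) = 1
  simpa using h1

theorem exists_apply_eq_one_of_notMem_orbit {α : Module.Dual ℝ V} (hα : α ∈ D.R)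
    (h : α ∉ D.orbitTheta) : ∃ z ∈ D.Y, α z = 1 := by
  obtain ⟨γ, hγ, n, hodd, hn⟩ := exists_odd_of_notMem_orbitTheta hα h
  exact exists_apply_eq_one hα (D.covector_mem_Y hγ) hn hodd

/-- An odd value of θ on Y could be corrected to 1, against the assumption. Stability of Y under W
carries this to the whole orbit. -/
theorem exists_two_mul_of_orbit {β : Module.Dual ℝ V} (hβ : β ∈ D.orbitTheta)
    (h : ¬∃ z ∈ D.Y, D.θ z = 1) (y : D.Y) : ∃ q : ℤ, β (y : V) = (2 * q : ℤ) := by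
  obtain ⟨w, hw, rfl⟩ := hβ
  have hy := D.W_apply_mem_Y (D.W.inv_mem hw) y.2
  obtain ⟨n, hn⟩ := D.exists_int_of_mem_Y D.isHighestRoot.mem hy
  rcases Int.even_or_odd n with he | ho
  · obtain ⟨q, rfl⟩ := he
    exact ⟨q, by rw [two_mul]; exact hn⟩
  · exact absurd (exists_apply_eq_one D.isHighestRoot.mem hy hn ho) h

theorem mult_orbit (hk : D.IsMultiplicity k) {β : Module.Dual ℝ V} (hβ : β ∈ D.orbitTheta) :
    k β.toAffineMap = k D.θ.toAffineMap ∧ k (affRoot β 1) = k D.a₀ := by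
  obtain ⟨w, hw, rfl⟩ := hβ
  have hθ := D.isHighestRoot.mem
  refine ⟨mult_comp hk ⟨w, hw⟩ hθ, ?_⟩
  have h1 : affRoot (D.θ ∘ₗ ((w⁻¹ : V ≃ₗ[ℝ] V) : V →ₗ[ℝ] V)) 1 =
      D.act (D.ofW ⟨w, hw⟩) (affRoot D.θ 1) := (D.act_ofW_add_const ⟨w, hw⟩ D.θ _).symm
  have h2 : D.a₀ = affRoot (-D.θ) 1 := by
    simp [a₀, affRoot]
  -- The chain is k(-θ + 1) = k(θ - 1) = k(θ + 1), by invariance under sign and under shifts by 2.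
  rw [h1, hk _ _ (affRoot_mem hθ 1), h2, mult_affRoot_neg hk hθ,
    ← mult_affRoot_add_two hk hθ (-1)]
  norm_num

/-- Roots outside Wθ always have constant multiplicity along α + ℤ. Those in Wθ have it when θ takes
the value 1 on Y; otherwise they take even values, and the two parities are counted separately. -/
theorem scalarJ_transl (hk : D.IsMultiplicity k) (hlam : lam ∈ D.Creg k) (y : D.Y) :
    D.scalarJ k (D.transl y) lam = D.jScalar k y lam := by
  have hfloor : ∀ α ∈ D.R, ⌊(-α) (y : V)⌋ = -⌊α (y : V)⌋ := by
    intro α hα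
    obtain ⟨n, hn⟩ := D.exists_int_of_mem_Y hα y.2
    rw [LinearMap.neg_apply, hn, ← Int.cast_neg, Int.floor_intCast, Int.floor_intCast]
  have hconst : ∀ α ∈ D.posRoots, (∃ z ∈ D.Y, α z = 1) →
      D.rootProd k lam α ⌊α (y : V)⌋ * D.rootProd k lam (-α) ⌊(-α) (y : V)⌋ =
        factor lam α (k α.toAffineMap) ^ ⌊α (y : V)⌋ := by
    intro α hα h
    rw [hfloor α hα.1]
    exact rootProd_mul_of_const hk hlam hα (mult_affRoot_const hk hα.1 h) _
  have hprod : D.inversionProd k lam (D.transl y) = ∏ᶠ α ∈ D.posRoots,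
      D.rootProd k lam α ⌊α (y : V)⌋ * D.rootProd k lam (-α) ⌊(-α) (y : V)⌋ := by
    rw [inversionProd_transl]
    exact (finprod_mem_eq_finite_toFinset_prod _ _).symm
  rw [scalarJ_eq_inversionProd hk hlam, hprod, jScalar]
  split_ifs with h
  · refine finprod_mem_congr rfl fun α hα => hconst α hα ?_
    by_cases hO : α ∈ D.orbitTheta
    · exact exists_apply_eq_one_of_orbit hO h
    · exact exists_apply_eq_one_of_notMem_orbit hα.1 hO
  · rw [← finprod_mem_inter_mul_sdiff D.orbitTheta posRoots_finite, mul_comm]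
    congr 1
    · exact finprod_mem_congr rfl fun α hα =>
        hconst α hα.1 (exists_apply_eq_one_of_notMem_orbit hα.1.1 hα.2)
    · refine finprod_mem_congr rfl fun β hβ => ?_
      obtain ⟨q, hq⟩ := exists_two_mul_of_orbit hβ.2 h y
      have hq2 : β (y : V) / 2 = (q : ℤ) := by
        rw [hq]
        push_cast
        ring
      obtain ⟨h1, h2⟩ := mult_orbit hk hβ.2
      rw [hfloor β hβ.1.1, hq2, hq, Int.floor_intCast, Int.floor_intCast,
        rootProd_mul_of_even hk hlam hβ.1, h1, h2]

end RootDatum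

end BetheAnsatz

end

/-! ### The Bethe ansatz equations -/

theorem theorem5 {V : Type*} [NormedAddCommGroup V] [InnerProductSpace ℝ V]
    [FiniteDimensional ℝ V] (D : BetheAnsatz.RootDatum V)
    (k : (V →ᵃ[ℝ] ℝ) → ℂ) (hk : D.IsMultiplicity k)
    (lam : V →ₗ[ℝ] ℂ) (hlam : lam ∈ D.Creg k) :
    (∀ {M : Type*} [AddCommGroup M] [Module ℂ M] (ρ : Representation ℂ D.Wa M) (m : M),
      D.psi k ρ lam m ∈ D.FirInvariants k ρ lam ↔
        ∀ y : D.Y, ρ.asAlgebraHom (D.J k (D.transl y) lam) m = Complex.exp (lam (y : V)) • m) ∧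
    (TensorProduct.tmul ℂ (D.psiScalar k lam) (1 : ℂ) ∈
        D.FirInvariants k (Representation.trivial ℂ D.Wa ℂ) lam ↔
      ∀ y : D.Y, D.jScalar k y lam = Complex.exp (lam (y : V))) := by
  refine ⟨fun ρ m => BetheAnsatz.RootDatum.psi_mem_FirInvariants hk hlam ρ m, ?_⟩
  -- Part (ii) is part (i) for the trivial module and m = 1, with the scalar of J_y made explicit.
  rw [BetheAnsatz.RootDatum.psiScalar_tmul hk hlam,
    BetheAnsatz.RootDatum.psi_mem_FirInvariants hk hlam]
  refine forall_congr' fun y => ?_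
  rw [← BetheAnsatz.RootDatum.scalarJ_transl hk hlam y, smul_eq_mul, mul_one]
  rfl
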